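/- Let $M$ be a closed (compact, without boundary) smooth manifold of dimension $n$, and let $J\subseteq\mathbb R$ be a nondegenerate interval. Let $g(t)$, $t\in J$, be a smooth family of Riemannian metrics on $M$ and let $f\colon J\times M\to\mathbb R$ be smooth, such that for all $t\in J$ $$\frac{\partial g_{ij}}{\partial t}=-2R_{ij},\qquad \frac{\partial f}{\partial t}=-\Delta f+|\nabla f|^2-R ,$$ where $R_{ij}$, $R$, $\nabla$, $\Delta$ and $|\cdot|$ are the Ricci tensor (positive on round spheres of dimension at least $2$), the scalar curvature, the Levi-Civita connection, the Laplacian and the norm of $g(t)$, and time derivatives are one-sided at endpoints of $J$ that belong to $J$. Put $$\mathcal F(g,f)=\int_M (R+|\nabla f|^2)\,e^{-f}\,dV ,$$ with $dV$ the Riemannian volume measure of $g$. Then: 1. for every $t\in J$ the integrals below converge absolutely, as does the one that defines $\mathcal F(g(t),f(t))$, and $t\mapsto\mathcal F(g(t),f(t))$ is differentiable on $J$ with $$\frac{d}{dt}\mathcal F(g(t),f(t))=2\int_M |R_{ij}+\nabla_i\nabla_j f|^2\,e^{-f}\,dV\ \ge 0 ;$$ 2. for $t\in J$ this derivative is $0$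 if and only if $(M,g(t))$ is a steady gradient Ricci soliton with potential $f(t)$, that is, $R_{ij}+\nabla_i\nabla_j f=0$ on $M$ at time $t$; 3. $\mathcal F(g(t),f(t))$ is non-decreasing on $J$, and the monotonicity is strict unless we are on a steady gradient soliton: if $t_1<t_2$ in $J$ and $\mathcal F(g(t_1),f(t_1))=\mathcal F(g(t_2),f(t_2))$, then for every $t\in[t_1,t_2]$, $(M,g(t))$ is a steady gradient Ricci soliton with potential $f(t)$. -/

import Mathlib

open scoped Manifold ContDiff
open MeasureTheory Set

namespace RicciFlow

noncomputable section

/-! ### Local tensor calculus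

`G` is the matrix-valued function `(g_ij)` of a metric in some coordinates, `u` is a function of
these coordinates. -/

/-- The partial derivative `∂_i u` at `y`. -/
def pderiv {n : ℕ} (i : Fin n) (u : EuclideanSpace ℝ (Fin n) → ℝ)
    (y : EuclideanSpace ℝ (Fin n)) : ℝ :=
  fderiv ℝ u y (EuclideanSpace.single i 1)

/-- Christoffel symbols `Γ^k_ij = ½ g^{kl} (∂_i g_jl + ∂_j g_il - ∂_l g_ij)`. -/
def christoffel {n : ℕ} (G : EuclideanSpace ℝ (Fin n) → Matrix (Fin n) (Fin n) ℝ)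
    (k i j : Fin n) (y : EuclideanSpace ℝ (Fin n)) : ℝ :=
  (1 / 2 : ℝ) * ∑ l, (G y)⁻¹ k l *
    (pderiv i (fun z ↦ G z j l) y + pderiv j (fun z ↦ G z i l) y - pderiv l (fun z ↦ G z i j) y)

/-- Riemann tensor: `R(∂_i, ∂_j) ∂_l = R_{ijl}^h ∂_h`, for
`R(X, Y) Z = ∇_X ∇_Y Z - ∇_Y ∇_X Z - ∇_[X,Y] Z`. -/
def riemann {n : ℕ} (G : EuclideanSpace ℝ (Fin n) → Matrix (Fin n) (Fin n) ℝ)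
    (h i j l : Fin n) (y : EuclideanSpace ℝ (Fin n)) : ℝ :=
  pderiv i (christoffel G h j l) y - pderiv j (christoffel G h i l) y
    + ∑ p, (christoffel G h i p y * christoffel G p j l y
      - christoffel G h j p y * christoffel G p i l y)

/-- Ricci tensor `R_jl = R_{ijl}^i`, the trace of `X ↦ R(X, ∂_j) ∂_l` (round spheres have positive
Ricci curvature). -/
def ricci {n : ℕ} (G : EuclideanSpace ℝ (Fin n) → Matrix (Fin n) (Fin n) ℝ)
    (j l : Fin n) (y : EuclideanSpace ℝ (Fin n)) : ℝ :=
  ∑ i, riemann G i i j l y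

/-- Scalar curvature `R = g^{jl} R_jl`. -/
def scalar {n : ℕ} (G : EuclideanSpace ℝ (Fin n) → Matrix (Fin n) (Fin n) ℝ)
    (y : EuclideanSpace ℝ (Fin n)) : ℝ :=
  ∑ j, ∑ l, (G y)⁻¹ j l * ricci G j l y

/-- `|∇u|² = g^{ij} ∂_i u ∂_j u`. -/
def gradSq {n : ℕ} (G : EuclideanSpace ℝ (Fin n) → Matrix (Fin n) (Fin n) ℝ)
    (u : EuclideanSpace ℝ (Fin n) → ℝ) (y : EuclideanSpace ℝ (Fin n)) : ℝ :=
  ∑ i, ∑ j, (G y)⁻¹ i j * pderiv i u y * pderiv j u y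

/-- Hessian `∇_i ∇_j u = ∂_i ∂_j u - Γ^k_ij ∂_k u`. -/
def hessian {n : ℕ} (G : EuclideanSpace ℝ (Fin n) → Matrix (Fin n) (Fin n) ℝ)
    (u : EuclideanSpace ℝ (Fin n) → ℝ) (i j : Fin n) (y : EuclideanSpace ℝ (Fin n)) : ℝ :=
  pderiv i (pderiv j u) y - ∑ k, christoffel G k i j y * pderiv k u y

/-- Laplacian `Δu = g^{ij} ∇_i ∇_j u`. -/
def laplacian {n : ℕ} (G : EuclideanSpace ℝ (Fin n) → Matrix (Fin n) (Fin n) ℝ)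
    (u : EuclideanSpace ℝ (Fin n) → ℝ) (y : EuclideanSpace ℝ (Fin n)) : ℝ :=
  ∑ i, ∑ j, (G y)⁻¹ i j * hessian G u i j y

/-- The squared norm `|R_ij + ∇_i ∇_j u|²`, where `|T|² = g^{ik} g^{jl} T_ij T_kl`. -/
def ricciHessSq {n : ℕ} (G : EuclideanSpace ℝ (Fin n) → Matrix (Fin n) (Fin n) ℝ)
    (u : EuclideanSpace ℝ (Fin n) → ℝ) (y : EuclideanSpace ℝ (Fin n)) : ℝ :=
  ∑ i, ∑ j, ∑ k, ∑ l, (G y)⁻¹ i k * (G y)⁻¹ j l *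
    (ricci G i j y + hessian G u i j y) * (ricci G k l y + hessian G u k l y)

/-! ### Riemannian metrics on a manifold -/

/-- Smooth Riemannian metrics on the `n`-dimensional manifold `M`. -/
abbrev Metric (n : ℕ) (M : Type*) [TopologicalSpace M]
    [ChartedSpace (EuclideanSpace ℝ (Fin n)) M] [IsManifold (𝓡 n) ∞ M] :=
  Bundle.ContMDiffRiemannianMetric (IB := 𝓡 n) (n := ∞) (EuclideanSpace ℝ (Fin n))
    (fun x : M ↦ TangentSpace (𝓡 n) x)

section Manifold

variable {n : ℕ} {M : Type*} [TopologicalSpace M] [ChartedSpace (EuclideanSpace ℝ (Fin n)) M]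

/-- The coordinate vector field `∂_i` of the preferred chart around `q`, at the point with
coordinates `y`. -/
def coordVec (q : M) (i : Fin n) (y : EuclideanSpace ℝ (Fin n)) :
    TangentSpace (𝓡 n) ((extChartAt (𝓡 n) q).symm y) :=
  mfderiv (𝓡 n) (𝓡 n) (extChartAt (𝓡 n) q).symm y (EuclideanSpace.single i (1 : ℝ))

/-- The function `u` in the preferred chart around `q`. -/
def inChart (q : M) (u : M → ℝ) (y : EuclideanSpace ℝ (Fin n)) : ℝ :=
  u ((extChartAt (𝓡 n) q).symm y)

variable [IsManifold (𝓡 n) ∞ M]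

/-- The matrix `g_ij = g(∂_i, ∂_j)` in the preferred chart around `q`, as a function on (the target
of) this chart. -/
def metricCoeff (g : Metric n M) (q : M) (y : EuclideanSpace ℝ (Fin n)) :
    Matrix (Fin n) (Fin n) ℝ :=
  Matrix.of fun i j ↦ g.inner ((extChartAt (𝓡 n) q).symm y) (coordVec q i y) (coordVec q j y)

/-- The scalar curvature of `g` at `p` (computed in the preferred chart around `p`; the value does
not depend on the chart; likewise for the next three definitions). -/
def scalarCurvature (g : Metric n M) (p : M) : ℝ :=
  scalar (metricCoeff g p) (extChartAt (𝓡 n) p p)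

/-- `|∇u|²` at `p`. -/
def gradNormSq (g : Metric n M) (u : M → ℝ) (p : M) : ℝ :=
  gradSq (metricCoeff g p) (inChart p u) (extChartAt (𝓡 n) p p)

/-- The Laplacian `Δu` at `p`. -/
def laplaceBeltrami (g : Metric n M) (u : M → ℝ) (p : M) : ℝ :=
  laplacian (metricCoeff g p) (inChart p u) (extChartAt (𝓡 n) p p)

/-- `|Ric + Hess u|²` at `p`. -/
def ricciHessNormSq (g : Metric n M) (u : M → ℝ) (p : M) : ℝ :=
  ricciHessSq (metricCoeff g p) (inChart p u) (extChartAt (𝓡 n) p p)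

/-- The measure `√(det g_ij) dy` of the preferred chart around `q`, carried over to `M` (where it is
concentrated on the chart domain). -/
def chartVolume [MeasurableSpace M] (g : Metric n M) (q : M) : Measure M :=
  Measure.map (extChartAt (𝓡 n) q).symm
    ((volume.restrict (extChartAt (𝓡 n) q).target).withDensity
      fun y ↦ ENNReal.ofReal (Real.sqrt (metricCoeff g q y).det))

/-- The Riemannian volume measure `dV` of `g`: the measure that is `√(det g_ij) dy` in every chart.
The chart measures agree on overlaps, so that it is their supremum. -/
def riemannianVolume [MeasurableSpace M] (g : Metric n M) : Measure M :=
  ⨆ q : M, chartVolume g q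

/-- The functional `𝓕(g, f) = ∫ (R + |∇f|²) e^{-f} dV`. -/
def functionalF [MeasurableSpace M] (g : Metric n M) (f : M → ℝ) : ℝ :=
  ∫ p, (scalarCurvature g p + gradNormSq g f p) * Real.exp (-f p) ∂(riemannianVolume g)

/-- `∫ |Ric + Hess f|² e^{-f} dV`. -/
def solitonEnergy [MeasurableSpace M] (g : Metric n M) (f : M → ℝ) : ℝ :=
  ∫ p, ricciHessNormSq g f p * Real.exp (-f p) ∂(riemannianVolume g)

/-- `(M, g, ∇f)` is a steady gradient Ricci soliton: `f` is smooth and `Ric + Hess f = 0`, i.e.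
`R_ij + ∇_i ∇_j f = 0` throughout every chart. -/
def IsSteadyGradientSoliton (g : Metric n M) (f : M → ℝ) : Prop :=
  ContMDiff (𝓡 n) 𝓘(ℝ, ℝ) ∞ f ∧
    ∀ q : M, ∀ y ∈ (extChartAt (𝓡 n) q).target, ∀ i j : Fin n,
      ricci (metricCoeff g q) i j y + hessian (metricCoeff g q) (inChart q f) i j y = 0

/-- `g(t)`, `t ∈ J`, is a smooth family of metrics: in every chart the coefficients `g_ij(t, y)` are
smooth functions of `(t, y)` jointly. -/
def IsSmoothFamily (J : Set ℝ) (g : ℝ → Metric n M) : Prop :=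
  ∀ q : M, ∀ i j : Fin n,
    ContDiffOn ℝ ∞ (fun z : ℝ × EuclideanSpace ℝ (Fin n) ↦ metricCoeff (g z.1) q z.2 i j)
      (J ×ˢ (extChartAt (𝓡 n) q).target)

/-- `g(t)`, `t ∈ J`, is a smooth solution of the Ricci flow `∂_t g_ij = -2 R_ij` (in every chart;
one-sided time derivatives at endpoints that belong to `J`). -/
def IsRicciFlow (J : Set ℝ) (g : ℝ → Metric n M) : Prop :=
  IsSmoothFamily J g ∧
    ∀ t ∈ J, ∀ q : M, ∀ y ∈ (extChartAt (𝓡 n) q).target, ∀ i j : Fin n,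
      HasDerivWithinAt (fun s ↦ metricCoeff (g s) q y i j)
        (-2 * ricci (metricCoeff (g t) q) i j y) J t

/-- `f(t)`, `t ∈ J`, is a smooth solution of `∂_t f = -Δf + |∇f|² - R` along the family `g(t)`. -/
def IsPotentialFlow (J : Set ℝ) (g : ℝ → Metric n M) (f : ℝ → M → ℝ) : Prop :=
  ContMDiffOn (𝓘(ℝ, ℝ).prod (𝓡 n)) 𝓘(ℝ, ℝ) ∞ (fun z : ℝ × M ↦ f z.1 z.2) (J ×ˢ univ) ∧
    ∀ t ∈ J, ∀ p : M,
      HasDerivWithinAt (fun s ↦ f s p)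
        (-laplaceBeltrami (g t) (f t) p + gradNormSq (g t) (f t) p - scalarCurvature (g t) p) J t

end Manifold

end

end RicciFlow

/-! Put v = (R + 2Δf - |∇f|²) e^{-f}. Since Δe^{-f} = (|∇f|² - Δf) e^{-f}, the integrand of 𝓕 is v +
2Δe^{-f}. A Laplacian integrates to zero on a closed manifold, so 𝓕 = ∫ v dV. Under the two flows
∂_t v = -Δv + R v + 2|Ric + Hess f|² e^{-f}, while ∂_t dV = -R dV. In the derivative of ∫ v dV the
terms with R v cancel and Δv integrates to zero, which leaves 2∫ |Ric + Hess f|² e^{-f} dV. This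
integrand is continuous and nonnegative and dV charges every nonempty open set, so the integral
vanishes only for solitons. If 𝓕 agrees at two times, monotonicity makes it constant in between, and
its derivative vanishes on the closed interval.

The pointwise equation for v is `Evolves.dt_harnack_mul`. It combines the evolutions of R, Δ and
|∇f|² with the Bochner formula; the quadratic terms complete to |Ric + Hess f|². The contracted
second Bianchi identity enters through g^{ij} ∂_t Γ^k_ij = 0 (`Evolves.sum_H_dt_Γ`), which removes
all derivatives of Ric from ∂_t Δ.

These identities only use the Leibniz rule and commuting derivatives. They are therefore proved in
an arbitrary commutative ℝ-algebra with n derivations and an invertible symmetric matrix, where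
smoothness never has to be mentioned. The smooth functions on J × U, for a chart with coordinates in
U, form such an algebra, and `FrameGeometry.Realizes` translates its elements into the coordinate
formulas of the statement. Those formulas are evaluated at p in the chart around p, so invariance
under change of chart is needed before a whole chart can be treated at once; this too is algebra
(`FrameGeometry.Change`), applied to transition maps in `Transition`.

The analysis consists of three facts: the supremum of the chart measures restricts to each chart as
that chart's own measure, the divergence theorem, and differentiation under the integral. The last
two are proved for functions supported in one chart and globalised by a partition of unity, which
does not depend on time. -/

namespace RicciFlow

noncomputable section

/-! ### Riemannian geometry over a differential ring -/

section DifferentialRing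

variable {n : ℕ} {A : Type*} [CommRing A] [Algebra ℝ A]

/-- A coordinate frame of derivations of a ring `A` with a metric `G` and its inverse `H`. -/
structure FrameGeometry (n : ℕ) (A : Type*) [CommRing A] [Algebra ℝ A] where
  D : Fin n → Derivation ℝ A A
  G : Matrix (Fin n) (Fin n) A
  H : Matrix (Fin n) (Fin n) A
  symm : ∀ i j, G i j = G j i
  mul_inv : G * H = 1

theorem map_derivation_mul (d : Derivation ℝ A A) (M N : Matrix (Fin n) (Fin n) A) :
    (M * N).map d = M.map d * N + M * N.map d := by
  ext i j
  simp only [Matrix.map_apply, Matrix.mul_apply, Matrix.add_apply, map_sum, Derivation.leibniz,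
    smul_eq_mul, ← Finset.sum_add_distrib]
  exact Finset.sum_congr rfl fun k _ ↦ by ring

theorem map_derivation_one (d : Derivation ℝ A A) :
    (1 : Matrix (Fin n) (Fin n) A).map d = 0 := by
  ext i j
  simp only [Matrix.map_apply, Matrix.one_apply, Matrix.zero_apply]
  split_ifs <;> simp

theorem map_derivation_add (d : Derivation ℝ A A) (M N : Matrix (Fin n) (Fin n) A) :
    (M + N).map d = M.map d + N.map d := by
  ext i j; simp

theorem map_derivation_sub (d : Derivation ℝ A A) (M N : Matrix (Fin n) (Fin n) A) :
    (M - N).map d = M.map d - N.map d := by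
  ext i j; simp

theorem map_derivation_neg (d : Derivation ℝ A A) (M : Matrix (Fin n) (Fin n) A) :
    (-M).map d = -(M.map d) := by
  ext i j; simp

theorem map_derivation_transpose (d : Derivation ℝ A A) (M : Matrix (Fin n) (Fin n) A) :
    M.transpose.map d = (M.map d).transpose := rfl

theorem half_smul_two_mul (a : A) : (1 / 2 : ℝ) • (2 * a) = a := by
  rw [two_mul, ← two_smul ℝ a, smul_smul]; norm_num

/-- Halves exist in an ℝ-algebra. Identities with Christoffel symbols are proved after doubling,
which clears their factor ½. -/
theorem two_mul_cancel {a b : A} (h : 2 * a = 2 * b) : a = b := by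
  rw [← half_smul_two_mul a, h, half_smul_two_mul]

/-! ### Levi-Civita connection, symmetries of curvature, second Bianchi identity. -/

namespace FrameGeometry

variable (S : FrameGeometry n A)

/-- The frame consists of commuting derivations. -/
def IsCoordinate : Prop := ∀ i j a, S.D i (S.D j a) = S.D j (S.D i a)

/-- Connection matrices `(Γ_i)^k_j`. -/
def Γ (i : Fin n) : Matrix (Fin n) (Fin n) A :=
  Matrix.of fun k j ↦ (1 / 2 : ℝ) • ∑ l, S.H k l *
    (S.D i (S.G j l) + S.D j (S.G i l) - S.D l (S.G i j))

/-- Curvature matrices `(R_ij)^h_l`. -/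
def Rm (i j : Fin n) : Matrix (Fin n) (Fin n) A :=
  (S.Γ j).map (S.D i) - (S.Γ i).map (S.D j) + (S.Γ i * S.Γ j - S.Γ j * S.Γ i)

/-- Ricci tensor. -/
def Ric : Matrix (Fin n) (Fin n) A := Matrix.of fun j l ↦ ∑ i, S.Rm i j i l

/-- Scalar curvature. -/
def Scal : A := ∑ j, ∑ l, S.H j l * S.Ric j l

/-- The gradient pairing `⟨∇a, ∇b⟩`. -/
def grad (a b : A) : A := ∑ i, ∑ j, S.H i j * S.D i a * S.D j b

/-- Hessian matrix. -/
def Hess (u : A) : Matrix (Fin n) (Fin n) A :=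
  Matrix.of fun i j ↦ S.D i (S.D j u) - ∑ k, S.Γ i k j * S.D k u

/-- Laplacian. -/
def lap (u : A) : A := ∑ i, ∑ j, S.H i j * S.Hess u i j

/-- The pairing of bilinear forms induced by the metric. -/
def pair (B C : Matrix (Fin n) (Fin n) A) : A :=
  ∑ i, ∑ j, ∑ k, ∑ l, S.H i k * S.H j l * B i j * C k l

theorem transpose_G : S.G.transpose = S.G := by
  ext i j; exact S.symm j i

theorem inv_mul : S.H * S.G = 1 := mul_eq_one_comm.mp S.mul_inv

theorem transpose_H : S.H.transpose = S.H := by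
  have h : S.H.transpose * S.G = 1 := by
    rw [← S.transpose_G, ← Matrix.transpose_mul, S.mul_inv, Matrix.transpose_one]
  calc S.H.transpose = S.H.transpose * (S.G * S.H) := by rw [S.mul_inv, mul_one]
    _ = S.H := by rw [← mul_assoc, h, one_mul]

theorem H_symm (i j : Fin n) : S.H i j = S.H j i := by
  conv_lhs => rw [← S.transpose_H]
  rfl

theorem Γ_symm (i j k : Fin n) : S.Γ i k j = S.Γ j k i := by
  simp only [Γ, Matrix.of_apply]
  congr 1
  exact Finset.sum_congr rfl fun l _ ↦ by rw [S.symm i j]; ring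

/-- Koszul's formula: without the inverse metric and the ½, the symbols are linear in the
derivatives of the metric. -/
theorem lower_Γ (i j m : Fin n) : 2 * ∑ k, S.G m k * S.Γ i k j =
    S.D i (S.G j m) + S.D j (S.G i m) - S.D m (S.G i j) := by
  simp only [Γ, Matrix.of_apply, mul_smul_comm, ← Finset.smul_sum]
  rw [half_smul_two_mul]
  simp only [Finset.mul_sum, ← mul_assoc]
  rw [Finset.sum_comm]
  simp only [← Finset.sum_mul, ← Matrix.mul_apply, S.mul_inv, Matrix.one_apply, ite_mul, one_mul,
    zero_mul, Finset.sum_ite_eq, Finset.mem_univ, if_true]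

/-- Metric compatibility ∇g = 0 in matrix form: two instances of Koszul's formula, with the lower
indices exchanged, add up to twice the derivative. -/
theorem map_D_G (i : Fin n) :
    S.G.map (S.D i) = (S.Γ i).transpose * S.G + S.G * S.Γ i := by
  ext j l
  apply two_mul_cancel
  simp only [Matrix.map_apply, Matrix.add_apply, Matrix.mul_apply, Matrix.transpose_apply, mul_add]
  rw [S.lower_Γ i l j]
  have h := S.lower_Γ i j l
  have h' : ∑ k, S.Γ i k j * S.G k l = ∑ k, S.G l k * S.Γ i k j :=
    Finset.sum_congr rfl fun k _ ↦ by rw [S.symm k l, mul_comm]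
  rw [h', h, S.symm l j, S.symm i j, S.symm i l]
  ring

theorem map_H (d : Derivation ℝ A A) : S.H.map d = -(S.H * S.G.map d * S.H) := by
  have h := map_derivation_mul d S.H S.G
  rw [S.inv_mul, map_derivation_one] at h
  have h' : S.H.map d * S.G = -(S.H * S.G.map d) := by
    rw [eq_neg_iff_add_eq_zero, ← h]
  calc S.H.map d = S.H.map d * S.G * S.H := by rw [mul_assoc, S.mul_inv, mul_one]
    _ = _ := by rw [h', neg_mul]

theorem map_D_H (i : Fin n) :
    S.H.map (S.D i) = -(S.H * (S.Γ i).transpose + S.Γ i * S.H) := by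
  have h : S.H * ((S.Γ i).transpose * S.G + S.G * S.Γ i) * S.H =
      S.H * (S.Γ i).transpose * (S.G * S.H) + (S.H * S.G) * S.Γ i * S.H := by noncomm_ring
  rw [S.map_H, S.map_D_G, h, S.mul_inv, S.inv_mul, mul_one, one_mul]

theorem D_H (i k l : Fin n) :
    S.D i (S.H k l) = -(∑ p, S.H k p * S.Γ i l p + ∑ p, S.Γ i k p * S.H p l) := by
  have h := congrFun₂ (S.map_D_H i) k l
  simpa [Matrix.mul_apply] using h

theorem Rm_antisymm (i j : Fin n) : S.Rm i j = -S.Rm j i := by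
  simp only [Rm]; abel

theorem map_D_comm (comm : S.IsCoordinate) (i j : Fin n)
    (M : Matrix (Fin n) (Fin n) A) :
    (M.map (S.D i)).map (S.D j) = (M.map (S.D j)).map (S.D i) := by
  ext k l; exact comm _ _ _

/-- The curvature with its last index raised. -/
def W (i j : Fin n) : Matrix (Fin n) (Fin n) A := S.Rm i j * S.H

theorem W_antisymm (i j : Fin n) : S.W i j = -S.W j i := by
  rw [W, S.Rm_antisymm, neg_mul, W]

/-- Skew-symmetry of curvature in its endomorphism indices, from the Ricci identity for the parallel
tensor `H`: expanding D_i D_j H = D_j D_i H by `map_D_H` leaves exactly R_ij H plus its transpose.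
-/
theorem W_transpose (comm : S.IsCoordinate) (i j : Fin n) :
    (S.W i j).transpose = -S.W i j := by
  have h := S.map_D_comm comm i j S.H
  simp only [S.map_D_H, map_derivation_neg, map_derivation_add, map_derivation_mul,
    map_derivation_transpose] at h
  rw [W, Matrix.transpose_mul, S.transpose_H, Rm]
  simp only [Matrix.transpose_add, Matrix.transpose_sub, Matrix.transpose_mul]
  rw [← sub_eq_zero] at h ⊢
  rw [← h]
  noncomm_ring

theorem W_transpose_apply (comm : S.IsCoordinate)
    (i j k l : Fin n) : S.W i j k l = -S.W i j l k :=
  congrFun₂ (S.W_transpose comm i j) l k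

/-- The identity d_A F_A = 0 for the curvature of any connection matrices; symmetry of Γ plays no
role. The Christoffel terms for the form indices are not written because a torsion-free connection
cancels them in the cyclic sum. -/
theorem bianchi (comm : S.IsCoordinate) (k i j : Fin n) :
    ((S.Rm i j).map (S.D k) + S.Γ k * S.Rm i j - S.Rm i j * S.Γ k) +
    ((S.Rm j k).map (S.D i) + S.Γ i * S.Rm j k - S.Rm j k * S.Γ i) +
    ((S.Rm k i).map (S.D j) + S.Γ j * S.Rm k i - S.Rm k i * S.Γ j) = 0 := by
  simp only [Rm, map_derivation_add, map_derivation_sub, map_derivation_mul]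
  rw [S.map_D_comm comm i k (S.Γ j), S.map_D_comm comm j k (S.Γ i), S.map_D_comm comm i j (S.Γ k)]
  noncomm_ring

end FrameGeometry

/-! ### Contracted second Bianchi identity. -/

namespace FrameGeometry

variable (S : FrameGeometry n A)

/-- The Ricci tensor with its last index raised. -/
def RicMixed : Matrix (Fin n) (Fin n) A := S.Ric * S.H

/-- The Ricci tensor with both indices raised. -/
def RicUp : Matrix (Fin n) (Fin n) A := S.H * S.Ric * S.H

theorem sum_W_left (j m : Fin n) : ∑ a, S.W a j a m = S.RicMixed j m := by
  simp only [W, RicMixed, Matrix.mul_apply, Ric, Matrix.of_apply, Finset.sum_mul]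
  exact Finset.sum_comm

theorem Scal_eq_trace : S.Scal = ∑ j, S.RicMixed j j := by
  simp only [Scal, RicMixed, Matrix.mul_apply]
  exact Finset.sum_congr rfl fun j _ ↦ Finset.sum_congr rfl fun l _ ↦ by
    rw [S.H_symm j l, mul_comm]

theorem sum_W_right (comm : S.IsCoordinate) (a p : Fin n) : ∑ j, S.W a j p j = S.RicMixed a p := by
  rw [← S.sum_W_left]
  exact Finset.sum_congr rfl fun j _ ↦ by
    rw [S.W_transpose_apply comm, S.W_antisymm a j, Matrix.neg_apply, neg_neg]

theorem sum_W_mixed (comm : S.IsCoordinate) (k a : Fin n) : ∑ j, S.W j k a j = -S.RicMixed k a := by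
  rw [← S.sum_W_right comm, ← Finset.sum_neg_distrib]
  exact Finset.sum_congr rfl fun j _ ↦ by rw [S.W_antisymm k j, Matrix.neg_apply, neg_neg]

theorem bianchi_raised (comm : S.IsCoordinate) (k i j : Fin n) :
    ((S.W i j).map (S.D k) + S.W i j * (S.Γ k).transpose + S.Γ k * S.W i j) +
    ((S.W j k).map (S.D i) + S.W j k * (S.Γ i).transpose + S.Γ i * S.W j k) +
    ((S.W k i).map (S.D j) + S.W k i * (S.Γ j).transpose + S.Γ j * S.W k i) = 0 := by
  have h := congrArg (· * S.H) (S.bianchi comm k i j)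
  simp only [zero_mul] at h
  rw [← h]
  simp only [W, map_derivation_mul, S.map_D_H]
  noncomm_ring

/-- This is ∇_k R = 2 ∇_a R_k^a. In the doubly traced Bianchi identity the first cyclic term gives
∇_k R, and the other two each give minus the divergence of Ric. -/
theorem contracted_bianchi (comm : S.IsCoordinate) (k : Fin n) :
    S.D k S.Scal = 2 * (∑ a, S.D a (S.RicMixed k a) + ∑ p, (∑ a, S.Γ a a p) * S.RicMixed k p
      - ∑ j, ∑ p, S.RicMixed j p * S.Γ k j p) := by
  -- Both upper indices of the raised curvature are contracted with the form indices a and j.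
  have key : ∑ a, ∑ j, ((((S.W a j).map (S.D k) + S.W a j * (S.Γ k).transpose
      + S.Γ k * S.W a j) a j) + (((S.W j k).map (S.D a) + S.W j k * (S.Γ a).transpose
      + S.Γ a * S.W j k) a j) + (((S.W k a).map (S.D j) + S.W k a * (S.Γ j).transpose
      + S.Γ j * S.W k a) a j)) = 0 :=
    Finset.sum_eq_zero fun a _ ↦ Finset.sum_eq_zero fun j _ ↦
      congrFun₂ (S.bianchi_raised comm k a j) a j
  simp only [Finset.sum_add_distrib, Matrix.add_apply, Matrix.map_apply, Matrix.mul_apply,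
    Matrix.transpose_apply] at key
  have a1 : ∑ a, ∑ j, S.D k (S.W a j a j) = S.D k S.Scal := by
    rw [Finset.sum_comm, S.Scal_eq_trace, map_sum]
    simp only [← map_sum, S.sum_W_left]
  have a2 : ∑ a, ∑ j, ∑ p, S.W a j a p * S.Γ k j p = ∑ j, ∑ p, S.RicMixed j p * S.Γ k j p := by
    rw [Finset.sum_comm]
    refine Finset.sum_congr rfl fun j _ ↦ ?_
    rw [Finset.sum_comm]
    simp only [← Finset.sum_mul, S.sum_W_left]
  have a3 : ∑ a, ∑ j, ∑ p, S.Γ k a p * S.W a j p j = ∑ j, ∑ p, S.RicMixed j p * S.Γ k j p := by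
    refine Finset.sum_congr rfl fun a _ ↦ ?_
    rw [Finset.sum_comm]
    simp only [← Finset.mul_sum, S.sum_W_right comm]
    exact Finset.sum_congr rfl fun p _ ↦ mul_comm _ _
  have b1 : ∑ a, ∑ j, S.D a (S.W j k a j) = -∑ a, S.D a (S.RicMixed k a) := by
    simp only [← map_sum, S.sum_W_mixed comm, map_neg, Finset.sum_neg_distrib]
  -- The curvature is skew in a, p and Γ is symmetric in them, so the sum equals its own negative.
  have b2 : ∑ a, ∑ j, ∑ p, S.W j k a p * S.Γ a j p = 0 := by
    rw [Finset.sum_comm]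
    refine Finset.sum_eq_zero fun j _ ↦ ?_
    apply two_mul_cancel
    rw [two_mul]
    nth_rw 2 [Finset.sum_comm]
    rw [← Finset.sum_add_distrib, mul_zero]
    refine Finset.sum_eq_zero fun a _ ↦ ?_
    rw [← Finset.sum_add_distrib]
    refine Finset.sum_eq_zero fun p _ ↦ ?_
    rw [S.W_transpose_apply comm, S.Γ_symm a p j]
    ring
  have b3 : ∑ a, ∑ j, ∑ p, S.Γ a a p * S.W j k p j =
      -∑ p, (∑ a, S.Γ a a p) * S.RicMixed k p := by
    simp only [Finset.sum_mul]
    rw [Finset.sum_comm (f := fun p a ↦ S.Γ a a p * S.RicMixed k p), ← Finset.sum_neg_distrib]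
    refine Finset.sum_congr rfl fun a _ ↦ ?_
    rw [Finset.sum_comm, ← Finset.sum_neg_distrib]
    simp only [← Finset.mul_sum, S.sum_W_mixed comm, mul_neg]
  -- The third cyclic term becomes the second when a and j are exchanged and both skew-symmetries
  -- are used; `c2` and `c3` do the same for the connection terms.
  have c1 : ∑ a, ∑ j, S.D j (S.W k a a j) = ∑ a, ∑ j, S.D a (S.W j k a j) := by
    rw [Finset.sum_comm]
    refine Finset.sum_congr rfl fun a _ ↦ Finset.sum_congr rfl fun j _ ↦ ?_
    rw [S.W_transpose_apply comm, S.W_antisymm, Matrix.neg_apply, neg_neg]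
  have c2 : ∑ a, ∑ j, ∑ p, S.W k a a p * S.Γ j j p = ∑ a, ∑ j, ∑ p, S.Γ a a p * S.W j k p j := by
    rw [Finset.sum_comm]
    refine Finset.sum_congr rfl fun a _ ↦ Finset.sum_congr rfl fun j _ ↦
      Finset.sum_congr rfl fun p _ ↦ ?_
    rw [S.W_transpose_apply comm, S.W_antisymm, Matrix.neg_apply, neg_neg, mul_comm]
  have c3 : ∑ a, ∑ j, ∑ p, S.Γ j a p * S.W k a p j = ∑ a, ∑ j, ∑ p, S.W j k a p * S.Γ a j p := by
    rw [Finset.sum_comm]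
    refine Finset.sum_congr rfl fun a _ ↦ Finset.sum_congr rfl fun j _ ↦
      Finset.sum_congr rfl fun p _ ↦ ?_
    rw [S.W_transpose_apply comm, S.W_antisymm, Matrix.neg_apply, neg_neg, mul_comm]
  rw [c1, c2, c3, a1, a2, a3, b1, b2, b3] at key
  linear_combination key

end FrameGeometry

/-! ### Traces of the connection and the Laplacian in divergence form. -/

namespace FrameGeometry

variable (S : FrameGeometry n A)

theorem RicUp_apply (i j : Fin n) : S.RicUp i j = ∑ p, S.H i p * S.RicMixed p j := by
  rw [RicUp, mul_assoc, Matrix.mul_apply]; rfl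

/-- The trace of the connection, `Γ^a_ap`. -/
def trΓ (p : Fin n) : A := ∑ a, S.Γ a a p

theorem trΓ_eq_trace (p : Fin n) : S.trΓ p = (S.Γ p).trace :=
  Finset.sum_congr rfl fun a _ ↦ S.Γ_symm a p a

/-- Γ^a_ap is the logarithmic derivative of √det g. Both the volume density and the time derivative
of `trΓ` are computed from this trace. -/
theorem two_mul_trΓ (p : Fin n) : 2 * S.trΓ p = (S.H * S.G.map (S.D p)).trace := by
  rw [S.map_D_G, mul_add, Matrix.trace_add, ← mul_assoc, ← mul_assoc, S.inv_mul, one_mul,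
    Matrix.trace_mul_comm, ← mul_assoc, S.mul_inv, one_mul, Matrix.trace_transpose, S.trΓ_eq_trace,
    two_mul]

theorem D_RicUp (a m k : Fin n) : S.D a (S.RicUp m k) =
    ∑ p, S.H m p * S.D a (S.RicMixed p k) - ∑ p, ∑ q, S.H m q * S.Γ a p q * S.RicMixed p k
      - ∑ q, S.Γ a m q * S.RicUp q k := by
  rw [S.RicUp_apply, map_sum]
  simp only [Derivation.leibniz, smul_eq_mul, Finset.sum_add_distrib, S.D_H, mul_neg, mul_add,
    Finset.sum_neg_distrib, Finset.mul_sum, S.RicUp_apply]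
  rw [Finset.sum_comm (f := fun p q ↦ S.RicMixed p k * (S.Γ a m q * S.H q p))]
  have h1 : ∀ p q, S.RicMixed p k * (S.Γ a m q * S.H q p) = S.Γ a m q * (S.H q p * S.RicMixed p k) :=
    fun p q ↦ by ring
  have h2 : ∀ p q, S.RicMixed p k * (S.H m q * S.Γ a p q) = S.H m q * S.Γ a p q * S.RicMixed p k :=
    fun p q ↦ by ring
  simp only [h1, h2]
  ring

theorem contracted_bianchi_raised (comm : S.IsCoordinate) (m : Fin n) :
    ∑ k, S.H m k * S.D k S.Scal = 2 * (∑ a, S.D a (S.RicUp m a) + ∑ p, S.trΓ p * S.RicUp m p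
      + ∑ a, ∑ p, S.Γ a m p * S.RicUp p a) := by
  have h : ∀ k, S.H m k * S.D k S.Scal = 2 * (∑ a, S.H m k * S.D a (S.RicMixed k a)
      + ∑ p, S.trΓ p * (S.H m k * S.RicMixed k p)
      - ∑ j, ∑ p, S.H m k * S.Γ p j k * S.RicMixed j p) := fun k ↦ by
    rw [S.contracted_bianchi comm k]
    simp only [mul_add, mul_sub, Finset.mul_sum, trΓ]
    congr 1
    · congr 1
      · exact Finset.sum_congr rfl fun _ _ ↦ by ring
      · exact Finset.sum_congr rfl fun _ _ ↦ by ring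
    · exact Finset.sum_congr rfl fun _ _ ↦ Finset.sum_congr rfl fun _ _ ↦ by
        rw [S.Γ_symm k]; ring
  rw [Finset.sum_congr rfl fun k _ ↦ h k, ← Finset.mul_sum]
  simp only [Finset.sum_add_distrib, Finset.sum_sub_distrib, S.D_RicUp]
  rw [Finset.sum_comm (f := fun k a ↦ S.H m k * S.D a (S.RicMixed k a)),
    Finset.sum_comm (f := fun k p ↦ S.trΓ p * (S.H m k * S.RicMixed k p))]
  simp only [← Finset.mul_sum, ← S.RicUp_apply]
  have e : ∑ k, ∑ j, ∑ p, S.H m k * S.Γ p j k * S.RicMixed j p =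
      ∑ a, ∑ p, ∑ q, S.H m q * S.Γ a p q * S.RicMixed p a := by
    rw [Finset.sum_comm_cycle]
    exact Finset.sum_congr rfl fun p _ ↦ Finset.sum_comm
  rw [e]
  ring

/-- The contraction `g^ij Γ^k_ij`. -/
def contrΓ (k : Fin n) : A := ∑ i, ∑ j, S.H i j * S.Γ i k j

/-- A contraction of ∇g⁻¹ = 0. It expresses g^{ij} Γ^k_ij through g⁻¹ and `trΓ`, whose time
derivatives are simple, so the full variation of Γ is never needed. -/
theorem contrΓ_eq (k : Fin n) :
    S.contrΓ k = -(∑ i, S.D i (S.H i k) + ∑ i, S.H i k * S.trΓ i) := by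
  simp only [contrΓ, S.D_H, Finset.sum_neg_distrib, Finset.sum_add_distrib, trΓ]
  have e : ∑ i, ∑ p, S.Γ i i p * S.H p k = ∑ i, S.H i k * ∑ a, S.Γ a a i := by
    rw [Finset.sum_comm]
    exact Finset.sum_congr rfl fun i _ ↦ by rw [← Finset.sum_mul, mul_comm]
  rw [e]; ring

/-- The gradient vector field `∇^k u`. -/
def gradVec (u : A) (k : Fin n) : A := ∑ l, S.H k l * S.D l u

theorem lap_eq_sub (u : A) :
    S.lap u = ∑ i, ∑ j, S.H i j * S.D i (S.D j u) - ∑ k, S.contrΓ k * S.D k u := by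
  simp only [lap, Hess, Matrix.of_apply, mul_sub, Finset.sum_sub_distrib, contrΓ, Finset.sum_mul,
    Finset.mul_sum]
  congr 1
  rw [Finset.sum_comm (s := (Finset.univ : Finset (Fin n))) (t := Finset.univ)
    (f := fun k i ↦ ∑ j, S.H i j * S.Γ i k j * S.D k u)]
  refine Finset.sum_congr rfl fun i _ ↦ ?_
  rw [Finset.sum_comm]
  exact Finset.sum_congr rfl fun j _ ↦ Finset.sum_congr rfl fun k _ ↦ by ring

theorem lap_eq_div (u : A) :
    S.lap u = ∑ k, S.D k (S.gradVec u k) + ∑ k, S.trΓ k * S.gradVec u k := by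
  rw [lap_eq_sub]
  simp only [S.contrΓ_eq, gradVec, map_sum, Derivation.leibniz, smul_eq_mul,
    Finset.sum_add_distrib, neg_mul, add_mul, Finset.sum_neg_distrib, Finset.sum_mul,
    Finset.mul_sum]
  rw [Finset.sum_comm (f := fun k i ↦ S.D i (S.H i k) * S.D k u),
    Finset.sum_comm (f := fun k i ↦ S.H i k * S.trΓ i * S.D k u)]
  have h1 : ∀ i k, S.H i k * S.trΓ i * S.D k u = S.trΓ i * (S.H i k * S.D k u) :=
    fun _ _ ↦ by ring
  have h2 : ∀ i k, S.D i (S.H i k) * S.D k u = S.D k u * S.D i (S.H i k) :=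
    fun _ _ ↦ by ring
  simp only [h1, h2]
  ring

theorem pair_eq (B C : Matrix (Fin n) (Fin n) A) :
    S.pair B C = ∑ i, ∑ j, B i j * (S.H * C * S.H) i j := by
  simp only [pair, Matrix.mul_apply, Finset.mul_sum, Finset.sum_mul]
  refine Finset.sum_congr rfl fun i _ ↦ Finset.sum_congr rfl fun j _ ↦ ?_
  rw [Finset.sum_comm]
  exact Finset.sum_congr rfl fun k _ ↦ Finset.sum_congr rfl fun l _ ↦ by
    rw [S.H_symm j]; ring

theorem lap_add (a b : A) : S.lap (a + b) = S.lap a + S.lap b := by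
  simp only [lap_eq_div, gradVec, map_add, mul_add, Finset.sum_add_distrib]; ring

theorem grad_comm (a b : A) : S.grad a b = S.grad b a := by
  rw [grad, Finset.sum_comm]
  exact Finset.sum_congr rfl fun i _ ↦ Finset.sum_congr rfl fun j _ ↦ by
    rw [S.H_symm j i]; ring

theorem grad_eq (a b : A) : S.grad a b = ∑ i, S.D i a * S.gradVec b i := by
  simp only [grad, gradVec, Finset.mul_sum]
  exact Finset.sum_congr rfl fun i _ ↦ Finset.sum_congr rfl fun j _ ↦ by ring

theorem gradVec_mul (a b : A) (k : Fin n) :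
    S.gradVec (a * b) k = a * S.gradVec b k + b * S.gradVec a k := by
  simp only [gradVec, Derivation.leibniz, smul_eq_mul, Finset.mul_sum, ← Finset.sum_add_distrib]
  exact Finset.sum_congr rfl fun i _ ↦ by ring

theorem lap_mul (a b : A) :
    S.lap (a * b) = a * S.lap b + b * S.lap a + 2 * S.grad a b := by
  have h1 := S.grad_eq a b
  have h2 := S.grad_eq b a
  rw [S.grad_comm] at h2
  rw [two_mul]
  nth_rw 1 [h1]
  rw [h2]
  simp only [lap_eq_div, gradVec_mul, map_add, Derivation.leibniz, smul_eq_mul, mul_add,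
    Finset.sum_add_distrib, Finset.mul_sum]
  have e1 : ∀ i, S.gradVec b i * S.D i a = S.D i a * S.gradVec b i := fun _ ↦ mul_comm _ _
  have e2 : ∀ i, S.gradVec a i * S.D i b = S.D i b * S.gradVec a i := fun _ ↦ mul_comm _ _
  have e3 : ∀ i, S.trΓ i * (a * S.gradVec b i) = a * (S.trΓ i * S.gradVec b i) := fun _ ↦ by ring
  have e4 : ∀ i, S.trΓ i * (b * S.gradVec a i) = b * (S.trΓ i * S.gradVec a i) := fun _ ↦ by ring
  simp only [e1, e2, e3, e4]
  ring

end FrameGeometry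

/-! ### Variation of curvature, Laplacian and gradient under the Ricci flow. -/

namespace FrameGeometry

variable (S : FrameGeometry n A)

/-- The metric of a coordinate frame evolves by the Ricci flow with respect to the time
derivation `dt`. -/
structure Evolves (dt : Derivation ℝ A A) : Prop where
  comm : S.IsCoordinate
  comm_time : ∀ i a, dt (S.D i a) = S.D i (dt a)
  flow : ∀ i j, dt (S.G i j) = -2 * S.Ric i j

variable {S} {dt : Derivation ℝ A A}

/-- The flow itself gives the symmetry: Ric is a multiple of the time derivative of the symmetric
matrix `G`. -/
theorem Evolves.Ric_symm (h : S.Evolves dt) (i j : Fin n) : S.Ric i j = S.Ric j i := by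
  apply two_mul_cancel
  have h1 := h.flow i j
  rw [S.symm, h.flow] at h1
  linear_combination h1

theorem Evolves.transpose_Ric (h : S.Evolves dt) : S.Ric.transpose = S.Ric := by
  ext i j; exact h.Ric_symm j i

theorem Evolves.RicUp_symm (h : S.Evolves dt) (i j : Fin n) : S.RicUp i j = S.RicUp j i := by
  have : S.RicUp.transpose = S.RicUp := by
    simp only [RicUp, Matrix.transpose_mul, S.transpose_H, h.transpose_Ric, mul_assoc]
  exact congrFun₂ this j i

theorem Evolves.map_G (h : S.Evolves dt) : S.G.map dt = (-2 : A) • S.Ric := by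
  ext i j; simp [h.flow]

theorem Evolves.dt_H (h : S.Evolves dt) (i j : Fin n) : dt (S.H i j) = 2 * S.RicUp i j := by
  have := congrFun₂ (S.map_H dt) i j
  rw [h.map_G] at this
  simpa [RicUp] using this

theorem Evolves.trace_H_map_G (h : S.Evolves dt) : (S.H * S.G.map dt).trace = -2 * S.Scal := by
  rw [h.map_G, Matrix.mul_smul, Matrix.trace_smul, smul_eq_mul, Matrix.trace_mul_comm,
    S.Scal_eq_trace]
  rfl

theorem derivation_two (d : Derivation ℝ A A) : d (2 : A) = 0 :=
  by simpa using d.map_natCast 2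

theorem derivation_two_mul (d : Derivation ℝ A A) (a : A) : d (2 * a) = 2 * d a := by
  rw [two_mul, map_add, two_mul]

theorem trace_map (d : Derivation ℝ A A) (M : Matrix (Fin n) (Fin n) A) :
    (M.map d).trace = d M.trace := by
  simp [Matrix.trace]

/-- The derivatives ∂_t and ∂_p of log √det g commute, and the logarithmic time derivative of √det g
is -R. In terms of matrices, the quadratic terms agree by cyclicity of the trace. -/
theorem Evolves.dt_trΓ (h : S.Evolves dt) (p : Fin n) : dt (S.trΓ p) = -S.D p S.Scal := by
  have hc : (S.G.map (S.D p)).map dt = (S.G.map dt).map (S.D p) := by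
    ext i j; exact h.comm_time _ _
  have h1 : dt (2 * S.trΓ p) = -(S.H * S.G.map dt * (S.H * S.G.map (S.D p))).trace
      + (S.H * (S.G.map dt).map (S.D p)).trace := by
    rw [S.two_mul_trΓ, ← trace_map, map_derivation_mul, hc, S.map_H, Matrix.trace_add, neg_mul,
      Matrix.trace_neg, mul_assoc (S.H * S.G.map dt)]
  have h2 : S.D p (-2 * S.Scal) = -(S.H * S.G.map (S.D p) * (S.H * S.G.map dt)).trace
      + (S.H * (S.G.map dt).map (S.D p)).trace := by
    rw [← h.trace_H_map_G, ← trace_map, map_derivation_mul, S.map_H, Matrix.trace_add, neg_mul,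
      Matrix.trace_neg, mul_assoc (S.H * S.G.map (S.D p))]
  rw [Matrix.trace_mul_comm, ← h1, neg_mul, map_neg, derivation_two_mul, derivation_two_mul] at h2
  apply two_mul_cancel
  linear_combination -h2

theorem Evolves.dt_contrΓ (h : S.Evolves dt) (k : Fin n) :
    dt (S.contrΓ k) = ∑ i, ∑ j, S.H i j * dt (S.Γ i k j) +
      2 * ∑ i, ∑ j, S.RicUp i j * S.Γ i k j := by
  simp only [contrΓ, map_sum, Derivation.leibniz, smul_eq_mul, Finset.sum_add_distrib, h.dt_H,
    Finset.mul_sum]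
  congr 1
  exact Finset.sum_congr rfl fun i _ ↦ Finset.sum_congr rfl fun j _ ↦ by ring

/-- The trace of ∂_t Γ^k_ij is ∇^k R - 2 ∇_i R^{ik}, zero by the contracted Bianchi identity. The
proof differentiates `contrΓ_eq` in time and compares with the product rule for `contrΓ`. -/
theorem Evolves.sum_H_dt_Γ (h : S.Evolves dt) (k : Fin n) :
    ∑ i, ∑ j, S.H i j * dt (S.Γ i k j) = 0 := by
  have h1 := h.dt_contrΓ k
  have h2 : dt (S.contrΓ k) = -(2 * ∑ i, S.D i (S.RicUp i k) - ∑ i, S.H i k * S.D i S.Scal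
      + 2 * ∑ i, S.trΓ i * S.RicUp i k) := by
    rw [contrΓ_eq]
    simp only [map_neg, map_add, map_sum, Derivation.leibniz, smul_eq_mul, Finset.sum_add_distrib,
      h.dt_H, h.comm_time, h.dt_trΓ, mul_neg, Finset.sum_neg_distrib, derivation_two, mul_zero,
      Finset.sum_const_zero]
    have e2 : ∀ i, S.trΓ i * (2 * S.RicUp i k) = 2 * (S.trΓ i * S.RicUp i k) := fun i ↦ by ring
    simp only [e2, ← Finset.mul_sum]
    ring
  have h3 := S.contracted_bianchi_raised h.comm k
  simp only [S.H_symm k, h.RicUp_symm k] at h3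
  have h4 : ∑ a, ∑ p, S.Γ a k p * S.RicUp p a = ∑ i, ∑ j, S.RicUp i j * S.Γ i k j :=
    Finset.sum_congr rfl fun i _ ↦ Finset.sum_congr rfl fun j _ ↦ by rw [h.RicUp_symm, mul_comm]
  rw [h4] at h3
  linear_combination h2 - h1 + h3

theorem Evolves.sum_Ric_RicUp (h : S.Evolves dt) :
    S.pair S.Ric S.Ric = ∑ i, ∑ j, S.Ric i j * S.RicUp j i := by
  rw [pair_eq]
  exact Finset.sum_congr rfl fun i _ ↦ Finset.sum_congr rfl fun j _ ↦ by
    rw [h.RicUp_symm j i]; rfl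

theorem map_dt_Rm (h : S.Evolves dt) (i j : Fin n) :
    (S.Rm i j).map dt = ((S.Γ j).map dt).map (S.D i) - ((S.Γ i).map dt).map (S.D j)
      + ((S.Γ i).map dt * S.Γ j + S.Γ i * (S.Γ j).map dt
        - ((S.Γ j).map dt * S.Γ i + S.Γ j * (S.Γ i).map dt)) := by
  have hc : ∀ i j, ((S.Γ j).map (S.D i)).map dt = ((S.Γ j).map dt).map (S.D i) := fun i j ↦ by
    ext k l; exact h.comm_time _ _
  simp only [Rm, map_derivation_add, map_derivation_sub, map_derivation_mul, hc]

/-- By Palatini's formula ∂_t R_ij (curvature) is the antisymmetrised covariant derivative of ∂_t Γ.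
Of the two traces of ∂_t Γ that survive, one is zero and the other is -∇R, whence ΔR. The variation
of g⁻¹ contributes 2|Ric|². -/
theorem Evolves.dt_Scal (h : S.Evolves dt) :
    dt S.Scal = S.lap S.Scal + 2 * S.pair S.Ric S.Ric := by
  have h0 : S.Scal = ∑ i, ∑ j, (S.Rm i j * S.H) i j := by
    rw [S.Scal_eq_trace, Finset.sum_comm]
    exact Finset.sum_congr rfl fun j _ ↦ (S.sum_W_left j j).symm
  -- The variation of the connection with an index raised; only its traces `z1` and `z2` matter in
  -- the end.
  let Z : Fin n → Matrix (Fin n) (Fin n) A := fun j ↦ (S.Γ j).map dt * S.H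
  have h1 : ∀ i j, ((S.Rm i j).map dt) * S.H =
      ((Z j).map (S.D i) + Z j * (S.Γ i).transpose + S.Γ i * Z j)
      - ((Z i).map (S.D j) + Z i * (S.Γ j).transpose + S.Γ j * Z i) := fun i j ↦ by
    rw [map_dt_Rm h]
    simp only [Z, map_derivation_mul, S.map_D_H]
    noncomm_ring
  have h2 : dt S.Scal = ∑ i, ∑ j, (((S.Rm i j).map dt) * S.H) i j
      + ∑ i, ∑ j, (S.Rm i j * S.H.map dt) i j := by
    conv_lhs => rw [h0]
    simp only [map_sum, ← Finset.sum_add_distrib]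
    refine Finset.sum_congr rfl fun i _ ↦ Finset.sum_congr rfl fun j _ ↦ ?_
    rw [← Matrix.add_apply, ← map_derivation_mul]; rfl
  have h3 : ∑ i, ∑ j, (S.Rm i j * S.H.map dt) i j = 2 * S.pair S.Ric S.Ric := by
    rw [h.sum_Ric_RicUp, Finset.sum_comm, Finset.mul_sum]
    refine Finset.sum_congr rfl fun j _ ↦ ?_
    simp only [Matrix.mul_apply, Matrix.map_apply, h.dt_H, Ric, Matrix.of_apply, Finset.mul_sum,
      Finset.sum_mul]
    rw [Finset.sum_comm]
    exact Finset.sum_congr rfl fun i _ ↦ Finset.sum_congr rfl fun j _ ↦ by ring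
  have z1 : ∀ i, ∑ j, Z j i j = 0 := fun i ↦ by
    rw [← h.sum_H_dt_Γ i]
    refine Finset.sum_congr rfl fun j _ ↦ ?_
    simp only [Z, Matrix.mul_apply, Matrix.map_apply]
    exact Finset.sum_congr rfl fun l _ ↦ by rw [S.H_symm j l, mul_comm]
  have z2 : ∀ j, ∑ i, Z i i j = -S.gradVec S.Scal j := fun j ↦ by
    simp only [Z, Matrix.mul_apply, Matrix.map_apply, gradVec]
    rw [Finset.sum_comm, ← Finset.sum_neg_distrib]
    refine Finset.sum_congr rfl fun l _ ↦ ?_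
    rw [← Finset.sum_mul, ← map_sum]
    have := h.dt_trΓ l
    rw [trΓ] at this
    rw [this, S.H_symm l j]; ring
  rw [h2, h3, S.lap_eq_div]
  congr 1
  simp_rw [h1]
  simp only [Matrix.sub_apply, Matrix.add_apply, Finset.sum_sub_distrib, Finset.sum_add_distrib,
    Matrix.map_apply, Matrix.mul_apply, Matrix.transpose_apply]
  have e1 : ∑ i, ∑ j, S.D i (Z j i j) = 0 := by
    simp only [← map_sum, z1, map_zero, Finset.sum_const_zero]
  have e2 : ∑ i, ∑ j, ∑ p, S.Γ i i p * Z j p j = 0 := by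
    refine Finset.sum_eq_zero fun i _ ↦ ?_
    rw [Finset.sum_comm]
    simp only [← Finset.mul_sum, z1, mul_zero, Finset.sum_const_zero]
  have e3 : ∑ i, ∑ j, S.D j (Z i i j) = -∑ k, S.D k (S.gradVec S.Scal k) := by
    rw [Finset.sum_comm]
    simp only [← map_sum, z2, map_neg, Finset.sum_neg_distrib]
  have e4 : ∑ i, ∑ j, ∑ p, Z i i p * S.Γ j j p = -∑ k, S.trΓ k * S.gradVec S.Scal k := by
    rw [Finset.sum_comm_cycle, ← Finset.sum_neg_distrib]
    refine Finset.sum_congr rfl fun p _ ↦ ?_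
    rw [← Finset.sum_mul_sum, z2, trΓ]
    ring
  -- These connection terms involve no trace of `Z`; they cancel against each other by
  -- torsion-freeness.
  have e5 : ∑ i, ∑ j, ∑ p, S.Γ j i p * Z i p j = ∑ i, ∑ j, ∑ p, Z j i p * S.Γ i j p := by
    rw [Finset.sum_comm_cycle]
    exact Finset.sum_congr rfl fun p _ ↦ Finset.sum_congr rfl fun i _ ↦
      Finset.sum_congr rfl fun j _ ↦ by rw [S.Γ_symm j, mul_comm]
  rw [e1, e2, e3, e4, e5]
  ring

theorem pair_comm (S : FrameGeometry n A) (B C : Matrix (Fin n) (Fin n) A) :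
    S.pair B C = S.pair C B := by
  have h : ∀ X Y : Matrix (Fin n) (Fin n) A, ∑ i, ∑ j, X i j * Y i j = (X.transpose * Y).trace :=
    fun X Y ↦ by
      simp only [Matrix.trace, Matrix.diag, Matrix.mul_apply, Matrix.transpose_apply]
      exact Finset.sum_comm
  rw [pair_eq, pair_eq, h, h, ← Matrix.trace_transpose]
  simp only [Matrix.transpose_mul, Matrix.transpose_transpose, S.transpose_H]
  rw [Matrix.trace_mul_comm, ← mul_assoc, Matrix.trace_mul_comm]
  simp only [mul_assoc]

theorem pair_Ric (S : FrameGeometry n A) (B : Matrix (Fin n) (Fin n) A) :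
    S.pair S.Ric B = ∑ i, ∑ j, B i j * S.RicUp i j := by
  rw [pair_comm, pair_eq]; rfl

/-- In `lap_eq_sub` the metric enters only through g^{ij} and g^{ij} Γ^k_ij. These vary by 2R^{ij}
and, thanks to `sum_H_dt_Γ`, by 2R^{ij} Γ^k_ij, which together pair Ric with the Hessian. -/
theorem Evolves.dt_lap (h : S.Evolves dt) (u : A) :
    dt (S.lap u) = S.lap (dt u) + 2 * S.pair S.Ric (S.Hess u) := by
  have h1 : S.pair S.Ric (S.Hess u) = ∑ i, ∑ j, S.RicUp i j * S.D i (S.D j u)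
      - ∑ k, (∑ i, ∑ j, S.RicUp i j * S.Γ i k j) * S.D k u := by
    rw [pair_Ric]
    simp only [Hess, Matrix.of_apply, sub_mul, Finset.sum_sub_distrib, Finset.sum_mul]
    congr 1
    · exact Finset.sum_congr rfl fun i _ ↦ Finset.sum_congr rfl fun j _ ↦ mul_comm _ _
    · rw [Finset.sum_comm_cycle]
      exact Finset.sum_congr rfl fun i _ ↦ Finset.sum_congr rfl fun j _ ↦
        Finset.sum_congr rfl fun k _ ↦ by ring
  rw [h1, lap_eq_sub, lap_eq_sub]
  simp only [map_sub, map_sum, Derivation.leibniz, smul_eq_mul, h.dt_H, h.dt_contrΓ, h.sum_H_dt_Γ,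
    h.comm_time, Finset.sum_add_distrib, zero_add]
  have e1 : ∀ i j, S.D i (S.D j u) * (2 * S.RicUp i j) = 2 * (S.RicUp i j * S.D i (S.D j u)) :=
    fun _ _ ↦ by ring
  have e2 : ∀ k, S.D k u * (2 * ∑ i, ∑ j, S.RicUp i j * S.Γ i k j) =
      2 * ((∑ i, ∑ j, S.RicUp i j * S.Γ i k j) * S.D k u) := fun _ ↦ by ring
  simp only [e1, e2, ← Finset.mul_sum]
  ring

theorem sum_Ric_gradVec (S : FrameGeometry n A) (a b : A) :
    ∑ i, ∑ j, S.Ric i j * S.gradVec a i * S.gradVec b j =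
      ∑ i, ∑ j, S.RicUp i j * S.D i a * S.D j b := by
  have h1 : ∀ c, S.gradVec c = S.H.mulVec fun l ↦ S.D l c := fun _ ↦ rfl
  have h2 : ∀ (B : Matrix (Fin n) (Fin n) A) (v w : Fin n → A),
      ∑ i, ∑ j, B i j * v i * w j = v ⬝ᵥ B.mulVec w := fun B v w ↦ by
    simp only [dotProduct, Matrix.mulVec, Finset.mul_sum]
    exact Finset.sum_congr rfl fun i _ ↦ Finset.sum_congr rfl fun j _ ↦ by ring
  rw [h2, h2, h1, h1, RicUp, ← Matrix.mulVec_mulVec, ← Matrix.mulVec_mulVec,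
    Matrix.dotProduct_mulVec (fun l ↦ S.D l a) S.H, ← Matrix.mulVec_transpose, S.transpose_H]

theorem Evolves.dt_grad (h : S.Evolves dt) (a b : A) :
    dt (S.grad a b) = S.grad (dt a) b + S.grad a (dt b)
      + 2 * ∑ i, ∑ j, S.Ric i j * S.gradVec a i * S.gradVec b j := by
  rw [sum_Ric_gradVec]
  simp only [grad, map_sum, Derivation.leibniz, smul_eq_mul, h.dt_H, h.comm_time, Finset.mul_sum,
    ← Finset.sum_add_distrib]
  exact Finset.sum_congr rfl fun i _ ↦ Finset.sum_congr rfl fun j _ ↦ by ring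

/-! ### Commuting covariant derivatives and the Bochner formula. -/

theorem Hess_symm (comm : S.IsCoordinate) (u : A) (i j : Fin n) :
    S.Hess u i j = S.Hess u j i := by
  simp only [Hess, Matrix.of_apply, comm i j]
  congr 1
  exact Finset.sum_congr rfl fun k _ ↦ by rw [S.Γ_symm]

theorem D_D_eq (S : FrameGeometry n A) (u : A) (i j : Fin n) :
    S.D i (S.D j u) = S.Hess u i j + ∑ k, S.Γ i k j * S.D k u := by
  simp [Hess]

theorem D_gradVec (S : FrameGeometry n A) (u : A) (k i : Fin n) :
    S.D k (S.gradVec u i) = ∑ j, S.H i j * S.Hess u k j - ∑ p, S.Γ k i p * S.gradVec u p := by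
  simp only [gradVec, map_sum, Derivation.leibniz, smul_eq_mul, D_D_eq, D_H, mul_add, mul_neg,
    Finset.sum_add_distrib, Finset.mul_sum, Finset.sum_neg_distrib]
  rw [Finset.sum_comm (f := fun p l ↦ S.Γ k i p * (S.H p l * S.D l u)),
    Finset.sum_comm (f := fun j l ↦ S.H i j * (S.Γ k l j * S.D l u))]
  have e1 : ∀ l p, S.D l u * (S.Γ k i p * S.H p l) = S.Γ k i p * (S.H p l * S.D l u) :=
    fun _ _ ↦ by ring
  have e2 : ∀ l p, S.D l u * (S.H i p * S.Γ k l p) = S.H i p * (S.Γ k l p * S.D l u) :=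
    fun _ _ ↦ by ring
  simp only [e1, e2]
  ring

theorem D_grad_self (S : FrameGeometry n A) (u : A) (k : Fin n) :
    S.D k (S.grad u u) = 2 * ∑ i, S.Hess u k i * S.gradVec u i := by
  simp only [grad_eq, map_sum, Derivation.leibniz, smul_eq_mul, D_D_eq, D_gradVec, mul_sub,
    Finset.sum_add_distrib, Finset.sum_sub_distrib, mul_add, Finset.mul_sum]
  have e1 : ∑ i, ∑ j, S.D i u * (S.H i j * S.Hess u k j) = ∑ i, S.gradVec u i * S.Hess u k i := by
    rw [Finset.sum_comm]
    simp only [gradVec, Finset.sum_mul]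
    exact Finset.sum_congr rfl fun i _ ↦ Finset.sum_congr rfl fun j _ ↦ by
      rw [S.H_symm j]; ring
  have e2 : ∑ i, ∑ j, S.D i u * (S.Γ k i j * S.gradVec u j) =
      ∑ i, ∑ j, S.gradVec u i * (S.Γ k j i * S.D j u) := by
    rw [Finset.sum_comm]
    exact Finset.sum_congr rfl fun i _ ↦ Finset.sum_congr rfl fun j _ ↦ by ring
  rw [e1, e2]
  have e3 : ∀ i, 2 * (S.Hess u k i * S.gradVec u i) = S.gradVec u i * S.Hess u k i
      + S.gradVec u i * S.Hess u k i := fun _ ↦ by ring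
  simp only [e3, Finset.sum_add_distrib]
  ring

/-- The covariant derivative `∇_k B_lj`. -/
def covD (S : FrameGeometry n A) (B : Matrix (Fin n) (Fin n) A) (k l j : Fin n) : A :=
  S.D k (B l j) - ∑ p, S.Γ k p l * B p j - ∑ p, S.Γ k p j * B l p

/-- The Ricci identity for du: the third derivatives D_k D_i D_l u cancel in the difference, and the
derivatives and products of Γ assemble into the curvature. -/
theorem covD_Hess (comm : S.IsCoordinate) (u : A) (k l i : Fin n) :
    S.covD (S.Hess u) k l i = S.covD (S.Hess u) i k l - ∑ p, S.Rm k i p l * S.D p u := by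
  have h : ∀ k i l, S.D k (S.Hess u i l) = S.D k (S.D i (S.D l u))
      - ∑ p, S.D k (S.Γ i p l) * S.D p u - ∑ p, S.Γ i p l * S.Hess u k p
      - ∑ p, S.Γ i p l * ∑ q, S.Γ k q p * S.D q u := fun k i l ↦ by
    simp only [Hess, Matrix.of_apply, map_sub, map_sum, Derivation.leibniz, smul_eq_mul, mul_sub,
      Finset.sum_sub_distrib, Finset.sum_add_distrib, mul_comm]
    ring
  have hq : ∀ k i l, ∑ p, S.Γ i p l * ∑ q, S.Γ k q p * S.D q u =
      ∑ q, (S.Γ k * S.Γ i) q l * S.D q u := fun k i l ↦ by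
    simp only [Matrix.mul_apply, Finset.mul_sum, Finset.sum_mul]
    rw [Finset.sum_comm]
    exact Finset.sum_congr rfl fun q _ ↦ Finset.sum_congr rfl fun p _ ↦ by ring
  simp only [covD]
  rw [S.Hess_symm comm u l i, h, h, hq, hq, comm k i]
  simp only [Rm, Matrix.add_apply, Matrix.sub_apply, Matrix.map_apply, add_mul, sub_mul,
    Finset.sum_add_distrib, Finset.sum_sub_distrib]
  have e1 : ∑ p, S.Γ k p i * S.Hess u l p = ∑ p, S.Γ i p k * S.Hess u p l :=
    Finset.sum_congr rfl fun p _ ↦ by rw [S.Γ_symm, S.Hess_symm comm]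
  have e2 : ∑ p, S.Γ k p l * S.Hess u i p = ∑ p, S.Γ k p l * S.Hess u p i :=
    Finset.sum_congr rfl fun p _ ↦ by rw [S.Hess_symm comm]
  rw [e1, e2]
  ring

/-- The metric is parallel, so taking the trace commutes with ∇. -/
theorem sum_H_covD (S : FrameGeometry n A) (B : Matrix (Fin n) (Fin n) A) (i : Fin n) :
    ∑ k, ∑ l, S.H k l * S.covD B i k l = S.D i (∑ k, ∑ l, S.H k l * B k l) := by
  simp only [covD, map_sum, Derivation.leibniz, smul_eq_mul, D_H, mul_sub, mul_add, mul_neg,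
    Finset.sum_add_distrib, Finset.sum_sub_distrib, Finset.mul_sum, Finset.sum_neg_distrib]
  have e1 : ∑ k, ∑ l, ∑ p, S.H k l * (S.Γ i p k * B p l) =
      ∑ k, ∑ l, ∑ p, B k l * (S.Γ i k p * S.H p l) := by
    rw [Finset.sum_comm_cycle, Finset.sum_congr rfl fun p _ ↦ Finset.sum_comm]
    exact Finset.sum_congr rfl fun k _ ↦ Finset.sum_congr rfl fun l _ ↦
      Finset.sum_congr rfl fun p _ ↦ by ring
  have e2 : ∑ k, ∑ l, ∑ p, S.H k l * (S.Γ i p l * B k p) =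
      ∑ k, ∑ l, ∑ p, B k l * (S.H k p * S.Γ i l p) := by
    refine Finset.sum_congr rfl fun k _ ↦ ?_
    rw [Finset.sum_comm]
    exact Finset.sum_congr rfl fun l _ ↦ Finset.sum_congr rfl fun p _ ↦ by ring
  rw [e1, e2]
  ring

theorem div_Hess (comm : S.IsCoordinate) (u : A) (i : Fin n) :
    ∑ k, ∑ l, S.H k l * S.covD (S.Hess u) k l i =
      S.D i (S.lap u) + ∑ p, S.Ric i p * S.gradVec u p := by
  have h0 : ∀ k l, S.H k l * S.covD (S.Hess u) k l i = S.H k l * S.covD (S.Hess u) i k l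
      - S.H k l * ∑ p, S.Rm k i p l * S.D p u := fun k l ↦ by rw [S.covD_Hess comm, mul_sub]
  rw [Finset.sum_congr rfl fun k _ ↦ Finset.sum_congr rfl fun l _ ↦ h0 k l]
  simp only [Finset.sum_sub_distrib]
  rw [sum_H_covD, lap, sub_eq_add_neg]
  congr 1
  have e : ∑ p, S.Ric i p * S.gradVec u p = ∑ p, S.RicMixed i p * S.D p u := by
    simp only [RicMixed, gradVec, Matrix.mul_apply, Finset.mul_sum, Finset.sum_mul]
    rw [Finset.sum_comm]
    exact Finset.sum_congr rfl fun i _ ↦ Finset.sum_congr rfl fun j _ ↦ by ring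
  have h : ∀ k p, ∑ l, S.H k l * (S.Rm k i p l * S.D p u) = -(S.W k i k p * S.D p u) :=
    fun k p ↦ by
      rw [S.W_transpose_apply comm, neg_mul, neg_neg, W, Matrix.mul_apply, Finset.sum_mul]
      exact Finset.sum_congr rfl fun l _ ↦ by rw [S.H_symm k]; ring
  rw [e]
  simp only [Finset.mul_sum]
  rw [Finset.sum_congr rfl fun k _ ↦ Finset.sum_comm]
  simp only [h, Finset.sum_neg_distrib, neg_neg]
  rw [Finset.sum_comm]
  simp only [← Finset.sum_mul, S.sum_W_left]

/-- `h1` is the Hessian of |∇u|², a term with third derivatives plus the square of Hess u. Its trace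
turns the former into the divergence of Hess u, and `div_Hess` produces ∇Δu and the Ricci term. -/
theorem bochner (comm : S.IsCoordinate) (u : A) :
    S.lap (S.grad u u) = 2 * S.pair (S.Hess u) (S.Hess u) + 2 * S.grad u (S.lap u)
      + 2 * ∑ i, ∑ j, S.Ric i j * S.gradVec u i * S.gradVec u j := by
  have h1 : ∀ k l, S.Hess (S.grad u u) k l = 2 * (∑ i, S.covD (S.Hess u) k l i * S.gradVec u i
      + ∑ i, S.Hess u l i * ∑ j, S.H i j * S.Hess u k j) := fun k l ↦ by
    have hd : S.Hess (S.grad u u) k l = S.D k (S.D l (S.grad u u))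
        - ∑ p, S.Γ k p l * S.D p (S.grad u u) := rfl
    have e1 : ∀ i, S.D k (S.Hess u l i * S.gradVec u i) = S.D k (S.Hess u l i) * S.gradVec u i
        + (S.Hess u l i * ∑ j, S.H i j * S.Hess u k j
          - S.Hess u l i * ∑ p, S.Γ k i p * S.gradVec u p) := fun i ↦ by
      rw [Derivation.leibniz, D_gradVec]; simp only [smul_eq_mul]; ring
    have e2 : ∑ i, (∑ p, S.Γ k p i * S.Hess u l p) * S.gradVec u i =
        ∑ i, S.Hess u l i * ∑ p, S.Γ k i p * S.gradVec u p := by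
      simp only [Finset.sum_mul, Finset.mul_sum]
      rw [Finset.sum_comm]
      exact Finset.sum_congr rfl fun i _ ↦ Finset.sum_congr rfl fun p _ ↦ by ring
    have e3 : ∑ p, S.Γ k p l * (2 * ∑ i, S.Hess u p i * S.gradVec u i) =
        2 * ∑ i, (∑ p, S.Γ k p l * S.Hess u p i) * S.gradVec u i := by
      simp only [Finset.sum_mul, Finset.mul_sum]
      rw [Finset.sum_comm]
      exact Finset.sum_congr rfl fun i _ ↦ Finset.sum_congr rfl fun p _ ↦ by ring
    simp only [hd, D_grad_self, derivation_two_mul, map_sum, e1, e3, covD, sub_mul,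
      Finset.sum_sub_distrib, Finset.sum_add_distrib, e2]
    ring
  have h2 : ∑ k, ∑ l, S.H k l * ∑ i, S.Hess u l i * ∑ j, S.H i j * S.Hess u k j =
      S.pair (S.Hess u) (S.Hess u) := by
    simp only [pair, Finset.mul_sum]
    refine Finset.sum_congr rfl fun k _ ↦ ?_
    rw [Finset.sum_comm_cycle]
    exact Finset.sum_congr rfl fun j _ ↦ Finset.sum_congr rfl fun l _ ↦
      Finset.sum_congr rfl fun i _ ↦ by rw [S.H_symm i j]; ring
  have h3 : ∑ k, ∑ l, S.H k l * ∑ i, S.covD (S.Hess u) k l i * S.gradVec u i =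
      S.grad u (S.lap u) + ∑ i, ∑ j, S.Ric i j * S.gradVec u i * S.gradVec u j := by
    have e : ∑ k, ∑ l, S.H k l * ∑ i, S.covD (S.Hess u) k l i * S.gradVec u i =
        ∑ i, (∑ k, ∑ l, S.H k l * S.covD (S.Hess u) k l i) * S.gradVec u i := by
      simp only [Finset.mul_sum, Finset.sum_mul]
      rw [Finset.sum_comm_cycle]
      simp only [mul_assoc]
    rw [e, S.grad_comm, grad_eq, ← Finset.sum_add_distrib]
    refine Finset.sum_congr rfl fun i _ ↦ ?_
    rw [div_Hess comm, add_mul, Finset.sum_mul]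
    congr 1
    exact Finset.sum_congr rfl fun j _ ↦ by ring
  rw [lap]
  simp only [h1]
  have h4 : ∀ k l, S.H k l * (2 * (∑ i, S.covD (S.Hess u) k l i * S.gradVec u i
      + ∑ i, S.Hess u l i * ∑ j, S.H i j * S.Hess u k j)) =
      2 * (S.H k l * ∑ i, S.covD (S.Hess u) k l i * S.gradVec u i)
      + 2 * (S.H k l * ∑ i, S.Hess u l i * ∑ j, S.H i j * S.Hess u k j) := fun _ _ ↦ by ring
  simp only [h4, Finset.sum_add_distrib, ← Finset.mul_sum, h2, h3]
  ring

/-! ### Evolution of Perelman's Harnack quantity. -/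

theorem pair_add (S : FrameGeometry n A) (B C : Matrix (Fin n) (Fin n) A) :
    S.pair (B + C) (B + C) = S.pair B B + 2 * S.pair B C + S.pair C C := by
  have h1 : ∀ B C D, S.pair B (C + D) = S.pair B C + S.pair B D := fun B C D ↦ by
    simp only [pair, Matrix.add_apply, mul_add, Finset.sum_add_distrib]
  rw [h1, S.pair_comm _ B, S.pair_comm _ C, h1, h1, S.pair_comm C B]
  ring

theorem grad_add (S : FrameGeometry n A) (a b c : A) :
    S.grad a (b + c) = S.grad a b + S.grad a c := by
  simp only [grad, map_add, mul_add, Finset.sum_add_distrib]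

theorem lap_neg (S : FrameGeometry n A) (a : A) : S.lap (-a) = -S.lap a := by
  have h := S.lap_add a (-a)
  have h0 : S.lap 0 = 0 := by simp [lap_eq_sub]
  rw [add_neg_cancel, h0] at h
  linear_combination -h

theorem grad_neg (S : FrameGeometry n A) (a b : A) : S.grad a (-b) = -S.grad a b := by
  simp only [grad, map_neg, mul_neg, Finset.sum_neg_distrib]

/-- Perelman's Harnack quantity `R + 2Δf - |∇f|²`. -/
def harnack (S : FrameGeometry n A) (f : A) : A := S.Scal + 2 * S.lap f - S.grad f f

/-- The variations supply 2|Ric|² and 4⟨Ric, Hess f⟩, and Bochner's formula for the Δ|∇f|² left over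
supplies 2|Hess f|², completing the square. The terms Ric(∇f, ∇f) from Bochner and from `dt_grad`
cancel. -/
theorem Evolves.dt_harnack (h : S.Evolves dt) {f : A}
    (hf : dt f = -S.lap f + S.grad f f - S.Scal) :
    dt (S.harnack f) = -S.lap (S.harnack f) + 2 * S.pair (S.Ric + S.Hess f) (S.Ric + S.Hess f)
      + 2 * S.grad f (S.harnack f) := by
  have b := bochner h.comm f
  rw [harnack, map_sub, map_add, derivation_two_mul, h.dt_Scal, h.dt_lap, h.dt_grad, hf, pair_add,
    S.grad_comm (-S.lap f + S.grad f f - S.Scal) f]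
  simp only [sub_eq_add_neg, lap_add, lap_neg, grad_add, grad_neg, two_mul] at b ⊢
  linear_combination b

/-- The ring has no exponential: u plays the role of e^{-f}, characterised by its logarithmic
derivatives. -/
theorem gradVec_exp_neg (S : FrameGeometry n A) {f u : A} (hu : ∀ i, S.D i u = -(u * S.D i f))
    (k : Fin n) : S.gradVec u k = -(u * S.gradVec f k) := by
  simp only [gradVec, hu, Finset.mul_sum, ← Finset.sum_neg_distrib]
  exact Finset.sum_congr rfl fun _ _ ↦ by ring

theorem lap_exp_neg (S : FrameGeometry n A) {f u : A} (hu : ∀ i, S.D i u = -(u * S.D i f)) :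
    S.lap u = (S.grad f f - S.lap f) * u := by
  have h : ∀ k, S.D k (S.gradVec u k) =
      u * (S.D k f * S.gradVec f k) - u * S.D k (S.gradVec f k) := fun k ↦ by
    rw [gradVec_exp_neg S hu, map_neg, Derivation.leibniz, hu]
    simp only [smul_eq_mul]; ring
  have h' : ∀ k, S.trΓ k * S.gradVec u k = -(u * (S.trΓ k * S.gradVec f k)) := fun k ↦ by
    rw [gradVec_exp_neg S hu]; ring
  simp only [lap_eq_div, grad_eq, h, h', Finset.sum_sub_distrib, Finset.sum_neg_distrib,
    ← Finset.mul_sum]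
  ring

/-- The factor e^{-f} absorbs the drift term 2⟨∇f, ∇·⟩ and leaves the conjugate heat equation with a
nonnegative source. The reaction term R v is what the shrinking of dV compensates. -/
theorem Evolves.dt_harnack_mul (h : S.Evolves dt) {f u : A}
    (hf : dt f = -S.lap f + S.grad f f - S.Scal) (hu : ∀ i, S.D i u = -(u * S.D i f))
    (hut : dt u = -(u * dt f)) :
    dt (S.harnack f * u) = -S.lap (S.harnack f * u) + S.Scal * (S.harnack f * u)
      + 2 * S.pair (S.Ric + S.Hess f) (S.Ric + S.Hess f) * u := by
  have hg : S.grad (S.harnack f) u = -(u * S.grad f (S.harnack f)) := by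
    rw [S.grad_comm f, grad_eq, grad_eq, Finset.mul_sum, ← Finset.sum_neg_distrib]
    exact Finset.sum_congr rfl fun _ _ ↦ by rw [gradVec_exp_neg S hu]; ring
  rw [Derivation.leibniz, h.dt_harnack hf, lap_mul, hut, hf, hg, lap_exp_neg S hu]
  simp only [smul_eq_mul]
  ring

theorem functional_integrand (S : FrameGeometry n A) {f u : A}
    (hu : ∀ i, S.D i u = -(u * S.D i f)) :
    (S.Scal + S.grad f f) * u = S.harnack f * u + 2 * S.lap u := by
  rw [lap_exp_neg S hu, harnack]; ring

end FrameGeometry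

/-! ### Behaviour under change of coordinates. -/

namespace FrameGeometry

/-- Uniqueness of the Levi-Civita connection: symmetry and metric compatibility recover Koszul's
formula. -/
theorem eq_Γ (S : FrameGeometry n A) (K : Fin n → Matrix (Fin n) (Fin n) A)
    (hK : ∀ i j k, K i k j = K j k i)
    (hG : ∀ i, S.G.map (S.D i) = (K i).transpose * S.G + S.G * K i) (i : Fin n) : K i = S.Γ i := by
  have h1 : ∀ i j m, S.D i (S.G j m) = (S.G * K i) m j + (S.G * K i) j m := fun i j m ↦ by
    have h := congrFun₂ (hG i) j m
    rw [Matrix.map_apply] at h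
    rw [h, Matrix.add_apply]
    congr 1
    simp only [Matrix.mul_apply, Matrix.transpose_apply]
    exact Finset.sum_congr rfl fun k _ ↦ by rw [S.symm k m, mul_comm]
  have h2 : ∀ i j m, (S.G * K i) m j = (S.G * K j) m i := fun i j m ↦ by
    simp only [Matrix.mul_apply]
    exact Finset.sum_congr rfl fun k _ ↦ by rw [hK]
  have h3 : S.G * K i = S.G * S.Γ i := by
    ext m j
    apply two_mul_cancel
    rw [Matrix.mul_apply (N := S.Γ i), S.lower_Γ, h1, h1, h1, h2 m j i, h2 m i j, h2 j i m]
    ring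
  calc K i = S.H * (S.G * K i) := by rw [← mul_assoc, S.inv_mul, one_mul]
    _ = S.Γ i := by rw [h3, ← mul_assoc, S.inv_mul, one_mul]

/-- A change of coordinates: the frame of `S` is `D_i = P_ia D'_a`. -/
structure Change (S S' : FrameGeometry n A) where
  P : Matrix (Fin n) (Fin n) A
  Q : Matrix (Fin n) (Fin n) A
  mul_Q : P * Q = 1
  D_eq : ∀ i a, S.D i a = ∑ b, P i b * S'.D b a
  D_P : ∀ i j a, S.D i (P j a) = S.D j (P i a)
  G_eq : S.G = P * S'.G * P.transpose

namespace Change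

variable {S S' : FrameGeometry n A} (c : Change S S')

theorem Q_mul : c.Q * c.P = 1 := mul_eq_one_comm.mp c.mul_Q

theorem PT_mul_QT : c.P.transpose * c.Q.transpose = 1 := by
  rw [← Matrix.transpose_mul, c.Q_mul, Matrix.transpose_one]

theorem QT_mul_PT : c.Q.transpose * c.P.transpose = 1 := by
  rw [← Matrix.transpose_mul, c.mul_Q, Matrix.transpose_one]

theorem H_eq : S.H = c.Q.transpose * S'.H * c.Q := by
  have h : S.G * (c.Q.transpose * S'.H * c.Q) = 1 := by
    calc S.G * (c.Q.transpose * S'.H * c.Q)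
        = c.P * S'.G * (c.P.transpose * c.Q.transpose) * S'.H * c.Q := by
          rw [c.G_eq]; simp only [mul_assoc]
      _ = c.P * (S'.G * S'.H) * c.Q := by rw [c.PT_mul_QT]; simp only [mul_assoc, mul_one]
      _ = 1 := by rw [S'.mul_inv, mul_one, c.mul_Q]
  calc S.H = S.H * (S.G * (c.Q.transpose * S'.H * c.Q)) := by rw [h, mul_one]
    _ = _ := by rw [← mul_assoc S.H, S.inv_mul, one_mul]

theorem H'_eq : c.P.transpose * S.H * c.P = S'.H := by
  rw [c.H_eq]
  calc c.P.transpose * (c.Q.transpose * S'.H * c.Q) * c.P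
      = (c.P.transpose * c.Q.transpose) * S'.H * (c.Q * c.P) := by simp only [mul_assoc]
    _ = S'.H := by rw [c.PT_mul_QT, c.Q_mul, one_mul, mul_one]

/-- The connection of the old frame along the new one. -/
def Γ' (i : Fin n) : Matrix (Fin n) (Fin n) A := ∑ a, c.P i a • S'.Γ a

theorem map_D (i : Fin n) (M : Matrix (Fin n) (Fin n) A) :
    M.map (S.D i) = ∑ a, c.P i a • M.map (S'.D a) := by
  ext k l
  simp [c.D_eq, Matrix.sum_apply]

theorem map_D_G' (i : Fin n) :
    S'.G.map (S.D i) = (c.Γ' i).transpose * S'.G + S'.G * c.Γ' i := by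
  rw [c.map_D]
  simp only [S'.map_D_G, Γ', Matrix.transpose_sum, Matrix.transpose_smul, Finset.sum_mul,
    Finset.mul_sum, smul_add, Finset.sum_add_distrib, Matrix.smul_mul, Matrix.mul_smul]

/-- The inhomogeneous transformation law. Rather than expanding Christoffel symbols, the candidate
`K` that satisfies the law is shown to be symmetric and metric, and `eq_Γ` identifies it. -/
theorem Γ_eq (i : Fin n) :
    c.P.transpose * S.Γ i = c.P.transpose.map (S.D i) + c.Γ' i * c.P.transpose := by
  let K : Fin n → Matrix (Fin n) (Fin n) A := fun i ↦
    c.Q.transpose * (c.P.transpose.map (S.D i) + c.Γ' i * c.P.transpose)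
  have hPK : ∀ i, c.P.transpose * K i = c.P.transpose.map (S.D i) + c.Γ' i * c.P.transpose :=
    fun i ↦ by rw [← mul_assoc, c.PT_mul_QT, one_mul]
  have hs : ∀ i j a, (c.P.transpose.map (S.D i) + c.Γ' i * c.P.transpose) a j =
      (c.P.transpose.map (S.D j) + c.Γ' j * c.P.transpose) a i := fun i j a ↦ by
    rw [Matrix.add_apply, Matrix.add_apply]
    congr 1
    · exact c.D_P i j a
    · simp only [Γ', Matrix.mul_apply, Matrix.sum_apply, Matrix.smul_apply, smul_eq_mul,
        Finset.sum_mul, Matrix.transpose_apply]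
      rw [Finset.sum_comm]
      exact Finset.sum_congr rfl fun b _ ↦ Finset.sum_congr rfl fun d _ ↦ by
        rw [S'.Γ_symm]; ring
  rw [← S.eq_Γ K _ _ i, hPK]
  · intro i j k
    simp only [K]
    rw [Matrix.mul_apply, Matrix.mul_apply]
    exact Finset.sum_congr rfl fun a _ ↦ by rw [hs]
  · intro i
    have h1 : S.G * K i = c.P * S'.G * (c.P.transpose.map (S.D i) + c.Γ' i * c.P.transpose) := by
      rw [c.G_eq, mul_assoc _ c.P.transpose, hPK]
    have h2 : (K i).transpose * S.G = (S.G * K i).transpose := by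
      rw [Matrix.transpose_mul (M := S.G), S.transpose_G]
    rw [h2, h1, c.G_eq, map_derivation_mul, map_derivation_mul, c.map_D_G']
    simp only [Matrix.transpose_add, Matrix.transpose_mul, Matrix.transpose_transpose,
      S'.transpose_G, map_derivation_transpose]
    noncomm_ring

theorem map_D_Γ' (i j : Fin n) : (c.Γ' j).map (S.D i) =
    ∑ b, S.D i (c.P j b) • S'.Γ b + ∑ a, ∑ b, (c.P i a * c.P j b) • (S'.Γ b).map (S'.D a) := by
  ext k l
  simp only [Γ', Matrix.map_apply, Matrix.sum_apply, Matrix.smul_apply, smul_eq_mul, map_sum,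
    Derivation.leibniz, Matrix.add_apply, Finset.sum_add_distrib]
  rw [add_comm]
  congr 1
  · exact Finset.sum_congr rfl fun b _ ↦ mul_comm _ _
  · simp only [c.D_eq i (S'.Γ _ k l), Finset.mul_sum]
    rw [Finset.sum_comm]
    exact Finset.sum_congr rfl fun a _ ↦ Finset.sum_congr rfl fun b _ ↦ by ring

theorem Γ'_mul (i j : Fin n) :
    c.Γ' i * c.Γ' j = ∑ a, ∑ b, (c.P i a * c.P j b) • (S'.Γ a * S'.Γ b) := by
  simp only [Γ', Finset.sum_mul, Finset.mul_sum, Matrix.smul_mul, Matrix.mul_smul, smul_smul]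
  rw [Finset.sum_comm]
  exact Finset.sum_congr rfl fun a _ ↦ Finset.sum_congr rfl fun b _ ↦ by rw [mul_comm]

/-- Differentiate `Γ_eq` and antisymmetrise: the second derivatives of `P` cancel and the
inhomogeneous terms drop out, so the curvature transforms as a tensor. -/
theorem Rm_eq (comm : S.IsCoordinate) (i j : Fin n) : c.P.transpose * S.Rm i j =
    (∑ a, ∑ b, (c.P i a * c.P j b) • S'.Rm a b) * c.P.transpose := by
  have h0 : ∑ a, ∑ b, (c.P i a * c.P j b) • S'.Rm a b = (c.Γ' j).map (S.D i)
      - (c.Γ' i).map (S.D j) + (c.Γ' i * c.Γ' j - c.Γ' j * c.Γ' i) := by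
    rw [c.map_D_Γ', c.map_D_Γ', c.Γ'_mul, c.Γ'_mul]
    simp only [c.D_P i j, Rm, smul_add, smul_sub, Finset.sum_add_distrib, Finset.sum_sub_distrib]
    rw [Finset.sum_comm (f := fun a b ↦ (c.P j a * c.P i b) • (S'.Γ b).map (S'.D a)),
      Finset.sum_comm (f := fun a b ↦ (c.P j a * c.P i b) • (S'.Γ a * S'.Γ b))]
    simp only [mul_comm (c.P j _)]
    abel
  have h1 : ∀ i j, (c.P.transpose * S.Γ j).map (S.D i) =
      (c.P.transpose.map (S.D j) + c.Γ' j * c.P.transpose).map (S.D i) := fun i j ↦ by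
    rw [c.Γ_eq]
  have h2 := h1 i j
  have h3 := h1 j i
  simp only [map_derivation_mul, map_derivation_add] at h2 h3
  rw [S.map_D_comm comm j i] at h2
  have e1 := c.Γ_eq i
  have e2 := c.Γ_eq j
  set B := c.P.transpose
  have h4 : B * S.Rm i j = (B.map (S.D i) * S.Γ j + B * (S.Γ j).map (S.D i))
      - (B.map (S.D j) * S.Γ i + B * (S.Γ i).map (S.D j)) + (B * S.Γ i) * S.Γ j
      - (B * S.Γ j) * S.Γ i - B.map (S.D i) * S.Γ j + B.map (S.D j) * S.Γ i := by
    rw [Rm]; noncomm_ring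
  have h5 : (B * S.Γ i) * S.Γ j - B.map (S.D i) * S.Γ j = c.Γ' i * (B * S.Γ j) := by
    rw [e1]; noncomm_ring
  have h6 : (B * S.Γ j) * S.Γ i - B.map (S.D j) * S.Γ i = c.Γ' j * (B * S.Γ i) := by
    rw [e2]; noncomm_ring
  rw [e2] at h5
  rw [e1] at h6
  rw [h0, h4, h2, h3, sub_eq_iff_eq_add.mp h5, sub_eq_iff_eq_add.mp h6]
  noncomm_ring

theorem Ric_eq (comm : S.IsCoordinate) : S.Ric = c.P * S'.Ric * c.P.transpose := by
  have h : ∀ i j, S.Rm i j = c.Q.transpose * ((∑ a, ∑ b, (c.P i a * c.P j b) • S'.Rm a b)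
      * c.P.transpose) := fun i j ↦ by
    rw [← c.Rm_eq comm, ← mul_assoc, c.QT_mul_PT, one_mul]
  have hQ : ∀ d a, ∑ i, c.Q d i * c.P i a = if d = a then 1 else 0 := fun d a ↦ by
    rw [← Matrix.mul_apply, c.Q_mul, Matrix.one_apply]
  ext j l
  have e1 : S.Ric j l = ∑ i, ∑ d, ∑ a, ∑ b,
      (c.Q d i * c.P i a) * (c.P j b * (S'.Rm a b * c.P.transpose) d l) := by
    simp only [Ric, Matrix.of_apply, h]
    refine Finset.sum_congr rfl fun i _ ↦ ?_
    rw [Matrix.mul_apply]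
    simp only [Finset.sum_mul, Matrix.smul_mul, Matrix.sum_apply, Matrix.smul_apply, smul_eq_mul,
      Finset.mul_sum, Matrix.transpose_apply (M := c.Q)]
    exact Finset.sum_congr rfl fun d _ ↦ Finset.sum_congr rfl fun a _ ↦
      Finset.sum_congr rfl fun b _ ↦ by ring
  have e2 : S.Ric j l = ∑ d, ∑ a, ∑ b,
      (∑ i, c.Q d i * c.P i a) * (c.P j b * (S'.Rm a b * c.P.transpose) d l) := by
    rw [e1, Finset.sum_comm]
    refine Finset.sum_congr rfl fun d _ ↦ ?_
    rw [Finset.sum_comm]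
    refine Finset.sum_congr rfl fun a _ ↦ ?_
    rw [Finset.sum_comm]
    exact Finset.sum_congr rfl fun b _ ↦ by rw [Finset.sum_mul]
  simp only [hQ, ite_mul, one_mul, zero_mul] at e2
  rw [e2, Matrix.mul_assoc, Matrix.mul_apply]
  have e3 : ∀ d, (∑ a, ∑ b, if d = a then c.P j b * (S'.Rm a b * c.P.transpose) d l else 0) =
      ∑ b, c.P j b * (S'.Rm d b * c.P.transpose) d l := fun d ↦ by
    rw [Finset.sum_comm]; simp
  simp only [e3]
  rw [Finset.sum_comm]
  refine Finset.sum_congr rfl fun b _ ↦ ?_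
  rw [← Finset.mul_sum]
  congr 1
  simp only [Matrix.mul_apply, Ric, Matrix.of_apply, Finset.sum_mul]
  exact Finset.sum_comm

theorem Hess_eq (u : A) : S.Hess u = c.P * S'.Hess u * c.P.transpose := by
  ext i j
  have e1 : ∑ k, S.Γ i k j * S.D k u = ∑ a, (c.P.transpose * S.Γ i) a j * S'.D a u := by
    simp only [c.D_eq, Matrix.mul_apply, Matrix.transpose_apply, Finset.mul_sum, Finset.sum_mul]
    rw [Finset.sum_comm]
    exact Finset.sum_congr rfl fun a _ ↦ Finset.sum_congr rfl fun k _ ↦ by ring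
  have e2 : S.D i (S.D j u) = ∑ a, S.D i (c.P j a) * S'.D a u
      + ∑ a, ∑ b, c.P i b * S'.D b (S'.D a u) * c.P j a := by
    rw [c.D_eq j u]
    simp only [map_sum, Derivation.leibniz, smul_eq_mul, Finset.sum_add_distrib]
    rw [add_comm]
    congr 1
    · exact Finset.sum_congr rfl fun a _ ↦ mul_comm _ _
    · refine Finset.sum_congr rfl fun a _ ↦ ?_
      rw [c.D_eq i, Finset.mul_sum]
      exact Finset.sum_congr rfl fun b _ ↦ by ring
  have e3 : ∑ a, (c.Γ' i * c.P.transpose) a j * S'.D a u =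
      ∑ a, ∑ b, c.P i b * (∑ k, S'.Γ b k a * S'.D k u) * c.P j a := by
    simp only [Γ', Matrix.mul_apply, Matrix.sum_apply, Matrix.smul_apply, smul_eq_mul,
      Finset.sum_mul, Finset.mul_sum, Matrix.transpose_apply]
    rw [Finset.sum_comm]
    refine Finset.sum_congr rfl fun a _ ↦ ?_
    rw [Finset.sum_comm]
    exact Finset.sum_congr rfl fun b _ ↦ Finset.sum_congr rfl fun k _ ↦ by ring
  have e4 : (c.P * S'.Hess u * c.P.transpose) i j =
      ∑ a, ∑ b, c.P i b * S'.Hess u b a * c.P j a := by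
    simp only [Matrix.mul_apply, Finset.sum_mul, Matrix.transpose_apply]
  rw [e4]
  simp only [Hess, Matrix.of_apply, mul_sub, sub_mul, Finset.sum_sub_distrib]
  rw [e1, e2, c.Γ_eq]
  simp only [Matrix.add_apply, add_mul, Finset.sum_add_distrib, Matrix.map_apply,
    Matrix.transpose_apply]
  rw [e3]
  ring

theorem sum_H_mul (S : FrameGeometry n A) (B : Matrix (Fin n) (Fin n) A) :
    ∑ i, ∑ j, S.H i j * B i j = (S.H * B).trace := by
  simp only [Matrix.trace, Matrix.diag, Matrix.mul_apply]
  rw [Finset.sum_comm]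
  exact Finset.sum_congr rfl fun i _ ↦ Finset.sum_congr rfl fun j _ ↦ by rw [S.H_symm]

theorem trace_conj (B : Matrix (Fin n) (Fin n) A) :
    (S.H * (c.P * B * c.P.transpose)).trace = (S'.H * B).trace := by
  rw [← c.H'_eq, ← mul_assoc, Matrix.trace_mul_comm]
  simp only [mul_assoc]

theorem Scal_eq (c : Change S S') (comm : S.IsCoordinate) : S.Scal = S'.Scal := by
  rw [Scal, Scal, sum_H_mul, sum_H_mul, c.Ric_eq comm, c.trace_conj]

theorem lap_eq (c : Change S S') (u : A) : S.lap u = S'.lap u := by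
  rw [lap, lap, sum_H_mul, sum_H_mul, c.Hess_eq, c.trace_conj]

theorem grad_eq (c : Change S S') (a b : A) : S.grad a b = S'.grad a b := by
  have h : ∀ (S : FrameGeometry n A), S.grad a b =
      ((Matrix.of fun i j ↦ S.D i a * S.D j b) * S.H).trace := fun S ↦ by
    rw [Matrix.trace_mul_comm, ← sum_H_mul]
    exact Finset.sum_congr rfl fun i _ ↦ Finset.sum_congr rfl fun j _ ↦ mul_assoc _ _ _
  have h2 : (Matrix.of fun i j ↦ S.D i a * S.D j b) =
      c.P * (Matrix.of fun i j ↦ S'.D i a * S'.D j b) * c.P.transpose := by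
    ext i j
    simp only [Matrix.of_apply, Matrix.mul_apply, Matrix.transpose_apply, c.D_eq, Finset.sum_mul,
      Finset.mul_sum]
    exact Finset.sum_congr rfl fun i _ ↦ Finset.sum_congr rfl fun j _ ↦ by ring
  rw [h, h, Matrix.trace_mul_comm, h2, c.trace_conj, Matrix.trace_mul_comm]

theorem pair_conj (B C : Matrix (Fin n) (Fin n) A) :
    S.pair (c.P * B * c.P.transpose) (c.P * C * c.P.transpose) = S'.pair B C := by
  have h : ∀ (S : FrameGeometry n A) (B C : Matrix (Fin n) (Fin n) A),
      S.pair B C = (S.H * C * S.H * B.transpose).trace := fun S B C ↦ by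
    rw [pair_eq, Matrix.trace_mul_comm]
    simp only [Matrix.trace, Matrix.diag, Matrix.mul_apply (M := B.transpose),
      Matrix.transpose_apply]
    exact Finset.sum_comm
  rw [h, h, ← c.H'_eq]
  simp only [Matrix.transpose_mul, Matrix.transpose_transpose, mul_assoc]
  rw [Matrix.trace_mul_comm c.P.transpose]
  simp only [mul_assoc]

theorem pair_eq (c : Change S S') (comm : S.IsCoordinate) (u : A) :
    S.pair (S.Ric + S.Hess u) (S.Ric + S.Hess u) =
      S'.pair (S'.Ric + S'.Hess u) (S'.Ric + S'.Hess u) := by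
  rw [← c.pair_conj, mul_add, add_mul, ← c.Ric_eq comm, ← c.Hess_eq]

end Change

end FrameGeometry

end DifferentialRing

/-! ### The differential ring of smooth functions on a set. -/

section SmoothRing

/-- Extension by zero of a function on a subset. -/
def extendZero {F : Type*} {s : Set F} (φ : s → ℝ) : F → ℝ := Function.extend Subtype.val φ 0

theorem extendZero_apply {F : Type*} {s : Set F} (φ : s → ℝ) (z : s) : extendZero φ z = φ z :=
  Subtype.val_injective.extend_apply φ 0 z

variable {F : Type*} [NormedAddCommGroup F] [NormedSpace ℝ F]

/-- Smoothness on s sees only values on s, so extension by zero is harmless. Elements of the ring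
are functions on s alone, so that equality in the ring is equality on s. -/
theorem contDiffOn_extendZero {s : Set F} {φ : s → ℝ} {ψ : F → ℝ} (hψ : ContDiffOn ℝ ∞ ψ s)
    (h : ∀ z : s, φ z = ψ z) : ContDiffOn ℝ ∞ (extendZero φ) s :=
  hψ.congr fun z hz ↦ (extendZero_apply φ ⟨z, hz⟩).trans (h ⟨z, hz⟩)

/-- The algebra of smooth functions on the set `s`. -/
def smoothRing (s : Set F) : Subalgebra ℝ (s → ℝ) where
  carrier := {φ | ContDiffOn ℝ ∞ (extendZero φ) s}
  mul_mem' {a b} ha hb := contDiffOn_extendZero (ha.mul hb) fun z ↦ by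
    simp [extendZero_apply]
  add_mem' {a b} ha hb := contDiffOn_extendZero (ha.add hb) fun z ↦ by
    simp [extendZero_apply]
  algebraMap_mem' r := contDiffOn_extendZero (ψ := fun _ ↦ r) contDiffOn_const fun z ↦ by simp

variable {s : Set F}

/-- The element of the ring given by a smooth function. -/
def smoothMk (ψ : F → ℝ) (hψ : ContDiffOn ℝ ∞ ψ s) : smoothRing s :=
  ⟨fun z ↦ ψ z, contDiffOn_extendZero hψ fun _ ↦ rfl⟩

/-- A function on the ambient space representing an element of the ring. -/
def smoothExt (a : smoothRing s) : F → ℝ := extendZero a.1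

theorem smoothExt_apply (a : smoothRing s) (z : s) : smoothExt a z = a.1 z :=
  extendZero_apply _ _

theorem smoothExt_eq (a : smoothRing s) {z : F} (hz : z ∈ s) : smoothExt a z = a.1 ⟨z, hz⟩ :=
  extendZero_apply _ ⟨z, hz⟩

theorem contDiffOn_smoothExt (a : smoothRing s) : ContDiffOn ℝ ∞ (smoothExt a) s := a.2

theorem differentiableWithinAt_smoothExt (a : smoothRing s) {z : F} (hz : z ∈ s) :
    DifferentiableWithinAt ℝ (smoothExt a) s z :=
  (contDiffOn_smoothExt a z hz).differentiableWithinAt (by simp)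

theorem hasFDerivWithinAt_smoothExt (a : smoothRing s) {z : F} (hz : z ∈ s) :
    HasFDerivWithinAt (smoothExt a) (fderivWithin ℝ (smoothExt a) s z) s z :=
  (differentiableWithinAt_smoothExt a hz).hasFDerivWithinAt

theorem fderivWithin_smoothExt (hs : UniqueDiffOn ℝ s) {a : smoothRing s} {ψ : F → ℝ}
    (h : ∀ z : s, a.1 z = ψ z) {z : F} (hz : z ∈ s) {ψ' : F →L[ℝ] ℝ}
    (hψ : HasFDerivWithinAt ψ ψ' s z) : fderivWithin ℝ (smoothExt a) s z = ψ' :=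
  (hψ.congr (fun y hy ↦ (smoothExt_eq a hy).trans (h ⟨y, hy⟩))
    ((smoothExt_eq a hz).trans (h ⟨z, hz⟩))).fderivWithin (hs z hz)

/-- The directional derivative as a derivation. -/
def dirDeriv (hs : UniqueDiffOn ℝ s) (v : F) : Derivation ℝ (smoothRing s) (smoothRing s) :=
  Derivation.mk'
    { toFun := fun a ↦ smoothMk (fun z ↦ fderivWithin ℝ (smoothExt a) s z v)
        (((contDiffOn_smoothExt a).fderivWithin hs (by simp)).clm_apply contDiffOn_const)
      map_add' := fun a b ↦ by
        ext z
        have h : ∀ y : s, (a + b).1 y = (smoothExt a + smoothExt b) y := fun y ↦ by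
          simp [smoothExt_apply]
        simp only [smoothMk, fderivWithin_smoothExt hs h z.2
          ((hasFDerivWithinAt_smoothExt a z.2).add (hasFDerivWithinAt_smoothExt b z.2))]
        rfl
      map_smul' := fun r a ↦ by
        ext z
        have h : ∀ y : s, (r • a).1 y = (r • smoothExt a) y := fun y ↦ by
          simp [smoothExt_apply]
        simp only [smoothMk, fderivWithin_smoothExt hs h z.2
          ((hasFDerivWithinAt_smoothExt a z.2).const_smul r)]
        rfl }
    (fun a b ↦ by
      ext z
      have h : ∀ y : s, (a * b).1 y = (smoothExt a * smoothExt b) y := fun y ↦ by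
        simp [smoothExt_apply]
      simp only [LinearMap.coe_mk, AddHom.coe_mk, smoothMk, fderivWithin_smoothExt hs h z.2
        ((hasFDerivWithinAt_smoothExt a z.2).mul (hasFDerivWithinAt_smoothExt b z.2)),
        smoothExt_apply]
      rfl)

theorem dirDeriv_apply (hs : UniqueDiffOn ℝ s) (v : F) (a : smoothRing s) (z : s) :
    (dirDeriv hs v a).1 z = fderivWithin ℝ (smoothExt a) s z v := rfl

theorem two_le_infty : minSmoothness ℝ 2 ≤ (∞ : WithTop ℕ∞) := by
  rw [minSmoothness_of_isRCLikeNormedField]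
  exact WithTop.coe_le_coe.2 le_top

/-- Symmetry of second derivatives within s, valid at points in the closure of the interior. Hence
time and space derivatives commute also at endpoints of J. -/
theorem dirDeriv_comm (hs : UniqueDiffOn ℝ s) (hs' : s ⊆ closure (interior s))
    (v w : F) (a : smoothRing s) :
    dirDeriv hs v (dirDeriv hs w a) = dirDeriv hs w (dirDeriv hs v a) := by
  ext z
  have h : ∀ v w : F, (dirDeriv hs v (dirDeriv hs w a)).1 z =
      fderivWithin ℝ (fderivWithin ℝ (smoothExt a) s) s z v w := fun v w ↦ by
    have hd : HasFDerivWithinAt (fderivWithin ℝ (smoothExt a) s)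
        (fderivWithin ℝ (fderivWithin ℝ (smoothExt a) s) s z) s z :=
      (((contDiffOn_smoothExt a).fderivWithin hs (m := ∞) (by simp) z z.2).differentiableWithinAt
        (by simp)).hasFDerivWithinAt
    rw [dirDeriv_apply, fderivWithin_smoothExt hs (ψ := fun z ↦ fderivWithin ℝ (smoothExt a) s z w)
      (fun y ↦ rfl) z.2 (hd.clm_apply (hasFDerivWithinAt_const w _ _))]
    simp
  rw [h, h]
  exact (contDiffOn_smoothExt a z z.2).isSymmSndFDerivWithinAt two_le_infty hs (hs' z.2) z.2 v w

theorem exists_mul_eq_one {a : smoothRing s} (h : ∀ z, a.1 z ≠ 0) : IsUnit a := by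
  refine IsUnit.of_mul_eq_one (smoothMk (fun z ↦ (smoothExt a z)⁻¹)
    ((contDiffOn_smoothExt a).inv fun z hz ↦ by rw [smoothExt_eq a hz]; exact h _)) ?_
  ext z
  simp [smoothMk, smoothExt_apply, h z]

end SmoothRing

/-! ### Comparison with the coordinate expressions -/

section Represents

variable {n : ℕ} {F : Type*} [NormedAddCommGroup F] [NormedSpace ℝ F] {s : Set F}

/-- `a` is the function `ψ` of the time `T` and the coordinates `c`. -/
def Represents (T : s → ℝ) (c : s → EuclideanSpace ℝ (Fin n)) (a : smoothRing s)
    (ψ : ℝ → EuclideanSpace ℝ (Fin n) → ℝ) : Prop :=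
  ∀ z, a.1 z = ψ (T z) (c z)

/-- The frame of `S` is the coordinate frame for the coordinates `c`, and its metric is `G`. -/
structure FrameGeometry.Realizes (S : FrameGeometry n (smoothRing s)) (T : s → ℝ)
    (c : s → EuclideanSpace ℝ (Fin n))
    (G : ℝ → EuclideanSpace ℝ (Fin n) → Matrix (Fin n) (Fin n) ℝ) : Prop where
  D : ∀ i a ψ, Represents T c a ψ → Represents T c (S.D i a) fun t y ↦ pderiv i (ψ t) y
  G : ∀ i j, Represents T c (S.G i j) fun t y ↦ G t y i j

namespace FrameGeometry.Realizes

variable {S : FrameGeometry n (smoothRing s)} {T : s → ℝ} {c : s → EuclideanSpace ℝ (Fin n)}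
  {G : ℝ → EuclideanSpace ℝ (Fin n) → Matrix (Fin n) (Fin n) ℝ}

theorem sum_apply {ι : Type*} (t : Finset ι) (f : ι → smoothRing s) (z : s) :
    (∑ i ∈ t, f i).1 z = ∑ i ∈ t, (f i).1 z := by
  exact map_sum ((Pi.evalAlgHom ℝ (fun _ : s ↦ ℝ) z).comp (smoothRing s).val) f t

theorem apply_mul (a b : smoothRing s) (z : s) : (a * b).1 z = a.1 z * b.1 z := rfl
theorem apply_add (a b : smoothRing s) (z : s) : (a + b).1 z = a.1 z + b.1 z := rfl
theorem apply_sub (a b : smoothRing s) (z : s) : (a - b).1 z = a.1 z - b.1 z := rfl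
theorem apply_smul (r : ℝ) (a : smoothRing s) (z : s) : (r • a).1 z = r * a.1 z := rfl

theorem H (hS : S.Realizes T c G) (i j : Fin n) :
    Represents T c (S.H i j) fun t y ↦ (G t y)⁻¹ i j := fun z ↦ by
  have h : G (T z) (c z) * (Matrix.of fun i j ↦ (S.H i j).1 z) = 1 := by
    ext k l
    have := congrArg (fun a : smoothRing s ↦ a.1 z) (congrFun₂ S.mul_inv k l)
    simp only [Matrix.mul_apply, sum_apply, apply_mul, hS.G _ _ z, Matrix.of_apply] at this ⊢
    rw [this, Matrix.one_apply, Matrix.one_apply]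
    split_ifs <;> rfl
  simp only [Matrix.inv_eq_right_inv h, Matrix.of_apply]

theorem Γ (hS : S.Realizes T c G) (i k j : Fin n) :
    Represents T c (S.Γ i k j) fun t y ↦ christoffel (G t) k i j y := fun z ↦ by
  simp only [FrameGeometry.Γ, Matrix.of_apply, apply_smul, sum_apply, apply_mul, apply_add,
    apply_sub, hS.H _ _ z, hS.D _ _ _ (hS.G _ _) z, christoffel]

theorem Rm (hS : S.Realizes T c G) (h i j l : Fin n) :
    Represents T c (S.Rm i j h l) fun t y ↦ riemann (G t) h i j l y := fun z ↦ by
  simp only [FrameGeometry.Rm, Matrix.add_apply, Matrix.sub_apply, Matrix.map_apply,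
    Matrix.mul_apply, apply_add, apply_sub, sum_apply, apply_mul, hS.Γ _ _ _ z,
    hS.D _ _ _ (hS.Γ _ _ _) z, riemann, Finset.sum_sub_distrib]

theorem Ric (hS : S.Realizes T c G) (j l : Fin n) :
    Represents T c (S.Ric j l) fun t y ↦ ricci (G t) j l y := fun z ↦ by
  simp only [FrameGeometry.Ric, Matrix.of_apply, sum_apply, hS.Rm _ _ _ _ z, ricci]

theorem Scal (hS : S.Realizes T c G) :
    Represents T c S.Scal fun t y ↦ scalar (G t) y := fun z ↦ by
  simp only [FrameGeometry.Scal, sum_apply, apply_mul, hS.H _ _ z, hS.Ric _ _ z, scalar]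

theorem grad (hS : S.Realizes T c G)
    {a : smoothRing s} {u : ℝ → EuclideanSpace ℝ (Fin n) → ℝ} (ha : Represents T c a u) :
    Represents T c (S.grad a a) fun t y ↦ gradSq (G t) (u t) y := fun z ↦ by
  simp only [FrameGeometry.grad, sum_apply, apply_mul, hS.H _ _ z, hS.D _ _ _ ha z, gradSq]

theorem Hess (hS : S.Realizes T c G)
    {a : smoothRing s} {u : ℝ → EuclideanSpace ℝ (Fin n) → ℝ} (ha : Represents T c a u)
    (i j : Fin n) : Represents T c (S.Hess a i j) fun t y ↦ hessian (G t) (u t) i j y := fun z ↦ by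
  simp only [FrameGeometry.Hess, Matrix.of_apply, sum_apply, apply_sub, apply_mul, hS.Γ _ _ _ z,
    hS.D _ _ _ ha z, hS.D _ _ _ (hS.D _ _ _ ha) z, hessian]

theorem lap (hS : S.Realizes T c G)
    {a : smoothRing s} {u : ℝ → EuclideanSpace ℝ (Fin n) → ℝ} (ha : Represents T c a u) :
    Represents T c (S.lap a) fun t y ↦ laplacian (G t) (u t) y := fun z ↦ by
  simp only [FrameGeometry.lap, sum_apply, apply_mul, hS.H _ _ z, hS.Hess ha _ _ z, laplacian]

theorem pair (hS : S.Realizes T c G)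
    {a : smoothRing s} {u : ℝ → EuclideanSpace ℝ (Fin n) → ℝ} (ha : Represents T c a u) :
    Represents T c (S.pair (S.Ric + S.Hess a) (S.Ric + S.Hess a))
      fun t y ↦ ricciHessSq (G t) (u t) y := fun z ↦ by
  simp only [FrameGeometry.pair, sum_apply, apply_mul, apply_add, Matrix.add_apply, hS.H _ _ z,
    hS.Hess ha _ _ z, hS.Ric _ _ z, ricciHessSq]

end FrameGeometry.Realizes

end Represents

/-! ### The coordinate frame over a time interval and an open set. -/

section ChartFrame

variable {n : ℕ}

theorem euclidean_eq_sum (v : EuclideanSpace ℝ (Fin n)) :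
    v = ∑ i, v i • EuclideanSpace.single i (1 : ℝ) := by
  have := (EuclideanSpace.basisFun (Fin n) ℝ).sum_repr v
  simpa using this.symm

theorem fderiv_apply_eq_sum (u : EuclideanSpace ℝ (Fin n) → ℝ) (y v : EuclideanSpace ℝ (Fin n)) :
    fderiv ℝ u y v = ∑ i, v i * pderiv i u y := by
  conv_lhs => rw [euclidean_eq_sum v, map_sum]
  simp [pderiv]

theorem pderiv_component {τ : EuclideanSpace ℝ (Fin n) → EuclideanSpace ℝ (Fin n)}
    {y : EuclideanSpace ℝ (Fin n)} (h : DifferentiableAt ℝ τ y) (i a : Fin n) :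
    pderiv i (fun z ↦ τ z a) y = fderiv ℝ τ y (EuclideanSpace.single i 1) a := by
  have := ((EuclideanSpace.proj a : EuclideanSpace ℝ (Fin n) →L[ℝ] ℝ).hasFDerivAt.comp y
    h.hasFDerivAt).fderiv
  rw [pderiv]
  erw [this]
  rfl

theorem nonempty_interior_of_nontrivial {J : Set ℝ} (hJ : J.OrdConnected) (hJ' : J.Nontrivial) :
    (interior J).Nonempty := by
  obtain ⟨a, ha, b, hb, hab⟩ := hJ'.exists_lt
  have h : Ioo a b ⊆ interior J :=
    interior_maximal (Ioo_subset_Icc_self.trans (hJ.out ha hb)) isOpen_Ioo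
  exact (nonempty_Ioo.2 hab).mono h

theorem uniqueDiffOn_of_nontrivial {J : Set ℝ} (hJ : J.OrdConnected) (hJ' : J.Nontrivial) :
    UniqueDiffOn ℝ J :=
  uniqueDiffOn_convex hJ.convex (nonempty_interior_of_nontrivial hJ hJ')

theorem uniqueDiffOn_cylinder {J : Set ℝ} (hJ : J.OrdConnected) (hJ' : J.Nontrivial)
    {U : Set (EuclideanSpace ℝ (Fin n))} (hU : IsOpen U) : UniqueDiffOn ℝ (J ×ˢ U) :=
  (uniqueDiffOn_of_nontrivial hJ hJ').prod hU.uniqueDiffOn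

theorem cylinder_subset_closure {J : Set ℝ} (hJ : J.OrdConnected) (hJ' : J.Nontrivial)
    {U : Set (EuclideanSpace ℝ (Fin n))} (hU : IsOpen U) :
    J ×ˢ U ⊆ closure (interior (J ×ˢ U)) := by
  rw [interior_prod_eq, closure_prod_eq, hU.interior_eq,
    Convex.closure_interior_eq_closure_of_nonempty_interior (𝕜 := ℝ) hJ.convex
      (nonempty_interior_of_nontrivial hJ hJ')]
  exact prod_mono subset_closure subset_closure

/-- A time-dependent metric with smooth coefficients on an open set of coordinates. -/
structure SmoothCoeff (J : Set ℝ) (U : Set (EuclideanSpace ℝ (Fin n)))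
    (G : ℝ → EuclideanSpace ℝ (Fin n) → Matrix (Fin n) (Fin n) ℝ) : Prop where
  smooth : ∀ i j, ContDiffOn ℝ ∞ (fun z : ℝ × EuclideanSpace ℝ (Fin n) ↦ G z.1 z.2 i j) (J ×ˢ U)
  symm : ∀ t ∈ J, ∀ y ∈ U, ∀ i j, G t y i j = G t y j i
  det_ne_zero : ∀ t ∈ J, ∀ y ∈ U, (G t y).det ≠ 0

/-- The matrix over the ring of smooth functions with the given entries. -/
def smoothMatrix {F : Type*} [NormedAddCommGroup F] [NormedSpace ℝ F] {s : Set F}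
    (G : F → Matrix (Fin n) (Fin n) ℝ) (hG : ∀ i j, ContDiffOn ℝ ∞ (fun z ↦ G z i j) s) :
    Matrix (Fin n) (Fin n) (smoothRing s) :=
  Matrix.of fun i j ↦ smoothMk (fun z ↦ G z i j) (hG i j)

/-- Evaluation at a point. -/
def smoothEval {F : Type*} [NormedAddCommGroup F] [NormedSpace ℝ F] {s : Set F} (z : s) :
    smoothRing s →ₐ[ℝ] ℝ :=
  (Pi.evalAlgHom ℝ (fun _ : s ↦ ℝ) z).comp (smoothRing s).val

theorem smoothMatrix_mul_inv {F : Type*} [NormedAddCommGroup F] [NormedSpace ℝ F] {s : Set F}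
    (G : F → Matrix (Fin n) (Fin n) ℝ) (hG : ∀ i j, ContDiffOn ℝ ∞ (fun z ↦ G z i j) s)
    (hdet : ∀ z ∈ s, (G z).det ≠ 0) : smoothMatrix G hG * (smoothMatrix G hG)⁻¹ = 1 := by
  apply Matrix.mul_nonsing_inv
  apply exists_mul_eq_one
  intro z
  have := (smoothEval z).toRingHom.map_det (smoothMatrix G hG)
  change smoothEval z _ ≠ 0
  erw [this]
  exact hdet z z.2

variable {J : Set ℝ} {U : Set (EuclideanSpace ℝ (Fin n))}
  {G : ℝ → EuclideanSpace ℝ (Fin n) → Matrix (Fin n) (Fin n) ℝ}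

/-- The coordinate frame on `J × U` with metric `G`. -/
def chartFrame (hs : UniqueDiffOn ℝ (J ×ˢ U)) (hG : SmoothCoeff J U G) :
    FrameGeometry n (smoothRing (J ×ˢ U)) where
  D i := dirDeriv hs (0, EuclideanSpace.single i 1)
  G := smoothMatrix (fun z ↦ G z.1 z.2) hG.smooth
  H := (smoothMatrix (fun z ↦ G z.1 z.2) hG.smooth)⁻¹
  symm _ _ := by ext z; exact hG.symm _ z.2.1 _ z.2.2 _ _
  mul_inv := smoothMatrix_mul_inv _ _ fun z hz ↦ hG.det_ne_zero _ hz.1 _ hz.2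

/-- At fixed time the set U is open, so the derivative within J × U, restricted to spatial
directions, is a full derivative. Thus `dirDeriv` agrees with `pderiv`, and ψ need only be known on
J × U. -/
theorem hasFDerivAt_slice (hU : IsOpen U) (a : smoothRing (J ×ˢ U))
    {ψ : ℝ → EuclideanSpace ℝ (Fin n) → ℝ}
    (ha : ∀ z, a.1 z = ψ z.1.1 z.1.2) (z : (J ×ˢ U : Set (ℝ × EuclideanSpace ℝ (Fin n)))) :
    HasFDerivAt (ψ z.1.1) ((fderivWithin ℝ (smoothExt a) (J ×ˢ U) z).comp
      (ContinuousLinearMap.inr ℝ ℝ (EuclideanSpace ℝ (Fin n)))) z.1.2 := by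
  obtain ⟨⟨t, y⟩, ht, hy⟩ := z
  have h1 : HasFDerivWithinAt (fun y' ↦ (t, y')) (ContinuousLinearMap.inr ℝ ℝ _) U y :=
    (hasFDerivAt_prodMk_right t y).hasFDerivWithinAt
  have h2 := (hasFDerivWithinAt_smoothExt a (z := (t, y)) ⟨ht, hy⟩).comp y h1
    fun y' hy' ↦ ⟨ht, hy'⟩
  refine (h2.hasFDerivAt (hU.mem_nhds hy)).congr_of_eventuallyEq ?_
  filter_upwards [hU.mem_nhds hy] with y' hy'
  have := ha ⟨(t, y'), ht, hy'⟩
  rw [← smoothExt_apply] at this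
  exact this.symm

theorem hasDerivWithinAt_slice (hs : UniqueDiffOn ℝ (J ×ˢ U)) (a : smoothRing (J ×ˢ U))
    {ψ : ℝ → EuclideanSpace ℝ (Fin n) → ℝ}
    (ha : ∀ z, a.1 z = ψ z.1.1 z.1.2) (z : (J ×ˢ U : Set (ℝ × EuclideanSpace ℝ (Fin n)))) :
    HasDerivWithinAt (fun t ↦ ψ t z.1.2) ((dirDeriv hs (1, 0) a).1 z) J z.1.1 := by
  obtain ⟨⟨t, y⟩, ht, hy⟩ := z
  have h1 : HasFDerivWithinAt (fun t' ↦ (t', y)) (ContinuousLinearMap.inl ℝ ℝ _) J t :=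
    (hasFDerivAt_prodMk_left t y).hasFDerivWithinAt
  have h0 : MapsTo (fun t' ↦ (t', y)) J (J ×ˢ U) := fun t' ht' ↦ ⟨ht', hy⟩
  have h2 := (hasFDerivWithinAt_smoothExt a (z := (t, y)) ⟨ht, hy⟩).comp t h1 h0
  have h3 : ∀ t' ∈ J, ψ t' y = (smoothExt a ∘ fun t' ↦ (t', y)) t' := fun t' ht' ↦ by
    have := ha ⟨(t', y), ht', hy⟩
    rw [← smoothExt_apply] at this
    exact this.symm
  exact h2.hasDerivWithinAt.congr_of_mem h3 ht

theorem chartFrame_realizes (hs : UniqueDiffOn ℝ (J ×ˢ U)) (hU : IsOpen U)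
    (hG : SmoothCoeff J U G) :
    (chartFrame hs hG).Realizes (fun z ↦ z.1.1) (fun z ↦ z.1.2) G where
  D i a ψ ha z := by
    change fderivWithin ℝ (smoothExt a) (J ×ˢ U) z _ = fderiv ℝ (ψ z.1.1) z.1.2 _
    rw [(hasFDerivAt_slice hU a ha z).fderiv]
    rfl
  G _ _ _ := rfl

end ChartFrame

/-! ### Invariance of the curvature quantities under transition maps. -/

section Transition

variable {n : ℕ}

/-- A change of coordinates `τ : U → V` with inverse `τ'` that takes the metric `G` to `G'`. -/
structure Transition (U V : Set (EuclideanSpace ℝ (Fin n)))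
    (τ τ' : EuclideanSpace ℝ (Fin n) → EuclideanSpace ℝ (Fin n))
    (G G' : EuclideanSpace ℝ (Fin n) → Matrix (Fin n) (Fin n) ℝ) : Prop where
  isOpen_source : IsOpen U
  isOpen_target : IsOpen V
  mapsTo : MapsTo τ U V
  mapsTo' : MapsTo τ' V U
  leftInv : ∀ y ∈ U, τ' (τ y) = y
  rightInv : ∀ y ∈ V, τ (τ' y) = y
  smooth : ContDiffOn ℝ ∞ τ U
  smooth' : ContDiffOn ℝ ∞ τ' V
  coeff : ∀ i j, ContDiffOn ℝ ∞ (fun y ↦ G y i j) U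
  coeff' : ∀ i j, ContDiffOn ℝ ∞ (fun y ↦ G' y i j) V
  symm : ∀ y ∈ U, ∀ i j, G y i j = G y j i
  symm' : ∀ y ∈ V, ∀ i j, G' y i j = G' y j i
  det_ne_zero : ∀ y ∈ U, (G y).det ≠ 0
  det_ne_zero' : ∀ y ∈ V, (G' y).det ≠ 0
  metric_eq : ∀ y ∈ U, ∀ i j, G y i j =
    ∑ a, ∑ b, pderiv i (fun z ↦ τ z a) y * pderiv j (fun z ↦ τ z b) y * G' (τ y) a b

namespace Transition

variable {U V : Set (EuclideanSpace ℝ (Fin n))}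
  {τ τ' : EuclideanSpace ℝ (Fin n) → EuclideanSpace ℝ (Fin n)}
  {G G' : EuclideanSpace ℝ (Fin n) → Matrix (Fin n) (Fin n) ℝ} (h : Transition U V τ τ' G G')
include h

theorem uniqueDiffOn : UniqueDiffOn ℝ ((univ : Set ℝ) ×ˢ U) :=
  uniqueDiffOn_univ.prod h.isOpen_source.uniqueDiffOn

theorem smoothCoeff : SmoothCoeff univ U (fun _ ↦ G) where
  smooth i j := (h.coeff i j).comp contDiffOn_snd fun _ hz ↦ hz.2
  symm _ _ := h.symm
  det_ne_zero _ _ := h.det_ne_zero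

theorem smooth_comp {φ : EuclideanSpace ℝ (Fin n) → ℝ} (hφ : ContDiffOn ℝ ∞ φ V) :
    ContDiffOn ℝ ∞ (fun z : ℝ × EuclideanSpace ℝ (Fin n) ↦ φ (τ z.2)) (univ ×ˢ U) :=
  (hφ.comp h.smooth h.mapsTo).comp contDiffOn_snd fun _ hz ↦ hz.2

theorem differentiableAt {y : EuclideanSpace ℝ (Fin n)} (hy : y ∈ U) : DifferentiableAt ℝ τ y :=
  (h.smooth.contDiffAt (h.isOpen_source.mem_nhds hy)).differentiableAt (by simp)

theorem differentiableAt' {y : EuclideanSpace ℝ (Fin n)} (hy : y ∈ V) : DifferentiableAt ℝ τ' y :=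
  (h.smooth'.contDiffAt (h.isOpen_target.mem_nhds hy)).differentiableAt (by simp)

theorem smooth_pderiv' (b i : Fin n) : ContDiffOn ℝ ∞ (pderiv b fun w ↦ τ' w i) V :=
  ((contDiffOn_euclidean.1 h.smooth' i).fderiv_of_isOpen h.isOpen_target (by simp)).clm_apply
    contDiffOn_const

/-- The Jacobian matrix of the inverse. -/
def Q : Matrix (Fin n) (Fin n) (smoothRing ((univ : Set ℝ) ×ˢ U)) :=
  Matrix.of fun b i ↦ smoothMk (fun z ↦ pderiv b (fun w ↦ τ' w i) (τ z.2))
    (h.smooth_comp (h.smooth_pderiv' b i))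

/-- The new frame. -/
def frame : FrameGeometry n (smoothRing ((univ : Set ℝ) ×ˢ U)) :=
  chartFrame h.uniqueDiffOn h.smoothCoeff

/-- The coordinate `τ_a`. -/
def coord (a : Fin n) : smoothRing ((univ : Set ℝ) ×ˢ U) :=
  smoothMk (fun z ↦ τ z.2 a)
    ((contDiffOn_euclidean.1 h.smooth a).comp contDiffOn_snd fun _ hz ↦ hz.2)

/-- The Jacobian matrix. -/
def P : Matrix (Fin n) (Fin n) (smoothRing ((univ : Set ℝ) ×ˢ U)) :=
  Matrix.of fun i a ↦ h.frame.D i (h.coord a)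

theorem realizes : h.frame.Realizes (fun z ↦ z.1.1) (fun z ↦ z.1.2) fun _ ↦ G :=
  chartFrame_realizes h.uniqueDiffOn h.isOpen_source h.smoothCoeff

theorem P_apply (i a : Fin n) (z : ((univ : Set ℝ) ×ˢ U : Set (ℝ × EuclideanSpace ℝ (Fin n)))) :
    (h.P i a).1 z = pderiv i (fun y ↦ τ y a) z.1.2 :=
  h.realizes.D i (h.coord a) (fun _ y ↦ τ y a) (fun _ ↦ rfl) z

/-- The old frame, in the new coordinates. -/
def frame' : FrameGeometry n (smoothRing ((univ : Set ℝ) ×ˢ U)) where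
  D b := ∑ i, h.Q b i • h.frame.D i
  G := smoothMatrix (fun z ↦ G' (τ z.2)) fun i j ↦ h.smooth_comp (h.coeff' i j)
  H := (smoothMatrix (fun z ↦ G' (τ z.2)) fun i j ↦ h.smooth_comp (h.coeff' i j))⁻¹
  symm _ _ := by ext z; exact h.symm' _ (h.mapsTo z.2.2) _ _
  mul_inv := smoothMatrix_mul_inv _ _ fun z hz ↦ h.det_ne_zero' _ (h.mapsTo hz.2)

theorem D'_apply (b : Fin n) (a : smoothRing ((univ : Set ℝ) ×ˢ U)) :
    h.frame'.D b a = ∑ i, h.Q b i * h.frame.D i a := by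
  have := map_sum (Derivation.coeFnAddMonoidHom (R := ℝ) (A := smoothRing ((univ : Set ℝ) ×ˢ U))
    (M := smoothRing ((univ : Set ℝ) ×ˢ U))) (fun i ↦ h.Q b i • h.frame.D i) Finset.univ
  have := congrFun this a
  rw [Finset.sum_apply] at this
  exact this

theorem P_mul_Q : h.P * h.Q = 1 := by
  ext i j z
  obtain ⟨⟨t, y⟩, ht, hy⟩ := z
  rw [Matrix.mul_apply, FrameGeometry.Realizes.sum_apply]
  simp only [FrameGeometry.Realizes.apply_mul, h.P_apply]
  have h1 : DifferentiableAt ℝ (fun w ↦ τ' w j) (τ y) :=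
    ((contDiffOn_euclidean.1 h.smooth' j).contDiffAt
      (h.isOpen_target.mem_nhds (h.mapsTo hy))).differentiableAt (by simp)
  have h2 : (fun z : EuclideanSpace ℝ (Fin n) ↦ z j) =ᶠ[nhds y] (fun w ↦ τ' w j) ∘ τ := by
    filter_upwards [h.isOpen_source.mem_nhds hy] with w hw
    simp [h.leftInv w hw]
  have h3 : pderiv i (fun z : EuclideanSpace ℝ (Fin n) ↦ z j) y =
      ∑ b, pderiv i (fun w ↦ τ w b) y * pderiv b (fun w ↦ τ' w j) (τ y) := by
    rw [pderiv, h2.fderiv_eq, fderiv_comp _ h1 (h.differentiableAt hy),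
      ContinuousLinearMap.comp_apply, fderiv_apply_eq_sum]
    simp only [pderiv_component (h.differentiableAt hy)]
  have h4 : pderiv i (fun z : EuclideanSpace ℝ (Fin n) ↦ z j) y = if i = j then 1 else 0 := by
    have := pderiv_component (τ := id) (y := y) differentiableAt_id i j
    simp only [id_eq] at this
    rw [this, fderiv_id]
    simp [eq_comm]
  refine (h3.symm.trans h4).trans ?_
  rw [Matrix.one_apply]
  split_ifs <;> rfl

theorem isCoordinate : h.frame.IsCoordinate := fun _ _ a ↦
  dirDeriv_comm h.uniqueDiffOn (cylinder_subset_closure ordConnected_univ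
    (Set.nontrivial_univ) h.isOpen_source) _ _ a

/-- The change of frame. -/
def change : h.frame.Change h.frame' where
  P := h.P
  Q := h.Q
  mul_Q := h.P_mul_Q
  D_eq i a := by
    have e : ∀ j, (h.P * h.Q) i j * h.frame.D j a = if i = j then h.frame.D j a else 0 :=
      fun j ↦ by rw [h.P_mul_Q, Matrix.one_apply, ite_mul, one_mul, zero_mul]
    have e' : h.frame.D i a = ∑ j, (h.P * h.Q) i j * h.frame.D j a := by
      simp only [e, Finset.sum_ite_eq, Finset.mem_univ, if_true]
    rw [e']
    simp only [D'_apply, Matrix.mul_apply, Finset.sum_mul, Finset.mul_sum]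
    rw [Finset.sum_comm]
    simp only [mul_assoc]
  D_P := fun _ _ _ ↦ h.isCoordinate _ _ _
  G_eq := by
    ext i j z
    refine (h.metric_eq z.1.2 z.2.2 i j).trans ?_
    simp only [Matrix.mul_apply, FrameGeometry.Realizes.sum_apply,
      FrameGeometry.Realizes.apply_mul, Matrix.transpose_apply, h.P_apply, Finset.sum_mul]
    rw [Finset.sum_comm]
    refine Finset.sum_congr rfl fun a _ ↦ Finset.sum_congr rfl fun b _ ↦ ?_
    rw [mul_right_comm]
    rfl

/-- The geometry in the coordinates τ(y) is expressed over the same ring, functions of y, so that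
`Change` applies. By the chain rule through τ', the derivation ∑ Q_bi ∂_i is the partial derivative
in the coordinates τ. -/
theorem realizes' : h.frame'.Realizes (fun z ↦ z.1.1) (fun z ↦ τ z.1.2) fun _ ↦ G' where
  D b a ψ ha z := by
    obtain ⟨⟨t, y⟩, ht, hy⟩ := z
    have hV := h.mapsTo hy
    have h1 := hasFDerivAt_slice h.isOpen_source a (ψ := fun t y ↦ smoothExt a (t, y))
      (fun z ↦ (smoothExt_apply a z).symm) ⟨(t, y), ht, hy⟩
    have h2 : HasFDerivAt (ψ t) ((((fderivWithin ℝ (smoothExt a) (univ ×ˢ U) (t, y)).comp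
        (ContinuousLinearMap.inr ℝ ℝ (EuclideanSpace ℝ (Fin n)))).comp (fderiv ℝ τ' (τ y))))
        (τ y) := by
      have h3 : HasFDerivAt (fun y ↦ smoothExt a (t, y))
          ((fderivWithin ℝ (smoothExt a) (univ ×ˢ U) (t, y)).comp
            (ContinuousLinearMap.inr ℝ ℝ (EuclideanSpace ℝ (Fin n)))) (τ' (τ y)) := by
        rw [h.leftInv y hy]; exact h1
      refine (h3.comp (τ y) (h.differentiableAt' hV).hasFDerivAt).congr_of_eventuallyEq ?_
      filter_upwards [h.isOpen_target.mem_nhds hV] with w hw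
      have := ha ⟨(t, τ' w), mem_univ _, h.mapsTo' hw⟩
      rw [← smoothExt_apply] at this
      simp only [h.rightInv w hw] at this
      exact this.symm
    change (h.frame'.D b a).1 _ = fderiv ℝ (ψ t) (τ y) _
    rw [h2.fderiv, D'_apply, FrameGeometry.Realizes.sum_apply]
    simp only [ContinuousLinearMap.comp_apply]
    conv_rhs => rw [euclidean_eq_sum (fderiv ℝ τ' (τ y) (EuclideanSpace.single b 1))]
    rw [map_sum, map_sum]
    refine Finset.sum_congr rfl fun i _ ↦ ?_
    rw [← pderiv_component (h.differentiableAt' hV), map_smul, map_smul]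
    rfl
  G _ _ _ := rfl

/-- Both sides are values of one ring element, by `Change.Scal_eq`. Time is a dummy variable here
and is set to 0, as in the next three proofs. -/
theorem scalar_eq {y : EuclideanSpace ℝ (Fin n)} (hy : y ∈ U) :
    scalar G y = scalar G' (τ y) := by
  have e1 := h.realizes.Scal ⟨((0 : ℝ), y), mem_univ _, hy⟩
  have e2 := h.realizes'.Scal ⟨((0 : ℝ), y), mem_univ _, hy⟩
  rw [h.change.Scal_eq h.isCoordinate] at e1
  exact e1.symm.trans e2

variable {u u' : EuclideanSpace ℝ (Fin n) → ℝ} (hu : ContDiffOn ℝ ∞ u U)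
  (huu' : ∀ y ∈ U, u y = u' (τ y))
include hu huu'

theorem gradSq_eq {y : EuclideanSpace ℝ (Fin n)} (hy : y ∈ U) :
    gradSq G u y = gradSq G' u' (τ y) := by
  let a := smoothMk (fun z : ℝ × EuclideanSpace ℝ (Fin n) ↦ u z.2)
    (hu.comp contDiffOn_snd fun z (hz : z ∈ (univ : Set ℝ) ×ˢ U) ↦ hz.2)
  have e1 := h.realizes.grad (a := a) (u := fun _ ↦ u) (fun _ ↦ rfl) ⟨((0 : ℝ), y), mem_univ _, hy⟩
  have e2 := h.realizes'.grad (a := a) (u := fun _ ↦ u') (fun z ↦ huu' _ z.2.2)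
    ⟨((0 : ℝ), y), mem_univ _, hy⟩
  rw [h.change.grad_eq] at e1
  exact e1.symm.trans e2

theorem laplacian_eq {y : EuclideanSpace ℝ (Fin n)} (hy : y ∈ U) :
    laplacian G u y = laplacian G' u' (τ y) := by
  let a := smoothMk (fun z : ℝ × EuclideanSpace ℝ (Fin n) ↦ u z.2)
    (hu.comp contDiffOn_snd fun z (hz : z ∈ (univ : Set ℝ) ×ˢ U) ↦ hz.2)
  have e1 := h.realizes.lap (a := a) (u := fun _ ↦ u) (fun _ ↦ rfl) ⟨((0 : ℝ), y), mem_univ _, hy⟩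
  have e2 := h.realizes'.lap (a := a) (u := fun _ ↦ u') (fun z ↦ huu' _ z.2.2)
    ⟨((0 : ℝ), y), mem_univ _, hy⟩
  rw [h.change.lap_eq] at e1
  exact e1.symm.trans e2

theorem ricciHessSq_eq {y : EuclideanSpace ℝ (Fin n)} (hy : y ∈ U) :
    ricciHessSq G u y = ricciHessSq G' u' (τ y) := by
  let a := smoothMk (fun z : ℝ × EuclideanSpace ℝ (Fin n) ↦ u z.2)
    (hu.comp contDiffOn_snd fun z (hz : z ∈ (univ : Set ℝ) ×ˢ U) ↦ hz.2)
  have e1 := h.realizes.pair (a := a) (u := fun _ ↦ u) (fun _ ↦ rfl) ⟨((0 : ℝ), y), mem_univ _, hy⟩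
  have e2 := h.realizes'.pair (a := a) (u := fun _ ↦ u') (fun z ↦ huu' _ z.2.2)
    ⟨((0 : ℝ), y), mem_univ _, hy⟩
  rw [h.change.pair_eq h.isCoordinate] at e1
  exact e1.symm.trans e2

end Transition
end Transition

/-! ### Metric coefficients in the charts of the manifold. -/

section MetricCoeff

variable {n : ℕ} {M : Type*} [TopologicalSpace M] [ChartedSpace (EuclideanSpace ℝ (Fin n)) M]

/-- The change of coordinates from the chart around `q` to the chart around `q'`. -/
def coordChange (q q' : M) : EuclideanSpace ℝ (Fin n) → EuclideanSpace ℝ (Fin n) :=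
  extChartAt (𝓡 n) q' ∘ (extChartAt (𝓡 n) q).symm

/-- The overlap of two charts, in the coordinates of the first. -/
def overlap (q q' : M) : Set (EuclideanSpace ℝ (Fin n)) :=
  (extChartAt (𝓡 n) q).target ∩ (extChartAt (𝓡 n) q).symm ⁻¹' (extChartAt (𝓡 n) q').source

theorem isOpen_overlap (q q' : M) : IsOpen (overlap (n := n) q q') :=
  (continuousOn_extChartAt_symm q).isOpen_inter_preimage (isOpen_extChartAt_target q)
    (isOpen_extChartAt_source q')

theorem mapsTo_coordChange (q q' : M) :
    MapsTo (coordChange (n := n) q q') (overlap q q') (overlap q' q) := fun y hy ↦ by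
  refine ⟨(extChartAt (𝓡 n) q').map_source hy.2, ?_⟩
  change (extChartAt (𝓡 n) q').symm (extChartAt (𝓡 n) q' _) ∈ (extChartAt (𝓡 n) q).source
  rw [(extChartAt (𝓡 n) q').left_inv hy.2]
  exact (extChartAt (𝓡 n) q).map_target hy.1

theorem symm_coordChange {q q' : M} {y : EuclideanSpace ℝ (Fin n)} (hy : y ∈ overlap q q') :
    (extChartAt (𝓡 n) q').symm (coordChange q q' y) = (extChartAt (𝓡 n) q).symm y :=
  (extChartAt (𝓡 n) q').left_inv hy.2

theorem coordChange_coordChange {q q' : M} {y : EuclideanSpace ℝ (Fin n)}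
    (hy : y ∈ overlap q q') : coordChange q' q (coordChange q q' y) = y := by
  change extChartAt (𝓡 n) q ((extChartAt (𝓡 n) q').symm (coordChange q q' y)) = y
  rw [symm_coordChange hy, (extChartAt (𝓡 n) q).right_inv hy.1]

theorem mem_overlap_self {q : M} {y : EuclideanSpace ℝ (Fin n)}
    (hy : y ∈ (extChartAt (𝓡 n) q).target) : y ∈ overlap q ((extChartAt (𝓡 n) q).symm y) :=
  ⟨hy, mem_extChartAt_source _⟩

theorem inChart_coordChange (u : M → ℝ) {q q' : M} {y : EuclideanSpace ℝ (Fin n)}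
    (hy : y ∈ overlap q q') : inChart q u y = inChart q' u (coordChange q q' y) := by
  simp only [inChart, symm_coordChange hy]

/-- The derivative of the inverse chart, as a map between Euclidean spaces. -/
def symmDeriv (q : M) (y : EuclideanSpace ℝ (Fin n)) :
    EuclideanSpace ℝ (Fin n) →L[ℝ] EuclideanSpace ℝ (Fin n) :=
  mfderiv (𝓡 n) (𝓡 n) (extChartAt (𝓡 n) q).symm y

variable [IsManifold (𝓡 n) ∞ M]

theorem contDiffOn_coordChange (q q' : M) :
    ContDiffOn ℝ ∞ (coordChange (n := n) q q') (overlap q q') := by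
  have h1 : ContMDiffOn (𝓡 n) (𝓡 n) ∞ (coordChange (n := n) q q') (overlap q q') :=
    (contMDiffOn_extChartAt (I := 𝓡 n) (x := q')).comp
      ((contMDiffOn_extChartAt_symm q).mono inter_subset_left)
      fun y hy ↦ by simpa using hy.2
  exact h1.contDiffOn

theorem mdifferentiableAt_symm {q : M} {y : EuclideanSpace ℝ (Fin n)}
    (hy : y ∈ (extChartAt (𝓡 n) q).target) :
    MDifferentiableAt (𝓡 n) (𝓡 n) (extChartAt (𝓡 n) q).symm y :=
  ((contMDiffOn_extChartAt_symm (I := 𝓡 n) (n := ∞) q).contMDiffAt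
    ((isOpen_extChartAt_target q).mem_nhds hy)).mdifferentiableAt (by simp)

theorem symmDeriv_comp {q q' : M} {y : EuclideanSpace ℝ (Fin n)} (hy : y ∈ overlap q q')
    (v : EuclideanSpace ℝ (Fin n)) :
    symmDeriv q y v = symmDeriv q' (coordChange q q' y) (fderiv ℝ (coordChange q q') y v) := by
  have h1 : (extChartAt (𝓡 n) q).symm =ᶠ[nhds y]
      (extChartAt (𝓡 n) q').symm ∘ coordChange q q' := by
    filter_upwards [(isOpen_overlap q q').mem_nhds hy] with w hw
    exact (symm_coordChange hw).symm
  have hd : DifferentiableAt ℝ (coordChange (n := n) q q') y :=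
    ((contDiffOn_coordChange q q').contDiffAt
      ((isOpen_overlap q q').mem_nhds hy)).differentiableAt (by simp)
  have h2 := mfderiv_comp y (mdifferentiableAt_symm (mapsTo_coordChange q q' hy).1)
    hd.mdifferentiableAt
  rw [symmDeriv, h1.mfderiv_eq, h2, mfderiv_eq_fderiv]
  rfl

theorem injective_symmDeriv {q : M} {y : EuclideanSpace ℝ (Fin n)}
    (hy : y ∈ (extChartAt (𝓡 n) q).target) :
    Function.Injective (symmDeriv q y) := by
  have h1 : (extChartAt (𝓡 n) q) ∘ (extChartAt (𝓡 n) q).symm =ᶠ[nhds y] id := by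
    filter_upwards [(isOpen_extChartAt_target q).mem_nhds hy] with w hw
    exact (extChartAt (𝓡 n) q).right_inv hw
  have h3 : MDifferentiableAt (𝓡 n) (𝓡 n) (extChartAt (𝓡 n) q) ((extChartAt (𝓡 n) q).symm y) :=
    mdifferentiableAt_extChartAt (by simpa using (extChartAt (𝓡 n) q).map_target hy)
  have h2 := mfderiv_comp y h3 (mdifferentiableAt_symm hy)
  rw [h1.mfderiv_eq, mfderiv_id] at h2
  intro v w hvw
  have hv : v = mfderiv (𝓡 n) (𝓡 n) (extChartAt (𝓡 n) q) ((extChartAt (𝓡 n) q).symm y)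
    (symmDeriv q y v) := congrArg (fun L ↦ L v) h2
  have hw : w = mfderiv (𝓡 n) (𝓡 n) (extChartAt (𝓡 n) q) ((extChartAt (𝓡 n) q).symm y)
    (symmDeriv q y w) := congrArg (fun L ↦ L w) h2
  rw [hv, hvw]
  exact hw.symm

/-- The metric at a point, as a bilinear form on Euclidean space. -/
def metricAt (g : Metric n M) (p : M) :
    EuclideanSpace ℝ (Fin n) →L[ℝ] EuclideanSpace ℝ (Fin n) →L[ℝ] ℝ :=
  g.inner p

theorem metricAt_pos (g : Metric n M) (p : M) {v : EuclideanSpace ℝ (Fin n)} (hv : v ≠ 0) :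
    0 < metricAt g p v v :=
  g.pos p v hv

theorem metricCoeff_apply (g : Metric n M) (q : M) (y : EuclideanSpace ℝ (Fin n)) (i j : Fin n) :
    metricCoeff g q y i j = metricAt g ((extChartAt (𝓡 n) q).symm y)
      (symmDeriv q y (EuclideanSpace.single i 1)) (symmDeriv q y (EuclideanSpace.single j 1)) :=
  rfl

theorem metricCoeff_symm (g : Metric n M) (q : M) (y : EuclideanSpace ℝ (Fin n)) (i j : Fin n) :
    metricCoeff g q y i j = metricCoeff g q y j i :=
  g.symm _ _ _

theorem metricAt_symmDeriv (g : Metric n M) (q : M) (y v w : EuclideanSpace ℝ (Fin n)) :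
    metricAt g ((extChartAt (𝓡 n) q).symm y) (symmDeriv q y v) (symmDeriv q y w) =
      ∑ i, ∑ j, v i * w j * metricCoeff g q y i j := by
  conv_lhs => rw [euclidean_eq_sum v, euclidean_eq_sum w]
  simp only [map_sum, map_smul, sum_apply, smul_apply,
    smul_eq_mul, metricCoeff_apply]
  simp only [Finset.mul_sum]
  rw [Finset.sum_comm]
  exact Finset.sum_congr rfl fun i _ ↦ Finset.sum_congr rfl fun j _ ↦ by ring

theorem metricCoeff_posDef (g : Metric n M) {q : M} {y : EuclideanSpace ℝ (Fin n)}
    (hy : y ∈ (extChartAt (𝓡 n) q).target) : (metricCoeff g q y).PosDef := by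
  refine Matrix.PosDef.of_dotProduct_mulVec_pos ?_ fun v hv ↦ ?_
  · ext i j; exact metricCoeff_symm g q y j i
  · have hv' : symmDeriv q y (WithLp.toLp 2 v) ≠ 0 := fun h0 ↦ hv <| by
      have := injective_symmDeriv hy (h0.trans (map_zero _).symm)
      simpa using this
    have h := metricAt_pos g ((extChartAt (𝓡 n) q).symm y) hv'
    rw [metricAt_symmDeriv] at h
    refine h.trans_eq ?_
    simp only [dotProduct, Matrix.mulVec, Finset.mul_sum, star_trivial]
    exact Finset.sum_congr rfl fun i _ ↦ Finset.sum_congr rfl fun j _ ↦ by ring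

theorem metricCoeff_coordChange (g : Metric n M) {q q' : M} {y : EuclideanSpace ℝ (Fin n)}
    (hy : y ∈ overlap q q') (i j : Fin n) :
    metricCoeff g q y i j = ∑ a, ∑ b, pderiv i (fun z ↦ coordChange q q' z a) y *
      pderiv j (fun z ↦ coordChange q q' z b) y * metricCoeff g q' (coordChange q q' y) a b := by
  have hd : DifferentiableAt ℝ (coordChange (n := n) q q') y :=
    ((contDiffOn_coordChange q q').contDiffAt
      ((isOpen_overlap q q').mem_nhds hy)).differentiableAt (by simp)
  simp only [pderiv_component hd]
  rw [← metricAt_symmDeriv g q' (coordChange q q' y), metricCoeff_apply, symm_coordChange hy,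
    symmDeriv_comp hy, symmDeriv_comp hy]

/-- The coefficients of `g` are smooth in all charts. -/
def SmoothMetric (g : Metric n M) : Prop :=
  ∀ q : M, ∀ i j : Fin n, ContDiffOn ℝ ∞ (fun y ↦ metricCoeff g q y i j)
    (extChartAt (𝓡 n) q).target

theorem transition {g : Metric n M} (hg : SmoothMetric g) (q q' : M) :
    Transition (overlap q q') (overlap q' q) (coordChange q q') (coordChange q' q)
      (metricCoeff g q) (metricCoeff g q') where
  isOpen_source := isOpen_overlap q q'
  isOpen_target := isOpen_overlap q' q
  mapsTo := mapsTo_coordChange q q'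
  mapsTo' := mapsTo_coordChange q' q
  leftInv _ := coordChange_coordChange
  rightInv _ := coordChange_coordChange
  smooth := contDiffOn_coordChange q q'
  smooth' := contDiffOn_coordChange q' q
  coeff i j := (hg q i j).mono inter_subset_left
  coeff' i j := (hg q' i j).mono inter_subset_left
  symm y _ := metricCoeff_symm g q y
  symm' y _ := metricCoeff_symm g q' y
  det_ne_zero _ hy := (metricCoeff_posDef g hy.1).det_pos.ne'
  det_ne_zero' _ hy := (metricCoeff_posDef g hy.1).det_pos.ne'
  metric_eq _ := metricCoeff_coordChange g

theorem contDiffOn_inChart {u : M → ℝ} (hu : ContMDiff (𝓡 n) 𝓘(ℝ, ℝ) ∞ u) (q : M) :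
    ContDiffOn ℝ ∞ (inChart q u) (extChartAt (𝓡 n) q).target := by
  have : ContMDiffOn (𝓡 n) 𝓘(ℝ, ℝ) ∞ (inChart q u) (extChartAt (𝓡 n) q).target :=
    hu.comp_contMDiffOn (contMDiffOn_extChartAt_symm q)
  exact this.contDiffOn

section Invariance

variable {g : Metric n M} (hg : SmoothMetric g) {q : M} {y : EuclideanSpace ℝ (Fin n)}
  (hy : y ∈ (extChartAt (𝓡 n) q).target)
include hg hy

/-- The curvature at a point is defined by the chart around that point, which varies with the point.
This lemma and the next three allow one fixed chart to be used throughout its domain. -/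
theorem scalarCurvature_eq :
    scalarCurvature g ((extChartAt (𝓡 n) q).symm y) = scalar (metricCoeff g q) y :=
  ((transition hg q _).scalar_eq (mem_overlap_self hy)).symm

variable {u : M → ℝ} (hu : ContDiffOn ℝ ∞ (inChart q u) (extChartAt (𝓡 n) q).target)
include hu

theorem gradNormSq_eq :
    gradNormSq g u ((extChartAt (𝓡 n) q).symm y) = gradSq (metricCoeff g q) (inChart q u) y :=
  ((transition hg q _).gradSq_eq (hu.mono inter_subset_left)
    (fun _ h ↦ inChart_coordChange u h) (mem_overlap_self hy)).symm

theorem laplaceBeltrami_eq :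
    laplaceBeltrami g u ((extChartAt (𝓡 n) q).symm y) =
      laplacian (metricCoeff g q) (inChart q u) y :=
  ((transition hg q _).laplacian_eq (hu.mono inter_subset_left)
    (fun _ h ↦ inChart_coordChange u h) (mem_overlap_self hy)).symm

theorem ricciHessNormSq_eq :
    ricciHessNormSq g u ((extChartAt (𝓡 n) q).symm y) =
      ricciHessSq (metricCoeff g q) (inChart q u) y :=
  ((transition hg q _).ricciHessSq_eq (hu.mono inter_subset_left)
    (fun _ h ↦ inChart_coordChange u h) (mem_overlap_self hy)).symm

end Invariance

end MetricCoeff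

/-! ### The Riemannian volume measure. -/

section Volume

theorem _root_.ContinuousOn.measurableSet_inter_preimage {X Y : Type*} [TopologicalSpace X]
    [MeasurableSpace X] [OpensMeasurableSpace X] [TopologicalSpace Y] [MeasurableSpace Y]
    [BorelSpace Y] {f : X → Y} {s : Set X} (hf : ContinuousOn f s) (hs : MeasurableSet s)
    {B : Set Y} (hB : MeasurableSet B) : MeasurableSet (s ∩ f ⁻¹' B) := by
  have h := hs.subtype_image ((continuousOn_iff_continuous_domRestrict.1 hf).measurable hB)
  convert h using 1
  ext x
  simp [and_comm]

variable {n : ℕ} {M : Type*} [TopologicalSpace M] [ChartedSpace (EuclideanSpace ℝ (Fin n)) M]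

theorem measurableSet_preimage [MeasurableSpace M] [BorelSpace M] (q : M) {B : Set M} (hB : MeasurableSet B) :
    MeasurableSet ((extChartAt (𝓡 n) q).target ∩ (extChartAt (𝓡 n) q).symm ⁻¹' B) :=
  (continuousOn_extChartAt_symm q).measurableSet_inter_preimage
    (isOpen_extChartAt_target q).measurableSet hB

variable [IsManifold (𝓡 n) ∞ M]

/-- The volume density `√(det g_ij)` in a chart. -/
def density (g : Metric n M) (q : M) (y : EuclideanSpace ℝ (Fin n)) : ℝ :=
  Real.sqrt (metricCoeff g q y).det

theorem density_pos (g : Metric n M) {q : M} {y : EuclideanSpace ℝ (Fin n)}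
    (hy : y ∈ (extChartAt (𝓡 n) q).target) : 0 < density g q y :=
  Real.sqrt_pos.2 (metricCoeff_posDef g hy).det_pos

theorem contDiffOn_det {F : Type*} [NormedAddCommGroup F] [NormedSpace ℝ F] {s : Set F}
    {G : F → Matrix (Fin n) (Fin n) ℝ} (hG : ∀ i j, ContDiffOn ℝ ∞ (fun z ↦ G z i j) s) :
    ContDiffOn ℝ ∞ (fun z ↦ (G z).det) s := by
  simp only [Matrix.det_apply']
  exact ContDiffOn.sum fun σ _ ↦ contDiffOn_const.mul (contDiffOn_prod fun i _ ↦ hG _ _)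

theorem continuousOn_density {g : Metric n M} (hg : SmoothMetric g) (q : M) :
    ContinuousOn (density g q) (extChartAt (𝓡 n) q).target :=
  Real.continuous_sqrt.comp_continuousOn (contDiffOn_det (hg q)).continuousOn

theorem density_coordChange (g : Metric n M) {q q' : M} {y : EuclideanSpace ℝ (Fin n)}
    (hy : y ∈ overlap q q') : density g q y =
      |(fderiv ℝ (coordChange q q') y).det| * density g q' (coordChange q q' y) := by
  have hd : DifferentiableAt ℝ (coordChange (n := n) q q') y :=
    ((contDiffOn_coordChange q q').contDiffAt
      ((isOpen_overlap q q').mem_nhds hy)).differentiableAt (by simp)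
  let K : Matrix (Fin n) (Fin n) ℝ :=
    Matrix.of fun a i ↦ fderiv ℝ (coordChange q q') y (EuclideanSpace.single i 1) a
  have hK : (fderiv ℝ (coordChange (n := n) q q') y).det = K.det := by
    rw [ContinuousLinearMap.det, ← LinearMap.det_toMatrix (EuclideanSpace.basisFun (Fin n) ℝ).toBasis]
    congr 1
  have h : metricCoeff g q y = K.transpose * metricCoeff g q' (coordChange q q' y) * K := by
    ext i j
    rw [metricCoeff_coordChange g hy]
    simp only [Matrix.mul_apply, Matrix.transpose_apply, K, Matrix.of_apply, pderiv_component hd,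
      Finset.sum_mul]
    rw [Finset.sum_comm]
    exact Finset.sum_congr rfl fun a _ ↦ Finset.sum_congr rfl fun b _ ↦ by ring
  rw [density, density, hK, h, Matrix.det_mul, Matrix.det_mul, Matrix.det_transpose,
    mul_right_comm, ← sq, Real.sqrt_mul (sq_nonneg _), Real.sqrt_sq_eq_abs]

variable [MeasurableSpace M] [BorelSpace M]

theorem aemeasurable_symm (g : Metric n M) (q : M) :
    AEMeasurable (extChartAt (𝓡 n) q).symm
      ((volume.restrict (extChartAt (𝓡 n) q).target).withDensity
        fun y ↦ ENNReal.ofReal (density g q y)) :=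
  ((continuousOn_extChartAt_symm q).aemeasurable
    (isOpen_extChartAt_target q).measurableSet).mono_ac (withDensity_absolutelyContinuous _ _)

theorem chartVolume_apply (g : Metric n M) (q : M) {B : Set M} (hB : MeasurableSet B) :
    chartVolume g q B = ∫⁻ y in (extChartAt (𝓡 n) q).target ∩ (extChartAt (𝓡 n) q).symm ⁻¹' B,
      ENNReal.ofReal (density g q y) := by
  have h := Measure.map_apply_of_aemeasurable (aemeasurable_symm g q) hB
  rw [withDensity_apply', Measure.restrict_restrict' (isOpen_extChartAt_target q).measurableSet,
    inter_comm] at h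
  exact h

/-- Change of variables along the transition map; `density_coordChange` supplies precisely its
Jacobian determinant. -/
theorem chartVolume_congr (g : Metric n M) (q q' : M) {B : Set M} (hB : MeasurableSet B)
    (h : B ⊆ (extChartAt (𝓡 n) q).source) (h' : B ⊆ (extChartAt (𝓡 n) q').source) :
    chartVolume g q B = chartVolume g q' B := by
  set A := (extChartAt (𝓡 n) q).target ∩ (extChartAt (𝓡 n) q).symm ⁻¹' B with hA
  have hAo : A ⊆ overlap q q' := fun y hy ↦ ⟨hy.1, h' hy.2⟩
  have himage : (extChartAt (𝓡 n) q').target ∩ (extChartAt (𝓡 n) q').symm ⁻¹' B =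
      coordChange q q' '' A := by
    ext z
    constructor
    · intro hz
      have hz' : z ∈ overlap q' q := ⟨hz.1, h hz.2⟩
      refine ⟨coordChange q' q z, ⟨(mapsTo_coordChange q' q hz').1, ?_⟩,
        coordChange_coordChange hz'⟩
      rw [mem_preimage, symm_coordChange hz']
      exact hz.2
    · rintro ⟨y, hy, rfl⟩
      refine ⟨(mapsTo_coordChange q q' (hAo hy)).1, ?_⟩
      rw [mem_preimage, symm_coordChange (hAo hy)]
      exact hy.2
  have hinj : InjOn (coordChange (n := n) q q') A := fun y hy z hz hyz ↦ by
    rw [← coordChange_coordChange (hAo hy), hyz, coordChange_coordChange (hAo hz)]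
  have hmeas : MeasurableSet A := measurableSet_preimage q hB
  rw [chartVolume_apply g q hB, chartVolume_apply g q' hB, himage,
    lintegral_image_eq_lintegral_abs_det_fderiv_mul volume hmeas
      (f' := fderiv ℝ (coordChange q q')) (fun y hy ↦ ?_) hinj]
  · refine setLIntegral_congr_fun hmeas fun y hy ↦ ?_
    rw [density_coordChange g (hAo hy), ENNReal.ofReal_mul (abs_nonneg _)]
  · exact (((contDiffOn_coordChange q q').contDiffAt
      ((isOpen_overlap q q').mem_nhds (hAo hy))).differentiableAt
        (by simp)).hasFDerivAt.hasFDerivWithinAt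

theorem chartVolume_inter_source (g : Metric n M) (q : M) {B : Set M} (hB : MeasurableSet B) :
    chartVolume g q (B ∩ (extChartAt (𝓡 n) q).source) = chartVolume g q B := by
  rw [chartVolume_apply g q hB,
    chartVolume_apply g q (hB.inter (isOpen_extChartAt_source q).measurableSet)]
  congr 2
  ext y
  exact ⟨fun hy ↦ ⟨hy.1, hy.2.1⟩, fun hy ↦ ⟨hy.1, hy.2, (extChartAt (𝓡 n) q).map_target hy.1⟩⟩

/-- Chart measures agree on overlaps, so on the domain of a chart no other chart can enlarge the
supremum. -/
theorem riemannianVolume_restrict (g : Metric n M) (q : M) :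
    (riemannianVolume g).restrict (extChartAt (𝓡 n) q).source = chartVolume g q := by
  have hs : ∀ q : M, MeasurableSet (extChartAt (𝓡 n) q).source := fun q ↦
    (isOpen_extChartAt_source q).measurableSet
  apply le_antisymm
  -- A supremum of measures is not the supremum set by set. It is bounded instead by one measure
  -- that dominates every chart measure and is `chartVolume g q` on the chart domain.
  · have h : riemannianVolume g ≤ (chartVolume g q).restrict (extChartAt (𝓡 n) q).source
        + (riemannianVolume g).restrict (extChartAt (𝓡 n) q).sourceᶜ := by
      refine iSup_le fun q' ↦ ?_
      rw [← Measure.restrict_add_restrict_compl (μ := chartVolume g q') (hs q)]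
      refine add_le_add ?_ (Measure.restrict_mono le_rfl (le_iSup (chartVolume g) q'))
      refine Measure.le_iff.2 fun B hB ↦ ?_
      rw [Measure.restrict_apply hB, Measure.restrict_apply hB,
        ← chartVolume_inter_source g q' (hB.inter (hs q)),
        chartVolume_congr g q' q ((hB.inter (hs q)).inter (hs q')) inter_subset_right
          (inter_subset_left.trans inter_subset_right)]
      exact measure_mono inter_subset_left
    refine Measure.le_iff.2 fun B hB ↦ ?_
    rw [Measure.restrict_apply hB]
    refine (h _).trans ?_
    rw [Measure.add_apply, Measure.restrict_apply (hB.inter (hs q)),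
      Measure.restrict_apply (hB.inter (hs q)), inter_assoc, inter_assoc, inter_self,
      inter_compl_self, inter_empty, measure_empty, add_zero]
    exact measure_mono inter_subset_left
  · refine Measure.le_iff.2 fun B hB ↦ ?_
    rw [Measure.restrict_apply hB, ← chartVolume_inter_source g q hB]
    exact le_iSup (chartVolume g) q _

theorem integral_riemannianVolume {g : Metric n M} (hg : SmoothMetric g) (q : M) {h : M → ℝ}
    (hh : Continuous h) (hs : ∀ p, p ∉ (extChartAt (𝓡 n) q).source → h p = 0) :
    ∫ p, h p ∂(riemannianVolume g) =
      ∫ y in (extChartAt (𝓡 n) q).target, density g q y * inChart q h y := by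
  rw [← setIntegral_eq_integral_of_forall_compl_eq_zero hs, riemannianVolume_restrict]
  have h1 := integral_map (aemeasurable_symm g q) (f := h) hh.aestronglyMeasurable
  refine h1.trans ?_
  have hd : AEMeasurable (fun y ↦ ENNReal.ofReal (density g q y))
      (volume.restrict (extChartAt (𝓡 n) q).target) :=
    ((continuousOn_density hg q).aemeasurable
      (isOpen_extChartAt_target q).measurableSet).ennreal_ofReal
  rw [integral_withDensity_eq_integral_toReal_smul₀ hd (by simp)]
  refine integral_congr_ae (Filter.Eventually.of_forall fun y ↦ ?_)
  simp [inChart, ENNReal.toReal_ofReal (Real.sqrt_nonneg _), density]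

theorem riemannianVolume_pos {g : Metric n M} (hg : SmoothMetric g) :
    (riemannianVolume g).IsOpenPosMeasure where
  open_pos O hO hne := by
    obtain ⟨p, hp⟩ := hne
    intro h0
    have h1 : chartVolume g p O = 0 :=
      le_antisymm ((le_iSup (chartVolume g) p O).trans h0.le) zero_le
    rw [chartVolume_apply g p hO.measurableSet] at h1
    have hA : IsOpen ((extChartAt (𝓡 n) p).target ∩ (extChartAt (𝓡 n) p).symm ⁻¹' O) :=
      (continuousOn_extChartAt_symm p).isOpen_inter_preimage (isOpen_extChartAt_target p) hO
    have hd : AEMeasurable (fun y ↦ ENNReal.ofReal (density g p y)) (volume.restrict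
        ((extChartAt (𝓡 n) p).target ∩ (extChartAt (𝓡 n) p).symm ⁻¹' O)) :=
      (((continuousOn_density hg p).mono inter_subset_left).aemeasurable
        hA.measurableSet).ennreal_ofReal
    rw [lintegral_eq_zero_iff' hd, Filter.EventuallyEq, ae_restrict_iff' hA.measurableSet] at h1
    have h2 : volume ((extChartAt (𝓡 n) p).target ∩ (extChartAt (𝓡 n) p).symm ⁻¹' O) = 0 := by
      refine measure_mono_null (fun y hy ↦ ?_) (ae_iff.1 h1)
      simp only [Pi.zero_apply, ENNReal.ofReal_eq_zero, not_forall, not_le, mem_ofPred_eq]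
      exact ⟨hy, density_pos g hy.1⟩
    refine (hA.measure_pos volume ⟨extChartAt (𝓡 n) p p, mem_extChartAt_target p, ?_⟩).ne' h2
    simpa using hp

/-- Local finiteness suffices by compactness: near p the density is integrable on a small closed
ball in the chart. -/
theorem riemannianVolume_finite [CompactSpace M] {g : Metric n M} (hg : SmoothMetric g) :
    IsFiniteMeasure (riemannianVolume g) where
  measure_univ_lt_top := by
    refine isCompact_univ.measure_lt_top_of_nhdsWithin fun p _ ↦ ?_
    rw [nhdsWithin_univ]
    obtain ⟨r, hr, hball⟩ := Metric.nhds_basis_closedBall.mem_iff.1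
      ((isOpen_extChartAt_target (I := 𝓡 n) p).mem_nhds (mem_extChartAt_target p))
    have hO : IsOpen ((extChartAt (𝓡 n) p).source ∩
        extChartAt (𝓡 n) p ⁻¹' Metric.ball (extChartAt (𝓡 n) p p) r) :=
      (continuousOn_extChartAt p).isOpen_inter_preimage (isOpen_extChartAt_source p)
        Metric.isOpen_ball
    refine ⟨_, hO.mem_nhds ⟨mem_extChartAt_source p, Metric.mem_ball_self hr⟩, ?_⟩
    have h1 := congrArg (fun μ ↦ μ ((extChartAt (𝓡 n) p).source ∩
      extChartAt (𝓡 n) p ⁻¹' Metric.ball (extChartAt (𝓡 n) p p) r)) (riemannianVolume_restrict g p)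
    simp only [Measure.restrict_apply hO.measurableSet] at h1
    rw [inter_right_comm, inter_self] at h1
    rw [h1, chartVolume_apply g p hO.measurableSet]
    have h2 : IntegrableOn (density g p) (Metric.closedBall (extChartAt (𝓡 n) p p) r) :=
      ((continuousOn_density hg p).mono hball).integrableOn_compact (isCompact_closedBall _ _)
    refine (lintegral_mono_set fun y hy ↦ ?_).trans_lt h2.lintegral_lt_top
    have := hy.2.2
    rw [mem_preimage, (extChartAt (𝓡 n) p).right_inv hy.1] at this
    exact Metric.ball_subset_closedBall this

end Volume

/-! ### Derivatives of the volume density. -/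

section Density

variable {n : ℕ} {A : Type*} [CommRing A] [Algebra ℝ A]

theorem derivation_prod {ι : Type*} [DecidableEq ι] (d : Derivation ℝ A A) (s : Finset ι)
    (a : ι → A) : d (∏ i ∈ s, a i) = ∑ i ∈ s, (∏ j ∈ s.erase i, a j) * d (a i) := by
  induction s using Finset.induction_on with
  | empty => simp
  | insert k s hk ih =>
    rw [Finset.prod_insert hk, Derivation.leibniz, ih, Finset.sum_insert hk,
      Finset.erase_insert hk, smul_eq_mul, smul_eq_mul, Finset.mul_sum, add_comm]
    congr 1
    refine Finset.sum_congr rfl fun i hi ↦ ?_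
    have hik : k ≠ i := fun h ↦ hk (h ▸ hi)
    rw [Finset.erase_insert_of_ne hik, Finset.prod_insert (by simp [hk]), mul_assoc]

/-- Jacobi's formula. -/
theorem derivation_det (d : Derivation ℝ A A) (M : Matrix (Fin n) (Fin n) A) :
    d M.det = (M.adjugate * M.map d).trace := by
  have h : ∀ i, (M.adjugate * M.map d) i i = (M.updateCol i fun j ↦ d (M j i)).det := fun i ↦ by
    rw [← Matrix.cramer_apply, Matrix.cramer_eq_adjugate_mulVec]
    rfl
  simp only [Matrix.trace, Matrix.diag, h, Matrix.det_apply]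
  rw [map_sum, Finset.sum_comm]
  refine Finset.sum_congr rfl fun σ _ ↦ ?_
  rw [Units.smul_def, map_zsmul, derivation_prod, Finset.smul_sum]
  refine Finset.sum_congr rfl fun i _ ↦ ?_
  rw [Units.smul_def, ← Finset.prod_erase_mul _ _ (Finset.mem_univ i)]
  congr 2
  · exact Finset.prod_congr rfl fun j hj ↦ by
      rw [Matrix.updateCol_ne (Finset.ne_of_mem_erase hj)]
  · rw [Matrix.updateCol_self]

namespace FrameGeometry

variable (S : FrameGeometry n A) {w : A} (hw : w * w = S.G.det) (hu : IsUnit w)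
include hw hu

/-- Here w stands for √det g. Being a unit, it can be cancelled after Jacobi's formula is applied to
w² = det g. -/
theorem two_mul_derivation_sqrt_det (d : Derivation ℝ A A) :
    2 * d w = w * (S.H * S.G.map d).trace := by
  have h : S.G.adjugate = S.G.det • S.H := by
    calc S.G.adjugate = S.G.adjugate * (S.G * S.H) := by rw [S.mul_inv, mul_one]
      _ = _ := by rw [← mul_assoc, Matrix.adjugate_mul, Matrix.smul_mul, one_mul]
  have h1 := derivation_det d S.G
  rw [h, Matrix.smul_mul, Matrix.trace_smul, ← hw, Derivation.leibniz] at h1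
  refine hu.mul_left_cancel ?_
  simp only [smul_eq_mul] at h1
  linear_combination h1

theorem D_sqrt_det (k : Fin n) : S.D k w = w * S.trΓ k := by
  apply two_mul_cancel
  rw [S.two_mul_derivation_sqrt_det hw hu, ← S.two_mul_trΓ]
  ring

/-- The weighted Laplacian is a coordinate divergence, since `trΓ` is the logarithmic derivative of
w. This is the algebra behind the divergence theorem. -/
theorem sqrt_det_mul_lap (u : A) : w * S.lap u = ∑ k, S.D k (w * S.gradVec u k) := by
  simp only [Derivation.leibniz, S.D_sqrt_det hw hu, smul_eq_mul, lap_eq_div, mul_add,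
    Finset.mul_sum, Finset.sum_add_distrib]
  congr 1
  exact Finset.sum_congr rfl fun _ _ ↦ by ring

theorem dt_sqrt_det {dt : Derivation ℝ A A} (h : S.Evolves dt) : dt w = -(S.Scal * w) := by
  apply two_mul_cancel
  rw [S.two_mul_derivation_sqrt_det hw hu, h.trace_H_map_G]
  ring

end FrameGeometry
end Density

/-! ### Smooth families of functions and metrics on the manifold. -/

section Family

variable {n : ℕ} {M : Type*} [TopologicalSpace M] [ChartedSpace (EuclideanSpace ℝ (Fin n)) M]

/-- The time-dependent function `Φ` on `M` is smooth in all charts, jointly in time and space. -/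
def ChartSmooth (n : ℕ) {M : Type*} [TopologicalSpace M]
    [ChartedSpace (EuclideanSpace ℝ (Fin n)) M] (J : Set ℝ) (Φ : ℝ → M → ℝ) : Prop :=
  ∀ q : M, ContDiffOn ℝ ∞ (fun z : ℝ × EuclideanSpace ℝ (Fin n) ↦ inChart q (Φ z.1) z.2)
    (J ×ˢ (extChartAt (𝓡 n) q).target)

namespace ChartSmooth

variable {J : Set ℝ} {Φ Ψ : ℝ → M → ℝ}

/-- The element of the ring of smooth functions of a chart. -/
def elt (hΦ : ChartSmooth n J Φ) (q : M) : smoothRing (J ×ˢ (extChartAt (𝓡 n) q).target) :=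
  smoothMk _ (hΦ q)

theorem elt_apply (hΦ : ChartSmooth n J Φ) (q : M)
    (z : (J ×ˢ (extChartAt (𝓡 n) q).target : Set (ℝ × EuclideanSpace ℝ (Fin n)))) :
    (hΦ.elt q).1 z = inChart q (Φ z.1.1) z.1.2 := rfl

theorem of_smoothRing (h : ∀ q : M, ∃ a : smoothRing (J ×ˢ (extChartAt (𝓡 n) q).target),
    ∀ z, a.1 z = inChart q (Φ z.1.1) z.1.2) : ChartSmooth n J Φ := fun q ↦ by
  obtain ⟨a, ha⟩ := h q
  exact (contDiffOn_smoothExt a).congr fun z hz ↦ by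
    rw [smoothExt_eq a hz]; exact (ha ⟨z, hz⟩).symm

theorem add (hΦ : ChartSmooth n J Φ) (hΨ : ChartSmooth n J Ψ) :
    ChartSmooth n J fun t p ↦ Φ t p + Ψ t p := fun q ↦ (hΦ q).add (hΨ q)

theorem sub (hΦ : ChartSmooth n J Φ) (hΨ : ChartSmooth n J Ψ) :
    ChartSmooth n J fun t p ↦ Φ t p - Ψ t p := fun q ↦ (hΦ q).sub (hΨ q)

theorem mul (hΦ : ChartSmooth n J Φ) (hΨ : ChartSmooth n J Ψ) :
    ChartSmooth n J fun t p ↦ Φ t p * Ψ t p := fun q ↦ (hΦ q).mul (hΨ q)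

theorem exp_neg (hΦ : ChartSmooth n J Φ) :
    ChartSmooth n J fun t p ↦ Real.exp (-Φ t p) := fun q ↦ (hΦ q).neg.exp

theorem const_mul (c : ℝ) (hΦ : ChartSmooth n J Φ) :
    ChartSmooth n J fun t p ↦ c * Φ t p := fun q ↦ contDiffOn_const.mul (hΦ q)

theorem slice (hΦ : ChartSmooth n J Φ) {t : ℝ} (ht : t ∈ J) (q : M) :
    ContDiffOn ℝ ∞ (inChart q (Φ t)) (extChartAt (𝓡 n) q).target :=
  (hΦ q).comp (contDiffOn_const.prodMk contDiffOn_id) fun _ hy ↦ ⟨ht, hy⟩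

theorem const (hΦ : ChartSmooth n J Φ) {t : ℝ} (ht : t ∈ J) (I : Set ℝ) :
    ChartSmooth n I fun _ ↦ Φ t := fun q ↦
  (hΦ.slice ht q).comp contDiffOn_snd fun _ hz ↦ hz.2

theorem continuous (hΦ : ChartSmooth n J Φ) {t : ℝ} (ht : t ∈ J) : Continuous (Φ t) := by
  refine continuous_iff_continuousAt.2 fun p ↦ ?_
  have h1 : ContinuousAt (inChart p (Φ t) ∘ extChartAt (𝓡 n) p) p :=
    ((hΦ.slice ht p).continuousOn.continuousAt ((isOpen_extChartAt_target p).mem_nhds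
      (mem_extChartAt_target p))).comp (continuousAt_extChartAt p)
  refine h1.congr ?_
  filter_upwards [extChartAt_source_mem_nhds (I := 𝓡 n) p] with p' hp'
  simp only [Function.comp_apply, inChart, (extChartAt (𝓡 n) p).left_inv hp']

end ChartSmooth

theorem chartSmooth_of_contMDiff [IsManifold (𝓡 n) ∞ M] {u : M → ℝ}
    (hu : ContMDiff (𝓡 n) 𝓘(ℝ, ℝ) ∞ u) (I : Set ℝ) : ChartSmooth n I fun _ ↦ u := fun q ↦
  (contDiffOn_inChart hu q).comp contDiffOn_snd fun _ hz ↦ hz.2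

theorem chartSmooth_of_contMDiffOn [IsManifold (𝓡 n) ∞ M] {J : Set ℝ} {f : ℝ → M → ℝ}
    (hf : ContMDiffOn (𝓘(ℝ, ℝ).prod (𝓡 n)) 𝓘(ℝ, ℝ) ∞ (fun z : ℝ × M ↦ f z.1 z.2)
      (J ×ˢ univ)) : ChartSmooth n J f := fun q ↦ by
  have h1 : ContMDiffOn 𝓘(ℝ, ℝ × EuclideanSpace ℝ (Fin n)) (𝓘(ℝ, ℝ).prod (𝓡 n)) ∞
      (fun z : ℝ × EuclideanSpace ℝ (Fin n) ↦ (z.1, (extChartAt (𝓡 n) q).symm z.2))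
      (J ×ˢ (extChartAt (𝓡 n) q).target) :=
    (contDiff_fst.contMDiff.contMDiffOn).prodMk
      ((contMDiffOn_extChartAt_symm q).comp contDiff_snd.contMDiff.contMDiffOn fun _ hz ↦ hz.2)
  exact (hf.comp h1 fun z hz ↦ ⟨hz.1, mem_univ _⟩).contDiffOn

theorem contMDiff_slice [IsManifold (𝓡 n) ∞ M] {J : Set ℝ} {f : ℝ → M → ℝ}
    (hf : ContMDiffOn (𝓘(ℝ, ℝ).prod (𝓡 n)) 𝓘(ℝ, ℝ) ∞ (fun z : ℝ × M ↦ f z.1 z.2)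
      (J ×ˢ univ)) {t : ℝ} (ht : t ∈ J) : ContMDiff (𝓡 n) 𝓘(ℝ, ℝ) ∞ (f t) := by
  rw [← contMDiffOn_univ]
  exact hf.comp (contMDiff_const.prodMk contMDiff_id).contMDiffOn fun p _ ↦ ⟨ht, mem_univ _⟩

variable [IsManifold (𝓡 n) ∞ M] {J : Set ℝ} {g : ℝ → Metric n M}

theorem IsSmoothFamily.smoothMetric (hg : IsSmoothFamily J g) {t : ℝ} (ht : t ∈ J) :
    SmoothMetric (g t) := fun q i j ↦
  (hg q i j).comp (contDiffOn_const.prodMk contDiffOn_id) fun _ hy ↦ ⟨ht, hy⟩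

theorem SmoothMetric.isSmoothFamily {g : Metric n M} (hg : SmoothMetric g) (I : Set ℝ) :
    IsSmoothFamily I fun _ ↦ g := fun q i j ↦
  (hg q i j).comp contDiffOn_snd fun _ hz ↦ hz.2

theorem IsSmoothFamily.coeff (hg : IsSmoothFamily J g) (q : M) :
    SmoothCoeff J (extChartAt (𝓡 n) q).target fun t ↦ metricCoeff (g t) q where
  smooth := hg q
  symm t _ y _ := metricCoeff_symm (g t) q y
  det_ne_zero t _ _ hy := (metricCoeff_posDef (g t) hy).det_pos.ne'

/-- A smooth family of metrics over a nondegenerate interval. -/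
structure SmoothFamily (J : Set ℝ) (g : ℝ → Metric n M) : Prop where
  ordConnected : J.OrdConnected
  nontrivial : J.Nontrivial
  smooth : IsSmoothFamily J g

theorem SmoothMetric.smoothFamily {g : Metric n M} (hg : SmoothMetric g) :
    SmoothFamily univ fun _ ↦ g :=
  ⟨ordConnected_univ, nontrivial_univ, hg.isSmoothFamily univ⟩

namespace SmoothFamily

variable (hg : SmoothFamily J g) (q : M)
include hg

theorem uniqueDiffOn : UniqueDiffOn ℝ (J ×ˢ (extChartAt (𝓡 n) q).target) :=
  uniqueDiffOn_cylinder hg.ordConnected hg.nontrivial (isOpen_extChartAt_target q)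

/-- The coordinate frame of a chart. -/
def frame : FrameGeometry n (smoothRing (J ×ˢ (extChartAt (𝓡 n) q).target)) :=
  chartFrame (hg.uniqueDiffOn q) (hg.smooth.coeff q)

/-- The time derivative in a chart. -/
def dt : Derivation ℝ (smoothRing (J ×ˢ (extChartAt (𝓡 n) q).target))
    (smoothRing (J ×ˢ (extChartAt (𝓡 n) q).target)) :=
  dirDeriv (hg.uniqueDiffOn q) (1, 0)

theorem realizes : (hg.frame q).Realizes (fun z ↦ z.1.1) (fun z ↦ z.1.2)
    fun t ↦ metricCoeff (g t) q :=
  chartFrame_realizes _ (isOpen_extChartAt_target q) _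

theorem isCoordinate : (hg.frame q).IsCoordinate := fun _ _ a ↦
  dirDeriv_comm (hg.uniqueDiffOn q) (cylinder_subset_closure hg.ordConnected hg.nontrivial
    (isOpen_extChartAt_target q)) _ _ a

theorem dt_comm (i : Fin n) (a : smoothRing (J ×ˢ (extChartAt (𝓡 n) q).target)) :
    hg.dt q ((hg.frame q).D i a) = (hg.frame q).D i (hg.dt q a) :=
  dirDeriv_comm (hg.uniqueDiffOn q) (cylinder_subset_closure hg.ordConnected hg.nontrivial
    (isOpen_extChartAt_target q)) _ _ a

theorem hasDerivWithinAt {ψ : ℝ → EuclideanSpace ℝ (Fin n) → ℝ}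
    (a : smoothRing (J ×ˢ (extChartAt (𝓡 n) q).target)) (ha : ∀ z, a.1 z = ψ z.1.1 z.1.2)
    (z : (J ×ˢ (extChartAt (𝓡 n) q).target : Set (ℝ × EuclideanSpace ℝ (Fin n)))) :
    HasDerivWithinAt (fun t ↦ ψ t z.1.2) ((hg.dt q a).1 z) J z.1.1 :=
  hasDerivWithinAt_slice (hg.uniqueDiffOn q) a ha z

/-- Derivatives within a nondegenerate interval are unique, so a time derivative given by a flow
equation determines the abstract derivation `dt`. -/
theorem dt_apply_eq {ψ : ℝ → EuclideanSpace ℝ (Fin n) → ℝ}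
    {a : smoothRing (J ×ˢ (extChartAt (𝓡 n) q).target)} (ha : ∀ z, a.1 z = ψ z.1.1 z.1.2)
    {z : (J ×ˢ (extChartAt (𝓡 n) q).target : Set (ℝ × EuclideanSpace ℝ (Fin n)))} {d : ℝ}
    (h : HasDerivWithinAt (fun t ↦ ψ t z.1.2) d J z.1.1) : (hg.dt q a).1 z = d :=
  (uniqueDiffOn_of_nontrivial hg.ordConnected hg.nontrivial _ z.2.1).eq_deriv _
    (hg.hasDerivWithinAt q a ha z) h

theorem scal_apply (z : (J ×ˢ (extChartAt (𝓡 n) q).target : Set (ℝ × EuclideanSpace ℝ (Fin n)))) :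
    (hg.frame q).Scal.1 z = inChart q (scalarCurvature (g z.1.1)) z.1.2 :=
  ((hg.realizes q).Scal z).trans (scalarCurvature_eq (hg.smooth.smoothMetric z.2.1) z.2.2).symm

theorem chartSmooth_scalarCurvature : ChartSmooth n J fun t ↦ scalarCurvature (g t) :=
  .of_smoothRing fun q ↦ ⟨_, hg.scal_apply q⟩

variable {Φ Ψ : ℝ → M → ℝ} (hΦ : ChartSmooth n J Φ)
include hΦ

theorem lap_apply (z : (J ×ˢ (extChartAt (𝓡 n) q).target : Set (ℝ × EuclideanSpace ℝ (Fin n)))) :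
    ((hg.frame q).lap (hΦ.elt q)).1 z = inChart q (laplaceBeltrami (g z.1.1) (Φ z.1.1)) z.1.2 :=
  ((hg.realizes q).lap (u := fun t ↦ inChart q (Φ t)) (hΦ.elt_apply q) z).trans
    (laplaceBeltrami_eq (hg.smooth.smoothMetric z.2.1) z.2.2 (hΦ.slice z.2.1 q)).symm

theorem grad_apply (z : (J ×ˢ (extChartAt (𝓡 n) q).target : Set (ℝ × EuclideanSpace ℝ (Fin n)))) :
    ((hg.frame q).grad (hΦ.elt q) (hΦ.elt q)).1 z =
      inChart q (gradNormSq (g z.1.1) (Φ z.1.1)) z.1.2 :=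
  ((hg.realizes q).grad (u := fun t ↦ inChart q (Φ t)) (hΦ.elt_apply q) z).trans
    (gradNormSq_eq (hg.smooth.smoothMetric z.2.1) z.2.2 (hΦ.slice z.2.1 q)).symm

theorem pair_apply (z : (J ×ˢ (extChartAt (𝓡 n) q).target : Set (ℝ × EuclideanSpace ℝ (Fin n)))) :
    ((hg.frame q).pair ((hg.frame q).Ric + (hg.frame q).Hess (hΦ.elt q))
      ((hg.frame q).Ric + (hg.frame q).Hess (hΦ.elt q))).1 z =
      inChart q (ricciHessNormSq (g z.1.1) (Φ z.1.1)) z.1.2 :=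
  ((hg.realizes q).pair (u := fun t ↦ inChart q (Φ t)) (hΦ.elt_apply q) z).trans
    (ricciHessNormSq_eq (hg.smooth.smoothMetric z.2.1) z.2.2 (hΦ.slice z.2.1 q)).symm

theorem chartSmooth_laplaceBeltrami : ChartSmooth n J fun t ↦ laplaceBeltrami (g t) (Φ t) :=
  .of_smoothRing fun q ↦ ⟨_, hg.lap_apply q hΦ⟩

theorem chartSmooth_gradNormSq : ChartSmooth n J fun t ↦ gradNormSq (g t) (Φ t) :=
  .of_smoothRing fun q ↦ ⟨_, hg.grad_apply q hΦ⟩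

theorem chartSmooth_ricciHessNormSq : ChartSmooth n J fun t ↦ ricciHessNormSq (g t) (Φ t) :=
  .of_smoothRing fun q ↦ ⟨_, hg.pair_apply q hΦ⟩

theorem chartSmooth_derivWithin : ChartSmooth n J fun t p ↦ derivWithin (fun s ↦ Φ s p) J t :=
  .of_smoothRing fun q ↦ ⟨hg.dt q (hΦ.elt q), fun z ↦
    ((hg.hasDerivWithinAt q (ψ := fun t ↦ inChart q (Φ t)) _ (hΦ.elt_apply q) z).derivWithin
      (uniqueDiffOn_of_nontrivial hg.ordConnected hg.nontrivial _ z.2.1)).symm⟩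

theorem hasDerivWithinAt_derivWithin {t : ℝ} (ht : t ∈ J) (p : M) :
    HasDerivWithinAt (fun s ↦ Φ s p) (derivWithin (fun s ↦ Φ s p) J t) J t := by
  have h := hg.hasDerivWithinAt p (ψ := fun t ↦ inChart p (Φ t)) _ (hΦ.elt_apply p)
    ⟨(t, extChartAt (𝓡 n) p p), ht, mem_extChartAt_target p⟩
  simp only [inChart, extChartAt_to_inv] at h
  exact h.differentiableWithinAt.hasDerivWithinAt

end SmoothFamily

end Family

/-! ### Divergence theorem on a closed manifold. -/

section Divergence

variable {n : ℕ}

/-- Integration by parts against the constant 1. -/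
theorem integral_pderiv_eq_zero {Z : EuclideanSpace ℝ (Fin n) → ℝ} (hZ : ContDiff ℝ 1 Z)
    (hc : HasCompactSupport Z) (i : Fin n) : ∫ y, pderiv i Z y = 0 := by
  have h1 : Continuous fun y ↦ fderiv ℝ Z y (EuclideanSpace.single i 1) :=
    (hZ.continuous_fderiv one_ne_zero).clm_apply continuous_const
  have h2 : HasCompactSupport fun y ↦ fderiv ℝ Z y (EuclideanSpace.single i 1) :=
    hc.fderiv_apply ℝ _
  have h := integral_mul_fderiv_eq_neg_fderiv_mul_of_integrable (μ := volume)
    (f := fun _ : EuclideanSpace ℝ (Fin n) ↦ (1 : ℝ)) (g := Z)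
    (v := EuclideanSpace.single i 1) (by simp)
    (by simpa using h1.integrable_of_hasCompactSupport h2)
    (by simpa using hZ.continuous.integrable_of_hasCompactSupport hc)
    (fun _ _ ↦ differentiableAt_const _)
    (fun _ _ ↦ (hZ.differentiable one_ne_zero).differentiableAt)
  simpa [pderiv] using h

theorem contDiff_of_eq_zero {F : Type*} [NormedAddCommGroup F] [NormedSpace ℝ F] {U K : Set F}
    (hU : IsOpen U) (hK : IsClosed K) (hKU : K ⊆ U) {Z : F → ℝ} (hZ : ContDiffOn ℝ ∞ Z U)
    (h0 : ∀ y, y ∉ K → Z y = 0) : ContDiff ℝ ∞ Z := by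
  refine contDiff_iff_contDiffAt.2 fun y ↦ ?_
  by_cases hy : y ∈ K
  · exact hZ.contDiffAt (hU.mem_nhds (hKU hy))
  · refine (contDiffAt_const (c := (0 : ℝ))).congr_of_eventuallyEq ?_
    filter_upwards [hK.isOpen_compl.mem_nhds hy] with w hw
    exact h0 w hw

theorem pderiv_eq_zero {u : EuclideanSpace ℝ (Fin n) → ℝ} {y : EuclideanSpace ℝ (Fin n)}
    (h : u =ᶠ[nhds y] 0) (i : Fin n) : pderiv i u =ᶠ[nhds y] 0 := by
  filter_upwards [h.fderiv (𝕜 := ℝ)] with w hw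
  simp [pderiv, hw]

theorem laplacian_eq_zero (G : EuclideanSpace ℝ (Fin n) → Matrix (Fin n) (Fin n) ℝ)
    {u : EuclideanSpace ℝ (Fin n) → ℝ} {y : EuclideanSpace ℝ (Fin n)}
    (h : u =ᶠ[nhds y] 0) : laplacian G u y = 0 := by
  have h1 := fun i ↦ (pderiv_eq_zero h i).eq_of_nhds
  have h2 := fun i j ↦ (pderiv_eq_zero (pderiv_eq_zero h j) i).eq_of_nhds
  simp [laplacian, hessian, h1, h2]

variable {M : Type*} [TopologicalSpace M] [ChartedSpace (EuclideanSpace ℝ (Fin n)) M]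

theorem inChart_eventuallyEq_zero {u : M → ℝ} {q : M} {y : EuclideanSpace ℝ (Fin n)}
    (hy : y ∈ (extChartAt (𝓡 n) q).target)
    (hu : (extChartAt (𝓡 n) q).symm y ∉ tsupport u) : inChart q u =ᶠ[nhds y] 0 := by
  have h := (continuousAt_extChartAt_symm'' hy).preimage_mem_nhds
    ((isClosed_tsupport u).isOpen_compl.mem_nhds hu)
  filter_upwards [h] with w hw
  exact image_eq_zero_of_notMem_tsupport (f := u) hw

theorem isCompact_image_tsupport [CompactSpace M] {u : M → ℝ} {q : M}
    (hs : tsupport u ⊆ (extChartAt (𝓡 n) q).source) :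
    IsCompact (extChartAt (𝓡 n) q '' tsupport u) :=
  (isClosed_tsupport u).isCompact.image_of_continuousOn ((continuousOn_extChartAt q).mono hs)

theorem image_tsupport_subset {u : M → ℝ} {q : M}
    (hs : tsupport u ⊆ (extChartAt (𝓡 n) q).source) :
    extChartAt (𝓡 n) q '' tsupport u ⊆ (extChartAt (𝓡 n) q).target := by
  rintro _ ⟨p, hp, rfl⟩
  exact (extChartAt (𝓡 n) q).map_source (hs hp)

theorem symm_notMem_tsupport {u : M → ℝ} {q : M} {y : EuclideanSpace ℝ (Fin n)}
    (hy : y ∈ (extChartAt (𝓡 n) q).target) (h : y ∉ extChartAt (𝓡 n) q '' tsupport u) :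
    (extChartAt (𝓡 n) q).symm y ∉ tsupport u := fun h' ↦
  h ⟨_, h', (extChartAt (𝓡 n) q).right_inv hy⟩

variable [IsManifold (𝓡 n) ∞ M]

theorem laplaceBeltrami_eq_zero (g : Metric n M) {u : M → ℝ} {p : M} (hu : p ∉ tsupport u) :
    laplaceBeltrami g u p = 0 :=
  laplacian_eq_zero _ (inChart_eventuallyEq_zero (mem_extChartAt_target p)
    (by rwa [extChartAt_to_inv]))

namespace SmoothFamily

variable {J : Set ℝ} {g : ℝ → Metric n M} (hg : SmoothFamily J g) (q : M)
include hg

/-- The volume density of a chart as an element of the ring of smooth functions. -/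
def densityElt : smoothRing (J ×ˢ (extChartAt (𝓡 n) q).target) :=
  smoothMk (fun z ↦ density (g z.1) q z.2) ((contDiffOn_det (hg.smooth q)).sqrt
    fun z hz ↦ (metricCoeff_posDef (g z.1) hz.2).det_pos.ne')

theorem densityElt_mul_self : hg.densityElt q * hg.densityElt q = (hg.frame q).G.det := by
  ext z
  have h : ((hg.frame q).G.det).1 z = (metricCoeff (g z.1.1) q z.1.2).det :=
    (smoothEval z).toRingHom.map_det (hg.frame q).G
  rw [h]
  exact Real.mul_self_sqrt (metricCoeff_posDef (g z.1.1) z.2.2).det_pos.le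

theorem isUnit_densityElt : IsUnit (hg.densityElt q) :=
  exists_mul_eq_one fun z ↦ (density_pos (g z.1.1) z.2.2).ne'

end SmoothFamily

theorem laplaceBeltrami_add {g : Metric n M} (hg : SmoothMetric g) {u v : M → ℝ}
    (hu : ChartSmooth n univ fun _ ↦ u) (hv : ChartSmooth n univ fun _ ↦ v) (p : M) :
    laplaceBeltrami g (fun x ↦ u x + v x) p = laplaceBeltrami g u p + laplaceBeltrami g v p := by
  have hF := hg.smoothFamily
  have h := congrArg (fun a ↦ a.1 ⟨((0 : ℝ), extChartAt (𝓡 n) p p), mem_univ _,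
    mem_extChartAt_target p⟩) ((hF.frame p).lap_add (hu.elt p) (hv.elt p))
  have h1 : hu.elt p + hv.elt p = (hu.add hv).elt p := rfl
  simp only [FrameGeometry.Realizes.apply_add, h1, hF.lap_apply p hu, hF.lap_apply p hv,
    hF.lap_apply p (hu.add hv), inChart, extChartAt_to_inv] at h
  exact h

theorem laplaceBeltrami_sum {g : Metric n M} (hg : SmoothMetric g) {ι : Type*} (s : Finset ι)
    {u : ι → M → ℝ} (hu : ∀ i, ChartSmooth n univ fun _ ↦ u i) (p : M) :
    ChartSmooth n univ (fun _ p ↦ ∑ i ∈ s, u i p) ∧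
    laplaceBeltrami g (fun x ↦ ∑ i ∈ s, u i x) p = ∑ i ∈ s, laplaceBeltrami g (u i) p := by
  classical
  induction s using Finset.induction_on with
  | empty =>
    refine ⟨fun q ↦ contDiffOn_const, ?_⟩
    simp only [Finset.sum_empty]
    exact laplacian_eq_zero _ (Filter.Eventually.of_forall fun _ ↦ rfl)
  | insert k s hk ih =>
    simp only [Finset.sum_insert hk]
    exact ⟨(hu k).add ih.1, by rw [laplaceBeltrami_add hg (hu k) ih.1, ih.2]⟩

variable [CompactSpace M] [MeasurableSpace M] [BorelSpace M]

theorem integrable_of_continuous {g : Metric n M} (hg : SmoothMetric g) {h : M → ℝ}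
    (hh : Continuous h) : Integrable h (riemannianVolume g) := by
  have := riemannianVolume_finite hg
  exact hh.integrable_of_hasCompactSupport (HasCompactSupport.of_compactSpace h)

theorem integral_laplaceBeltrami_eq_zero_of_tsupport_subset {g : Metric n M} (hg : SmoothMetric g)
    {u : M → ℝ} (hu : ChartSmooth n univ fun _ ↦ u) {q : M}
    (hs : tsupport u ⊆ (extChartAt (𝓡 n) q).source) :
    ∫ p, laplaceBeltrami g u p ∂(riemannianVolume g) = 0 := by
  have hF := hg.smoothFamily
  have hU : IsOpen (extChartAt (𝓡 n) q).target := isOpen_extChartAt_target q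
  have hcont : Continuous (laplaceBeltrami g u) :=
    (hF.chartSmooth_laplaceBeltrami hu).continuous (mem_univ 0)
  rw [integral_riemannianVolume hg q hcont fun p hp ↦
    laplaceBeltrami_eq_zero g fun h ↦ hp (hs h)]
  set K := extChartAt (𝓡 n) q '' tsupport u with hK
  have hKc : IsCompact K := isCompact_image_tsupport hs
  -- The vector field √det g ∇u. It vanishes off the compact image of the support, hence is smooth
  -- with compact support on the whole Euclidean space.
  let Z (k : Fin n) (y : EuclideanSpace ℝ (Fin n)) : ℝ :=
    smoothExt (hF.densityElt q * (hF.frame q).gradVec (hu.elt q) k) ((0 : ℝ), y)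
  have hZs : ∀ k, ContDiffOn ℝ ∞ (Z k) (extChartAt (𝓡 n) q).target := fun k ↦
    (contDiffOn_smoothExt _).comp (contDiffOn_const.prodMk contDiffOn_id)
      fun _ hy ↦ ⟨mem_univ _, hy⟩
  have hZ0 : ∀ k y, y ∉ K → Z k y = 0 := fun k y hy ↦ by
    by_cases hyU : y ∈ (extChartAt (𝓡 n) q).target
    · have h1 : ∀ l, ((hF.frame q).D l (hu.elt q)).1 ⟨((0 : ℝ), y), mem_univ _, hyU⟩ = 0 :=
        fun l ↦ ((hF.realizes q).D l (hu.elt q) (fun _ ↦ inChart q u) (hu.elt_apply q) _).trans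
          (pderiv_eq_zero (inChart_eventuallyEq_zero hyU (symm_notMem_tsupport hyU hy))
            l).eq_of_nhds
      have h2 : (hF.densityElt q * (hF.frame q).gradVec (hu.elt q) k).1
          ⟨((0 : ℝ), y), mem_univ _, hyU⟩ = 0 := by
        simp only [FrameGeometry.gradVec, FrameGeometry.Realizes.apply_mul,
          FrameGeometry.Realizes.sum_apply, h1, mul_zero, Finset.sum_const_zero]
      have h3 : ((0 : ℝ), y) ∈ (univ : Set ℝ) ×ˢ (extChartAt (𝓡 n) q).target :=
        ⟨mem_univ _, hyU⟩
      exact (smoothExt_eq _ h3).trans h2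
    -- Off the chart target `smoothExt` takes its default value 0, as required here.
    · exact Function.extend_apply' _ _ _ fun ⟨z, hz⟩ ↦ hyU (by
        have := z.2.2; rw [hz] at this; exact this)
  have hZc : ∀ k, ContDiff ℝ ∞ (Z k) := fun k ↦
    contDiff_of_eq_zero hU hKc.isClosed (image_tsupport_subset hs) (hZs k) (hZ0 k)
  have hdiv : ∀ y ∈ (extChartAt (𝓡 n) q).target,
      density g q y * inChart q (laplaceBeltrami g u) y = ∑ k, pderiv k (Z k) y := fun y hy ↦ by
    have h1 := congrArg (fun a : smoothRing ((univ : Set ℝ) ×ˢ (extChartAt (𝓡 n) q).target) ↦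
      a.1 ⟨((0 : ℝ), y), mem_univ _, hy⟩)
      ((hF.frame q).sqrt_det_mul_lap (hF.densityElt_mul_self q) (hF.isUnit_densityElt q)
        (hu.elt q))
    simp only [FrameGeometry.Realizes.apply_mul, FrameGeometry.Realizes.sum_apply,
      hF.lap_apply q hu] at h1
    refine h1.trans (Finset.sum_congr rfl fun k _ ↦ ?_)
    exact (hF.realizes q).D k _ (fun t y ↦ smoothExt
      (hF.densityElt q * (hF.frame q).gradVec (hu.elt q) k) (t, y))
      (fun z ↦ (smoothExt_apply _ z).symm) ⟨((0 : ℝ), y), mem_univ _, hy⟩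
  rw [setIntegral_congr_fun hU.measurableSet hdiv, setIntegral_eq_integral_of_forall_compl_eq_zero,
    integral_finsetSum]
  · exact Finset.sum_eq_zero fun k _ ↦ integral_pderiv_eq_zero ((hZc k).of_le (by simp))
      (HasCompactSupport.intro hKc (hZ0 k)) k
  · intro k _
    exact (((hZc k).continuous_fderiv (by simp)).clm_apply
      continuous_const).integrable_of_hasCompactSupport
        ((HasCompactSupport.intro hKc (hZ0 k)).fderiv_apply ℝ _)
  · intro y hy
    refine Finset.sum_eq_zero fun k _ ↦ ?_
    refine (pderiv_eq_zero ?_ k).eq_of_nhds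
    filter_upwards [hKc.isClosed.isOpen_compl.mem_nhds
      fun h ↦ hy (image_tsupport_subset hs h)] with w hw
    exact hZ0 k w hw

/-- A finite smooth partition of unity subordinate to charts. -/
theorem exists_partition (n : ℕ) (M : Type*) [TopologicalSpace M]
    [ChartedSpace (EuclideanSpace ℝ (Fin n)) M] [IsManifold (𝓡 n) ∞ M] [CompactSpace M]
    [T2Space M] : ∃ (s : Finset M) (ρ : M → M → ℝ),
      (∀ i, ChartSmooth n univ fun _ ↦ ρ i) ∧
      (∀ i, tsupport (ρ i) ⊆ (extChartAt (𝓡 n) i).source) ∧ ∀ p, ∑ i ∈ s, ρ i p = 1 := by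
  obtain ⟨ρ, hρ⟩ := SmoothPartitionOfUnity.exists_isSubordinate_chartAt_source (𝓡 n) M
  have hfin := ρ.locallyFinite.finite_nonempty_of_compact
  refine ⟨hfin.toFinset, fun i ↦ ρ i, fun i ↦ chartSmooth_of_contMDiff (ρ i).contMDiff _,
    fun i ↦ by rw [extChartAt_source]; exact hρ i, fun p ↦ ?_⟩
  rw [← ρ.sum_eq_one (mem_univ p), finsum_eq_sum_of_support_subset]
  intro i hi
  simp only [Finite.coe_toFinset]
  exact ⟨p, hi⟩

/-- The partition of unity goes inside the Laplacian: Δu = ∑ Δ(ρ_i u), and each summand integrates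
to zero in its chart. The products ρ_i Δu would not. -/
theorem integral_laplaceBeltrami_eq_zero [T2Space M] {g : Metric n M} (hg : SmoothMetric g)
    {u : M → ℝ} (hu : ChartSmooth n univ fun _ ↦ u) :
    ∫ p, laplaceBeltrami g u p ∂(riemannianVolume g) = 0 := by
  obtain ⟨s, ρ, hρ, hs, h1⟩ := exists_partition n M
  have hu' : u = fun p ↦ ∑ i ∈ s, ρ i p * u p := by
    ext p; rw [← Finset.sum_mul, h1, one_mul]
  have h2 : ∀ p, laplaceBeltrami g u p = ∑ i ∈ s, laplaceBeltrami g (fun p ↦ ρ i p * u p) p :=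
    fun p ↦ by
      conv_lhs => rw [hu']
      exact (laplaceBeltrami_sum hg s (fun i ↦ (hρ i).mul hu) p).2
  simp only [h2]
  rw [integral_finsetSum]
  · exact Finset.sum_eq_zero fun i _ ↦ integral_laplaceBeltrami_eq_zero_of_tsupport_subset hg
      ((hρ i).mul hu) ((tsupport_mul_subset_left (f := ρ i) (g := u)).trans (hs i))
  · exact fun i _ ↦ integrable_of_continuous hg
      ((hg.smoothFamily.chartSmooth_laplaceBeltrami ((hρ i).mul hu)).continuous (mem_univ 0))

end Divergence

/-! ### Differentiation under the integral sign. -/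

section Parametric

/-- Dominated convergence for difference quotients within J, which covers one-sided derivatives at
endpoints. The mean value inequality bounds the quotients. -/
theorem hasDerivWithinAt_setIntegral {E : Type*} [TopologicalSpace E] [T2Space E]
    [MeasurableSpace E] [OpensMeasurableSpace E] {μ : Measure E} [IsFiniteMeasureOnCompacts μ]
    {J : Set ℝ} (hJ : J.OrdConnected) {K : Set E} (hK : IsCompact K) {ψ ψ' : ℝ × E → ℝ}
    (hψ : ContinuousOn ψ (J ×ˢ K)) (hψ' : ContinuousOn ψ' (J ×ˢ K))
    (hd : ∀ t ∈ J, ∀ y ∈ K, HasDerivWithinAt (fun s ↦ ψ (s, y)) (ψ' (t, y)) J t)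
    {t : ℝ} (ht : t ∈ J) :
    HasDerivWithinAt (fun s ↦ ∫ y in K, ψ (s, y) ∂μ) (∫ y in K, ψ' (t, y) ∂μ) J t := by
  have hslice : ∀ {χ : ℝ × E → ℝ}, ContinuousOn χ (J ×ˢ K) → ∀ s ∈ J,
      ContinuousOn (fun y ↦ χ (s, y)) K := fun hχ s hs ↦
    hχ.comp (continuous_const.prodMk continuous_id).continuousOn fun _ hy ↦ ⟨hs, hy⟩
  have hint : ∀ s ∈ J, IntegrableOn (fun y ↦ ψ (s, y)) K μ := fun s hs ↦
    (hslice hψ s hs).integrableOn_compact hK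
  obtain ⟨C, hC⟩ := hK.exists_bound_of_continuousOn (hslice hψ' t ht)
  -- C bounds ψ' at time t only; by continuity and compactness of K, the bound C + 1 holds for all
  -- nearby times in J, uniformly on K.
  have hev : ∀ᶠ s in nhds t, ∀ y ∈ K, s ∈ J → y ∈ K → ‖ψ' (s, y)‖ ≤ C + 1 := by
    refine hK.eventually_forall_of_forall_eventually fun y hy ↦ ?_
    have h1 := (hψ' (t, y) ⟨ht, hy⟩).norm.eventually_lt_const (u := C + 1)
      (lt_of_le_of_lt (hC y hy) (lt_add_one C))
    filter_upwards [eventually_nhdsWithin_iff.1 h1] with z hz h2 h3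
    exact (hz ⟨h2, h3⟩).le
  obtain ⟨ε, hε, hball⟩ := Metric.eventually_nhds_iff_ball.1 hev
  rw [hasDerivWithinAt_iff_tendsto_slope]
  have hslope : ∀ s ∈ J, slope (fun s ↦ ∫ y in K, ψ (s, y) ∂μ) t s =
      ∫ y in K, slope (fun s ↦ ψ (s, y)) t s ∂μ := fun s hs ↦ by
    simp only [slope_def_module]
    rw [integral_smul, integral_sub (hint s hs) (hint t ht)]
  have hmem : ∀ᶠ s in nhdsWithin t (J \ {t}), s ∈ J ∧ s ≠ t :=
    eventually_mem_nhdsWithin.mono fun s hs ↦ hs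
  refine Filter.Tendsto.congr' (f₁ := fun s ↦ ∫ y in K, slope (fun s ↦ ψ (s, y)) t s ∂μ)
    (hmem.mono fun s hs ↦ (hslope s hs.1).symm) ?_
  refine tendsto_integral_filter_of_dominated_convergence (fun _ ↦ C + 1) ?_ ?_ ?_ ?_
  · filter_upwards [hmem] with s hs
    simp only [slope_def_module]
    exact (((hint s hs.1).sub (hint t ht)).smul ((s - t)⁻¹)).aestronglyMeasurable
  · have hb : ∀ᶠ s in nhdsWithin t (J \ {t}), s ∈ Metric.ball t ε :=
      Filter.Eventually.filter_mono nhdsWithin_le_nhds (Metric.ball_mem_nhds t hε)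
    filter_upwards [hmem, hb] with s hs hsb
    refine (ae_restrict_iff' hK.measurableSet).2 (Filter.Eventually.of_forall fun y hy ↦ ?_)
    have hconv : Convex ℝ (J ∩ Metric.ball t ε) := hJ.convex.inter (convex_ball t ε)
    have h1 := hconv.norm_image_sub_le_of_norm_hasDerivWithin_le (f := fun s ↦ ψ (s, y))
      (f' := fun s ↦ ψ' (s, y)) (C := C + 1)
      (fun x hx ↦ (hd x hx.1 y hy).mono inter_subset_left)
      (fun x hx ↦ hball x hx.2 y hy hx.1 hy) ⟨ht, Metric.mem_ball_self hε⟩ ⟨hs.1, hsb⟩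
    rw [slope_def_field, norm_div, div_le_iff₀ (norm_pos_iff.2 (sub_ne_zero.2 hs.2))]
    exact h1
  · exact integrableOn_const hK.measure_lt_top.ne
  · refine (ae_restrict_iff' hK.measurableSet).2 (Filter.Eventually.of_forall fun y hy ↦ ?_)
    exact hasDerivWithinAt_iff_tendsto_slope.1 (hd t ht y hy)

end Parametric

/-! ### First variation of integrals along the Ricci flow. -/

section Flow

variable {n : ℕ} {M : Type*} [TopologicalSpace M] [ChartedSpace (EuclideanSpace ℝ (Fin n)) M]
  [IsManifold (𝓡 n) ∞ M]

/-- A Ricci flow over a nondegenerate interval. -/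
structure Flow (J : Set ℝ) (g : ℝ → Metric n M) : Prop extends SmoothFamily J g where
  flow : ∀ t ∈ J, ∀ q : M, ∀ y ∈ (extChartAt (𝓡 n) q).target, ∀ i j : Fin n,
    HasDerivWithinAt (fun s ↦ metricCoeff (g s) q y i j)
      (-2 * ricci (metricCoeff (g t) q) i j y) J t

variable {J : Set ℝ} {g : ℝ → Metric n M}

theorem Flow.evolves (hg : Flow J g) (q : M) : (hg.frame q).Evolves (hg.dt q) where
  comm := hg.isCoordinate q
  comm_time := hg.dt_comm q
  flow i j := by
    ext z
    refine (hg.dt_apply_eq q (ψ := fun t y ↦ metricCoeff (g t) q y i j) ((hg.realizes q).G i j) (hg.flow _ z.2.1 q _ z.2.2 i j)).trans ?_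
    rw [FrameGeometry.Realizes.apply_mul, (hg.realizes q).Ric i j z]
    rfl

theorem SmoothFamily.dt_const (hg : SmoothFamily J g) {χ : M → ℝ}
    (hχ : ChartSmooth n J fun _ ↦ χ) (q : M) : hg.dt q (hχ.elt q) = 0 := by
  ext z
  exact hg.dt_apply_eq q (ψ := fun _ ↦ inChart q χ) (hχ.elt_apply q)
    (hasDerivWithinAt_const _ _ _)

theorem SmoothFamily.dt_elt (hg : SmoothFamily J g) {Φ : ℝ → M → ℝ} (hΦ : ChartSmooth n J Φ)
    (q : M) : hg.dt q (hΦ.elt q) = (hg.chartSmooth_derivWithin hΦ).elt q := by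
  ext z
  exact hg.dt_apply_eq q (ψ := fun t ↦ inChart q (Φ t)) (hΦ.elt_apply q)
    (hg.hasDerivWithinAt_derivWithin hΦ z.2.1 _)

variable [CompactSpace M] [MeasurableSpace M] [BorelSpace M]

/-- The derivative of `∫ χ Φ dV` along the flow, for a cutoff `χ` supported in a chart. -/
theorem Flow.hasDerivWithinAt_integral_of_tsupport_subset (hg : Flow J g) {Φ : ℝ → M → ℝ}
    (hΦ : ChartSmooth n J Φ) {χ : M → ℝ} (hχ : ChartSmooth n J fun _ ↦ χ) {q : M}
    (hs : tsupport χ ⊆ (extChartAt (𝓡 n) q).source) {t : ℝ} (ht : t ∈ J) :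
    HasDerivWithinAt (fun s ↦ ∫ p, χ p * Φ s p ∂(riemannianVolume (g s)))
      (∫ p, χ p * (derivWithin (fun s ↦ Φ s p) J t - scalarCurvature (g t) p * Φ t p)
        ∂(riemannianVolume (g t))) J t := by
  have hΦ' := (hg.chartSmooth_derivWithin hΦ).sub (hg.chartSmooth_scalarCurvature.mul hΦ)
  have hK : IsCompact (extChartAt (𝓡 n) q '' tsupport χ) := isCompact_image_tsupport hs
  have hU : IsOpen (extChartAt (𝓡 n) q).target := isOpen_extChartAt_target q
  let a := hg.densityElt q * (hχ.elt q * hΦ.elt q)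
  -- The product rule with ∂_t χ = 0 and ∂_t √det g = -R √det g.
  have hat : hg.dt q a = hg.densityElt q * (hχ.elt q * hΦ'.elt q) := by
    have h1 : hΦ'.elt q = hg.dt q (hΦ.elt q) - (hg.frame q).Scal * hΦ.elt q := by
      rw [hg.dt_elt hΦ]
      ext z
      rw [FrameGeometry.Realizes.apply_sub, FrameGeometry.Realizes.apply_mul, hg.scal_apply]
      rfl
    rw [h1, Derivation.leibniz, Derivation.leibniz, hg.dt_const hχ,
      (hg.frame q).dt_sqrt_det (hg.densityElt_mul_self q) (hg.isUnit_densityElt q) (hg.evolves q)]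
    simp only [smul_eq_mul]
    ring
  -- The moving measure becomes a factor of the integrand, and the domain becomes a compact set
  -- independent of time.
  have key : ∀ {Ψ : ℝ → M → ℝ} (hΨ : ChartSmooth n J Ψ), ∀ s ∈ J,
      ∫ p, χ p * Ψ s p ∂(riemannianVolume (g s)) = ∫ y in extChartAt (𝓡 n) q '' tsupport χ,
        smoothExt (hg.densityElt q * (hχ.elt q * hΨ.elt q)) (s, y) := fun {Ψ} hΨ s hs' ↦ by
    rw [integral_riemannianVolume (hg.smooth.smoothMetric hs') q
      ((hχ.mul hΨ).continuous hs') fun p hp ↦ by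
        rw [image_eq_zero_of_notMem_tsupport fun h ↦ hp (hs h), zero_mul]]
    rw [setIntegral_eq_of_subset_of_forall_sdiff_eq_zero hU.measurableSet
      (image_tsupport_subset hs) fun y hy ↦ by
        simp only [inChart, image_eq_zero_of_notMem_tsupport (symm_notMem_tsupport hy.1 hy.2),
          zero_mul, mul_zero]]
    refine setIntegral_congr_fun hK.measurableSet fun y hy ↦ ?_
    have h1 : (s, y) ∈ J ×ˢ (extChartAt (𝓡 n) q).target := ⟨hs', image_tsupport_subset hs hy⟩
    rw [smoothExt_eq _ h1]
    rfl
  have hsub : J ×ˢ (extChartAt (𝓡 n) q '' tsupport χ) ⊆ J ×ˢ (extChartAt (𝓡 n) q).target :=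
    prod_mono le_rfl (image_tsupport_subset hs)
  have h := hasDerivWithinAt_setIntegral (μ := volume) hg.ordConnected hK
    ((contDiffOn_smoothExt a).continuousOn.mono hsub)
    ((contDiffOn_smoothExt (hg.dt q a)).continuousOn.mono hsub)
    (fun s hs' y hy ↦ by
      have h1 : (s, y) ∈ J ×ˢ (extChartAt (𝓡 n) q).target := hsub ⟨hs', hy⟩
      rw [smoothExt_eq _ h1]
      exact hg.hasDerivWithinAt q a (ψ := fun t y ↦ smoothExt a (t, y))
        (fun z ↦ (smoothExt_apply a z).symm) ⟨_, h1⟩) ht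
  rw [hat, ← key hΦ' t ht] at h
  exact h.congr_of_mem (fun s hs' ↦ key hΦ s hs') ht

theorem Flow.hasDerivWithinAt_integral [T2Space M] (hg : Flow J g) {Φ : ℝ → M → ℝ}
    (hΦ : ChartSmooth n J Φ) {t : ℝ} (ht : t ∈ J) :
    HasDerivWithinAt (fun s ↦ ∫ p, Φ s p ∂(riemannianVolume (g s)))
      (∫ p, (derivWithin (fun s ↦ Φ s p) J t - scalarCurvature (g t) p * Φ t p)
        ∂(riemannianVolume (g t))) J t := by
  obtain ⟨σ, ρ, hρ, hs, h1⟩ := exists_partition n M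
  have hρJ : ∀ i, ChartSmooth n J fun _ ↦ ρ i := fun i ↦ (hρ i).const (mem_univ 0) J
  have key : ∀ {Ψ : ℝ → M → ℝ} (_ : ChartSmooth n J Ψ), ∀ s ∈ J,
      ∫ p, Ψ s p ∂(riemannianVolume (g s)) =
        ∑ i ∈ σ, ∫ p, ρ i p * Ψ s p ∂(riemannianVolume (g s)) := fun {Ψ} hΨ s hs' ↦ by
    rw [← integral_finsetSum]
    · simp only [← Finset.sum_mul, h1, one_mul]
    · exact fun i _ ↦ integrable_of_continuous (hg.smooth.smoothMetric hs')
        (((hρJ i).mul hΨ).continuous hs')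
  have hΦ' := (hg.chartSmooth_derivWithin hΦ).sub (hg.chartSmooth_scalarCurvature.mul hΦ)
  have h := HasDerivWithinAt.fun_sum (u := σ) fun i _ ↦
    hg.hasDerivWithinAt_integral_of_tsupport_subset hΦ (hρJ i) (hs i) ht
  rw [← key hΦ' t ht] at h
  exact h.congr_of_mem (fun s hs' ↦ key hΦ s hs') ht

end Flow

/-! ### The soliton energy and its zero set. -/

section Positivity

variable {n : ℕ}

/-- The sum is the quadratic form of the Kronecker product G⁻¹ ⊗ G⁻¹, which is positive definite,
evaluated at T as a vector. -/
theorem sum_inv_mul_inv_pos {G : Matrix (Fin n) (Fin n) ℝ} (hG : G.PosDef)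
    {T : Fin n → Fin n → ℝ} (hT : T ≠ 0) :
    0 < ∑ i, ∑ j, ∑ k, ∑ l, G⁻¹ i k * G⁻¹ j l * T i j * T k l := by
  have h := (hG.inv.kronecker hG.inv).dotProduct_mulVec_pos (x := fun z ↦ T z.1 z.2)
    fun h0 ↦ hT (by ext i j; exact congrFun h0 (i, j))
  refine h.trans_eq ?_
  simp only [dotProduct, Matrix.mulVec, Fintype.sum_prod_type, Finset.mul_sum, star_trivial,
    Pi.star_apply, Matrix.kroneckerMap_apply]
  exact Finset.sum_congr rfl fun i _ ↦ Finset.sum_congr rfl fun j _ ↦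
    Finset.sum_congr rfl fun k _ ↦ Finset.sum_congr rfl fun l _ ↦ by ring

theorem ricciHessSq_nonneg {G : EuclideanSpace ℝ (Fin n) → Matrix (Fin n) (Fin n) ℝ}
    {u : EuclideanSpace ℝ (Fin n) → ℝ} {y : EuclideanSpace ℝ (Fin n)} (hG : (G y).PosDef) :
    0 ≤ ricciHessSq G u y := by
  by_cases hT : (fun i j ↦ ricci G i j y + hessian G u i j y) = 0
  · have h : ∀ i j, ricci G i j y + hessian G u i j y = 0 := fun i j ↦ congrFun₂ hT i j
    simp [ricciHessSq, h]
  · exact (sum_inv_mul_inv_pos hG hT).le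

theorem ricciHessSq_eq_zero_iff {G : EuclideanSpace ℝ (Fin n) → Matrix (Fin n) (Fin n) ℝ}
    {u : EuclideanSpace ℝ (Fin n) → ℝ} {y : EuclideanSpace ℝ (Fin n)} (hG : (G y).PosDef) :
    ricciHessSq G u y = 0 ↔ ∀ i j, ricci G i j y + hessian G u i j y = 0 := by
  refine ⟨fun h i j ↦ ?_, fun h ↦ by simp [ricciHessSq, h]⟩
  by_contra hij
  exact (sum_inv_mul_inv_pos hG (T := fun i j ↦ ricci G i j y + hessian G u i j y)
    fun h0 ↦ hij (congrFun₂ h0 i j)).ne' h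

variable {M : Type*} [TopologicalSpace M] [ChartedSpace (EuclideanSpace ℝ (Fin n)) M]
  [IsManifold (𝓡 n) ∞ M]

theorem ricciHessNormSq_nonneg (g : Metric n M) (u : M → ℝ) (p : M) :
    0 ≤ ricciHessNormSq g u p :=
  ricciHessSq_nonneg (metricCoeff_posDef g (mem_extChartAt_target p))

theorem solitonEnergy_nonneg [MeasurableSpace M] (g : Metric n M) (u : M → ℝ) : 0 ≤ solitonEnergy g u :=
  integral_nonneg fun p ↦ mul_nonneg (ricciHessNormSq_nonneg g u p) (Real.exp_pos _).le

theorem solitonEnergy_integrand_continuous {g : Metric n M} (hg : SmoothMetric g) {u : M → ℝ}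
    (hu : ContMDiff (𝓡 n) 𝓘(ℝ, ℝ) ∞ u) :
    Continuous fun p ↦ ricciHessNormSq g u p * Real.exp (-u p) :=
  ((hg.smoothFamily.chartSmooth_ricciHessNormSq (chartSmooth_of_contMDiff hu univ)).continuous
    (mem_univ 0)).mul (Real.continuous_exp.comp hu.continuous.neg)

/-- A continuous nonnegative integrand with zero integral vanishes everywhere, because the volume
charges nonempty open sets. Chart invariance then extends the equation from the centre of each chart
to all of it. -/
theorem solitonEnergy_eq_zero_iff [CompactSpace M] [MeasurableSpace M] [BorelSpace M] {g : Metric n M} (hg : SmoothMetric g) {u : M → ℝ}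
    (hu : ContMDiff (𝓡 n) 𝓘(ℝ, ℝ) ∞ u) :
    solitonEnergy g u = 0 ↔ IsSteadyGradientSoliton g u := by
  have := riemannianVolume_pos hg
  have := riemannianVolume_finite hg
  have hc := solitonEnergy_integrand_continuous hg hu
  have h0 : 0 ≤ fun p ↦ ricciHessNormSq g u p * Real.exp (-u p) := fun p ↦
    mul_nonneg (ricciHessNormSq_nonneg g u p) (Real.exp_pos _).le
  have hz : IsSteadyGradientSoliton g u ↔ ∀ p, ricciHessNormSq g u p = 0 := by
    refine ⟨fun h p ↦ (ricciHessSq_eq_zero_iff (metricCoeff_posDef g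
      (mem_extChartAt_target p))).2 (h.2 p _ (mem_extChartAt_target p)), fun h ↦
      ⟨hu, fun q y hy ↦ (ricciHessSq_eq_zero_iff (metricCoeff_posDef g hy)).1 ?_⟩⟩
    rw [← ricciHessNormSq_eq hg hy (contDiffOn_inChart hu q)]
    exact h _
  rw [hz]
  refine ⟨fun h p ↦ ?_, fun h ↦ by simp [solitonEnergy, h]⟩
  by_contra hp
  exact (hc.integral_pos_of_hasCompactSupport_nonneg_nonzero (μ := riemannianVolume g)
    (HasCompactSupport.of_compactSpace _) h0
    (mul_ne_zero hp (Real.exp_pos (-u p)).ne')).ne' h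

end Positivity

/-! ### The logarithmic derivative of e^{-f} in the smooth ring. -/

section Exponential

theorem dirDeriv_exp_neg {F : Type*} [NormedAddCommGroup F] [NormedSpace ℝ F] {s : Set F}
    (hs : UniqueDiffOn ℝ s) (v : F) {a b : smoothRing s}
    (h : ∀ z, b.1 z = Real.exp (-a.1 z)) : dirDeriv hs v b = -(b * dirDeriv hs v a) := by
  ext z
  have h1 := ((hasFDerivWithinAt_smoothExt a z.2).neg).exp
  rw [dirDeriv_apply, fderivWithin_smoothExt hs (fun y ↦ by
    rw [h, ← smoothExt_apply a y]; rfl) z.2 h1]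
  have h2 : (-(b * dirDeriv hs v a)).1 z = -(b.1 z * (dirDeriv hs v a).1 z) := rfl
  rw [h2, h, dirDeriv_apply, ← smoothExt_apply a z]
  simp

end Exponential

/-! ### The derivative of 𝓕. -/

section Functional

variable {n : ℕ} {M : Type*} [TopologicalSpace M] [ChartedSpace (EuclideanSpace ℝ (Fin n)) M]
  [IsManifold (𝓡 n) ∞ M] {J : Set ℝ} {g : ℝ → Metric n M} {f : ℝ → M → ℝ}

/-- Perelman's integrand `(R + 2Δf - |∇f|²) e^{-f}`. -/
def harnackDensity (g : Metric n M) (f : M → ℝ) (p : M) : ℝ :=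
  (scalarCurvature g p + 2 * laplaceBeltrami g f p - gradNormSq g f p) * Real.exp (-f p)

theorem SmoothFamily.chartSmooth_harnackDensity (hg : SmoothFamily J g)
    (hf : ChartSmooth n J f) : ChartSmooth n J fun t ↦ harnackDensity (g t) (f t) :=
  ((hg.chartSmooth_scalarCurvature.add ((hg.chartSmooth_laplaceBeltrami hf).const_mul 2)).sub
    (hg.chartSmooth_gradNormSq hf)).mul hf.exp_neg

theorem SmoothFamily.harnackDensity_elt (hg : SmoothFamily J g) (hf : ChartSmooth n J f) (q : M) :
    (hg.chartSmooth_harnackDensity hf).elt q =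
      (hg.frame q).harnack (hf.elt q) * hf.exp_neg.elt q := by
  ext z
  rw [FrameGeometry.harnack, two_mul, FrameGeometry.Realizes.apply_mul,
    FrameGeometry.Realizes.apply_sub, FrameGeometry.Realizes.apply_add,
    FrameGeometry.Realizes.apply_add, hg.scal_apply, hg.lap_apply q hf, hg.grad_apply q hf,
    ← two_mul]
  rfl

theorem SmoothFamily.D_exp_neg (hg : SmoothFamily J g) (hf : ChartSmooth n J f) (q : M)
    (i : Fin n) : (hg.frame q).D i (hf.exp_neg.elt q) =
      -(hf.exp_neg.elt q * (hg.frame q).D i (hf.elt q)) :=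
  dirDeriv_exp_neg (hg.uniqueDiffOn q) _ fun _ ↦ rfl

theorem SmoothFamily.functional_integrand (hg : SmoothFamily J g) (hf : ChartSmooth n J f)
    {t : ℝ} (ht : t ∈ J) (p : M) :
    (scalarCurvature (g t) p + gradNormSq (g t) (f t) p) * Real.exp (-f t p) =
      harnackDensity (g t) (f t) p
        + 2 * laplaceBeltrami (g t) (fun p ↦ Real.exp (-f t p)) p := by
  have h := (hg.frame p).functional_integrand (hg.D_exp_neg hf p)
  rw [← hg.harnackDensity_elt hf, two_mul] at h
  have h1 := congrArg (fun a : smoothRing (J ×ˢ (extChartAt (𝓡 n) p).target) ↦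
    a.1 ⟨(t, extChartAt (𝓡 n) p p), ht, mem_extChartAt_target p⟩) h
  simp only [FrameGeometry.Realizes.apply_mul, FrameGeometry.Realizes.apply_add, hg.scal_apply,
    hg.lap_apply p hf.exp_neg, hg.grad_apply p hf, ChartSmooth.elt_apply, inChart,
    extChartAt_to_inv] at h1
  rw [h1]
  ring

/-- The left side is the integrand produced by the first variation, the scalar curvature term coming
from ∂_t dV; on the right only the square survives integration. -/
theorem Flow.derivWithin_harnackDensity (hg : Flow J g) (hf : ChartSmooth n J f)
    (hft : ∀ t ∈ J, ∀ p : M, HasDerivWithinAt (fun s ↦ f s p)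
      (-laplaceBeltrami (g t) (f t) p + gradNormSq (g t) (f t) p - scalarCurvature (g t) p) J t)
    {t : ℝ} (ht : t ∈ J) (p : M) :
    derivWithin (fun s ↦ harnackDensity (g s) (f s) p) J t
      - scalarCurvature (g t) p * harnackDensity (g t) (f t) p =
      2 * (ricciHessNormSq (g t) (f t) p * Real.exp (-f t p))
        - laplaceBeltrami (g t) (harnackDensity (g t) (f t)) p := by
  have hd : hg.dt p (hf.elt p) = -(hg.frame p).lap (hf.elt p)
      + (hg.frame p).grad (hf.elt p) (hf.elt p) - (hg.frame p).Scal := by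
    ext z
    refine (hg.dt_apply_eq p (ψ := fun t ↦ inChart p (f t)) (hf.elt_apply p)
      (hft _ z.2.1 _)).trans ?_
    rw [sub_eq_add_neg, sub_eq_add_neg]
    change _ = -((hg.frame p).lap (hf.elt p)).1 z + ((hg.frame p).grad (hf.elt p) (hf.elt p)).1 z
      + -(hg.frame p).Scal.1 z
    rw [hg.scal_apply, hg.lap_apply p hf, hg.grad_apply p hf]
    rfl
  have h := (hg.evolves p).dt_harnack_mul hd (hg.D_exp_neg hf p)
    (dirDeriv_exp_neg (hg.uniqueDiffOn p) _ fun _ ↦ rfl)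
  rw [← hg.harnackDensity_elt hf, hg.dt_elt, two_mul, neg_add_eq_sub] at h
  have h1 := congrArg (fun a : smoothRing (J ×ˢ (extChartAt (𝓡 n) p).target) ↦
    a.1 ⟨(t, extChartAt (𝓡 n) p p), ht, mem_extChartAt_target p⟩) h
  simp only [FrameGeometry.Realizes.apply_mul, FrameGeometry.Realizes.apply_add,
    FrameGeometry.Realizes.apply_sub, hg.scal_apply,
    hg.lap_apply p (hg.chartSmooth_harnackDensity hf), hg.pair_apply p hf, ChartSmooth.elt_apply,
    inChart, extChartAt_to_inv] at h1
  rw [h1]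
  ring

variable [CompactSpace M] [T2Space M] [MeasurableSpace M] [BorelSpace M]

/-- The two integrands differ by 2Δe^{-f}, whose integral is zero. -/
theorem SmoothFamily.functionalF_eq (hg : SmoothFamily J g) (hf : ChartSmooth n J f)
    {t : ℝ} (ht : t ∈ J) :
    functionalF (g t) (f t) = ∫ p, harnackDensity (g t) (f t) p ∂(riemannianVolume (g t)) := by
  have hgt := hg.smooth.smoothMetric ht
  have hu := hf.exp_neg.const ht univ
  simp only [functionalF, hg.functional_integrand hf ht]
  rw [integral_add, integral_const_mul, integral_laplaceBeltrami_eq_zero hgt hu, mul_zero, add_zero]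
  · exact integrable_of_continuous hgt ((hg.chartSmooth_harnackDensity hf).continuous ht)
  · exact (integrable_of_continuous hgt
      ((hg.chartSmooth_laplaceBeltrami hf.exp_neg).continuous ht)).const_mul 2

theorem Flow.hasDerivWithinAt_functionalF (hg : Flow J g) (hf : ChartSmooth n J f)
    (hft : ∀ t ∈ J, ∀ p : M, HasDerivWithinAt (fun s ↦ f s p)
      (-laplaceBeltrami (g t) (f t) p + gradNormSq (g t) (f t) p - scalarCurvature (g t) p) J t)
    {t : ℝ} (ht : t ∈ J) :
    HasDerivWithinAt (fun s ↦ functionalF (g s) (f s)) (2 * solitonEnergy (g t) (f t)) J t := by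
  have hgt := hg.smooth.smoothMetric ht
  have hv := hg.chartSmooth_harnackDensity hf
  have h := hg.hasDerivWithinAt_integral hv ht
  simp only [hg.derivWithin_harnackDensity hf hft ht] at h
  rw [integral_sub, integral_const_mul,
    integral_laplaceBeltrami_eq_zero hgt (hv.const ht univ), sub_zero] at h
  · exact h.congr_of_mem (fun s hs ↦ hg.functionalF_eq hf hs) ht
  · exact (integrable_of_continuous hgt
      (((hg.chartSmooth_ricciHessNormSq hf).mul hf.exp_neg).continuous ht)).const_mul 2
  · exact integrable_of_continuous hgt ((hg.chartSmooth_laplaceBeltrami hv).continuous ht)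

end Functional

end

end RicciFlow

/-! ### Monotonicity and rigidity. -/

theorem lemma6p1 {n : ℕ} {M : Type*} [TopologicalSpace M]
    [ChartedSpace (EuclideanSpace ℝ (Fin n)) M] [IsManifold (𝓡 n) ∞ M]
    [CompactSpace M] [T2Space M] [MeasurableSpace M] [BorelSpace M]
    (J : Set ℝ) (hJ : J.OrdConnected) (hJ' : J.Nontrivial)
    (g : ℝ → RicciFlow.Metric n M) (f : ℝ → M → ℝ)
    (hg : RicciFlow.IsRicciFlow J g) (hf : RicciFlow.IsPotentialFlow J g f) :
    (∀ t ∈ J,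
      Integrable (fun p ↦ (RicciFlow.scalarCurvature (g t) p
          + RicciFlow.gradNormSq (g t) (f t) p) * Real.exp (-f t p))
        (RicciFlow.riemannianVolume (g t)) ∧
      Integrable (fun p ↦ RicciFlow.ricciHessNormSq (g t) (f t) p * Real.exp (-f t p))
        (RicciFlow.riemannianVolume (g t)) ∧
      HasDerivWithinAt (fun s ↦ RicciFlow.functionalF (g s) (f s))
        (2 * RicciFlow.solitonEnergy (g t) (f t)) J t ∧
      0 ≤ 2 * RicciFlow.solitonEnergy (g t) (f t) ∧
      (2 * RicciFlow.solitonEnergy (g t) (f t) = 0 ↔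
        RicciFlow.IsSteadyGradientSoliton (g t) (f t))) ∧
    MonotoneOn (fun s ↦ RicciFlow.functionalF (g s) (f s)) J ∧
    (∀ t₁ ∈ J, ∀ t₂ ∈ J, t₁ < t₂ →
      RicciFlow.functionalF (g t₁) (f t₁) = RicciFlow.functionalF (g t₂) (f t₂) →
        ∀ t ∈ Icc t₁ t₂, RicciFlow.IsSteadyGradientSoliton (g t) (f t)) := by
  have hG : RicciFlow.Flow J g := ⟨⟨hJ, hJ', hg.1⟩, hg.2⟩
  have hfs : RicciFlow.ChartSmooth n J f := RicciFlow.chartSmooth_of_contMDiffOn hf.1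
  have hd : ∀ t ∈ J, HasDerivWithinAt (fun s ↦ RicciFlow.functionalF (g s) (f s))
      (2 * RicciFlow.solitonEnergy (g t) (f t)) J t := fun t ht ↦
    hG.hasDerivWithinAt_functionalF hfs hf.2 ht
  have hnn : ∀ t, 0 ≤ 2 * RicciFlow.solitonEnergy (g t) (f t) := fun t ↦
    mul_nonneg zero_le_two (RicciFlow.solitonEnergy_nonneg _ _)
  have hiff : ∀ t ∈ J, (2 * RicciFlow.solitonEnergy (g t) (f t) = 0 ↔
      RicciFlow.IsSteadyGradientSoliton (g t) (f t)) := fun t ht ↦ by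
    rw [mul_eq_zero_iff_left two_ne_zero]
    exact RicciFlow.solitonEnergy_eq_zero_iff (hg.1.smoothMetric ht)
      (RicciFlow.contMDiff_slice hf.1 ht)
  have hmono : MonotoneOn (fun s ↦ RicciFlow.functionalF (g s) (f s)) J := by
    -- The monotonicity criterion uses two-sided derivatives in the interior and mere continuity at
    -- the endpoints.
    have hi : ∀ t ∈ interior J, HasDerivAt (fun s ↦ RicciFlow.functionalF (g s) (f s))
        (2 * RicciFlow.solitonEnergy (g t) (f t)) t := fun t ht ↦
      (hd t (interior_subset ht)).hasDerivAt (mem_interior_iff_mem_nhds.1 ht)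
    refine monotoneOn_of_deriv_nonneg hJ.convex (fun t ht ↦ (hd t ht).continuousWithinAt)
      (fun t ht ↦ (hi t ht).differentiableAt.differentiableWithinAt) fun t ht ↦ ?_
    rw [(hi t ht).deriv]
    exact hnn t
  refine ⟨fun t ht ↦ ⟨?_, ?_, hd t ht, hnn t, hiff t ht⟩, hmono, ?_⟩
  · exact RicciFlow.integrable_of_continuous (hg.1.smoothMetric ht)
      (((hG.chartSmooth_scalarCurvature.add (hG.chartSmooth_gradNormSq hfs)).mul
        hfs.exp_neg).continuous ht)
  · exact RicciFlow.integrable_of_continuous (hg.1.smoothMetric ht)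
      (((hG.chartSmooth_ricciHessNormSq hfs).mul hfs.exp_neg).continuous ht)
  · intro t₁ h₁ t₂ h₂ h12 heq t ht
    have hsub : Icc t₁ t₂ ⊆ J := hJ.out h₁ h₂
    -- Monotonicity squeezes the value at s between the two equal values at t₁ and t₂.
    have hconst : ∀ s ∈ Icc t₁ t₂,
        RicciFlow.functionalF (g s) (f s) = RicciFlow.functionalF (g t₁) (f t₁) := fun s hs ↦
      le_antisymm ((hmono (hsub hs) h₂ hs.2).trans_eq heq.symm) (hmono h₁ (hsub hs) hs.1)
    -- Within [t₁, t₂] the functional has derivative twice the energy and, being constant there,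
    -- also derivative 0. Uniqueness within the closed interval covers t₁ and t₂ themselves.
    refine (hiff t (hsub ht)).1 ((uniqueDiffOn_Icc h12 t ht).eq_deriv _
      ((hd t (hsub ht)).mono hsub) ?_)
    exact (hasDerivWithinAt_const t _ (RicciFlow.functionalF (g t₁) (f t₁))).congr_of_mem hconst ht
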